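/- For a positive integer $d$, a distance-$d$ packing of two cycles in a graph $G$ is a pair of distinct cycles $C_1, C_2$ of $G$ such that $G$ has no path of length at most $d$ (paths of length $0$ included) with one end in $C_1$ and the other in $C_2$. There are an absolute constant $c$, a polynomial $p$, and a deterministic algorithm (a program on a random access machine with unit-cost addition and subtraction and without multiplication) such that the following holds for all positive integers $d$ and $t$ and every finite simple graph $G$ of maximum degree at most $t$. Given $G$ (by its adjacency matrix) and $d$, the algorithm halts after at most $p(|V(G)|)$ steps and outputs either a distance-$d$ packing of two cycles in $G$, or a set $X$ of at most $c\cdot d\cdot t^{2d}$ vertices of $G$ such that $G-X$ is a forest. -/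

import Mathlib

namespace CoarseErdosPosa

/-! ### Graph notions -/

/-- A subgraph of `G` is a cycle if it consists of the vertices and edges of a closed walk that
repeats neither an edge nor a vertex (other than its endpoint). -/
def IsCycleSubgraph {V : Type*} {G : SimpleGraph V} (C : G.Subgraph) : Prop :=
  ∃ (u : V) (w : G.Walk u u), w.IsCycle ∧ w.toSubgraph = C

/-- A set `F` of cycles of `G` is a distance-`d` packing if `G` has no path of length at most `d`
between any two distinct cycles in `F`. (Paths of length `0` count, so distinct cycles of a packing
are vertex-disjoint.) -/
def IsDistancePacking {V : Type*} (G : SimpleGraph V) (d : ℕ) (F : Set G.Subgraph) : Prop :=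
  (∀ C ∈ F, IsCycleSubgraph C) ∧
    ∀ C ∈ F, ∀ D ∈ F, C ≠ D →
      ∀ u ∈ C.verts, ∀ v ∈ D.verts, ∀ p : G.Walk u v, p.IsPath → ¬ p.length ≤ d

/-- `X` is a feedback vertex set of `G`: the graph `G - X` is a forest. -/
def IsFeedbackVertexSet {V : Type*} (G : SimpleGraph V) (X : Set V) : Prop :=
  (G.induce Xᶜ).IsAcyclic

/-! ### The machine model

A random access machine with finitely many named registers and arrays holding natural numbers, run
by structured programs. The only arithmetic operations are addition and truncated subtraction, each
of unit cost; there is no multiplication, so in `T` steps the bit length of the stored numbers grows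
by at most `O(T)`. Hence polynomial time on this machine is ordinary polynomial time. -/

/-- A memory state: registers `reg x`, and arrays `arr a` with cells `arr a i`. -/
structure Memory where
  reg : ℕ → ℕ
  arr : ℕ → ℕ → ℕ

/-- Expressions: constants, registers, array cells at a computed index, `+` and truncated `-`. -/
inductive Expr where
  | const (k : ℕ)
  | reg (x : ℕ)
  | cell (a : ℕ) (i : Expr)
  | add (e f : Expr)
  | sub (e f : Expr)

/-- The value of an expression. -/
def Expr.eval (s : Memory) : Expr → ℕ
  | .const k => k
  | .reg x => s.reg x
  | .cell a i => s.arr a (i.eval s)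
  | .add e f => e.eval s + f.eval s
  | .sub e f => e.eval s - f.eval s

/-- The number of steps needed to evaluate an expression: one for each operation in it. -/
def Expr.cost : Expr → ℕ
  | .const _ => 1
  | .reg _ => 1
  | .cell _ i => i.cost + 1
  | .add e f => e.cost + f.cost + 1
  | .sub e f => e.cost + f.cost + 1

/-- Programs. A test `e` succeeds if the value of `e` is nonzero. -/
inductive Program where
  | skip
  /-- store the value of `e` in register `x` -/
  | assign (x : ℕ) (e : Expr)
  /-- store the value of `e` in cell `i` of array `a` -/
  | write (a : ℕ) (i e : Expr)
  | seq (P Q : Program)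
  | ite (e : Expr) (P Q : Program)
  | loop (e : Expr) (P : Program)

/-- `Runs P s T s'`: started in memory `s`, the program `P` halts after exactly `T` steps, with
memory `s'`. -/
inductive Runs : Program → Memory → ℕ → Memory → Prop where
  | skip (s : Memory) : Runs .skip s 1 s
  | assign (s : Memory) (x : ℕ) (e : Expr) :
      Runs (.assign x e) s (e.cost + 1) ⟨Function.update s.reg x (e.eval s), s.arr⟩
  | write (s : Memory) (a : ℕ) (i e : Expr) :
      Runs (.write a i e) s (i.cost + e.cost + 1)
        ⟨s.reg, Function.update s.arr a (Function.update (s.arr a) (i.eval s) (e.eval s))⟩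
  | seq {P Q : Program} {s s' s'' : Memory} {T T' : ℕ} :
      Runs P s T s' → Runs Q s' T' s'' → Runs (.seq P Q) s (T + T') s''
  | ite_true {e : Expr} {P Q : Program} {s s' : Memory} {T : ℕ} :
      e.eval s ≠ 0 → Runs P s T s' → Runs (.ite e P Q) s (e.cost + 1 + T) s'
  | ite_false {e : Expr} {P Q : Program} {s s' : Memory} {T : ℕ} :
      e.eval s = 0 → Runs Q s T s' → Runs (.ite e P Q) s (e.cost + 1 + T) s'
  | loop_done {e : Expr} {P : Program} {s : Memory} :
      e.eval s = 0 → Runs (.loop e P) s (e.cost + 1) s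
  | loop_step {e : Expr} {P : Program} {s s' s'' : Memory} {T T' : ℕ} :
      e.eval s ≠ 0 → Runs P s T s' → Runs (.loop e P) s' T' s'' →
        Runs (.loop e P) s (e.cost + 1 + T + T') s''

/-- The machine is deterministic: final memory and number of steps are determined by the program and
the initial memory. -/
theorem Runs.deterministic {P : Program} {s s' s'' : Memory} {T T' : ℕ} (h : Runs P s T s')
    (h' : Runs P s T' s'') : T = T' ∧ s' = s'' := by
  induction h generalizing T' s'' with
  | skip => cases h'; simp
  | assign => cases h'; simp
  | write => cases h'; simp
  | seq _ _ i1 i2 =>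
    cases h' with
    | seq a b => obtain ⟨rfl, rfl⟩ := i1 a; obtain ⟨rfl, rfl⟩ := i2 b; simp
  | ite_true e _ i =>
    cases h' with
    | ite_true _ a => obtain ⟨rfl, rfl⟩ := i a; simp
    | ite_false a _ => exact absurd a e
  | ite_false e _ i =>
    cases h' with
    | ite_false _ a => obtain ⟨rfl, rfl⟩ := i a; simp
    | ite_true a _ => exact absurd e a
  | loop_done e =>
    cases h' with
    | loop_done => simp
    | loop_step a => exact absurd e a
  | loop_step e _ _ i1 i2 =>
    cases h' with
    | loop_done a => exact absurd a e
    | loop_step _ a b => obtain ⟨rfl, rfl⟩ := i1 a; obtain ⟨rfl, rfl⟩ := i2 b; simp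

/-! ### Input and output formats -/

/-- The initial memory on input `(G, d)`, where `G` is a graph on `{0, …, n - 1}`: register `0` holds
`n`, register `1` holds `d`, array `0` holds the adjacency matrix of `G` row by row, and everything
else is `0`. -/
def inputMemory {n : ℕ} (G : SimpleGraph (Fin n)) [DecidableRel G.Adj] (d : ℕ) : Memory where
  reg x := if x = 0 then n else if x = 1 then d else 0
  arr a m := if a = 0 ∧ ∃ i j : Fin n, m = (i : ℕ) * n + (j : ℕ) ∧ G.Adj i j then 1 else 0

/-- The list stored in array `a`, with its length stored in register `a`. -/
def Memory.list (s : Memory) (a : ℕ) : List ℕ :=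
  (List.range (s.reg a)).map (s.arr a)

/-- The memory `s` outputs the cycle `C` in array `a`: the list stored there is the sequence of
vertices of `C` in cyclic order, starting and ending at the same vertex. -/
def OutputsCycle {n : ℕ} {G : SimpleGraph (Fin n)} (s : Memory) (a : ℕ) (C : G.Subgraph) : Prop :=
  ∃ (u : Fin n) (w : G.Walk u u), w.IsCycle ∧ w.toSubgraph = C ∧
    w.support.map (fun v => (v : ℕ)) = s.list a

/-- The memory `s` outputs the vertex set `X` in array `a`: the list stored there enumerates the
elements of `X`, without repetition. -/
def OutputsSet {n : ℕ} (s : Memory) (a : ℕ) (X : Finset (Fin n)) : Prop :=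
  ∃ l : List (Fin n), l.Nodup ∧ l.toFinset = X ∧ l.map (fun v => (v : ℕ)) = s.list a

/-- Register `0` is `1`, and arrays `1` and `2` contain two distinct cycles of `G` that form a
distance-`d` packing. -/
def OutputsPacking {n : ℕ} (G : SimpleGraph (Fin n)) (d : ℕ) (s : Memory) : Prop :=
  s.reg 0 = 1 ∧ ∃ C D : G.Subgraph, C ≠ D ∧ IsDistancePacking G d {C, D} ∧
    OutputsCycle s 1 C ∧ OutputsCycle s 2 D

/-- Register `0` is `0`, and array `1` contains a feedback vertex set of `G` of size at most `b`. -/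
def OutputsFeedbackVertexSet {n : ℕ} (G : SimpleGraph (Fin n)) (b : ℕ) (s : Memory) : Prop :=
  s.reg 0 = 0 ∧ ∃ X : Finset (Fin n), X.card ≤ b ∧ IsFeedbackVertexSet G (X : Set (Fin n)) ∧
    OutputsSet s 1 X

end CoarseErdosPosa

/-! Call a set of vertices dense if each of its vertices has two neighbours in it. Cycles are dense,
and every nonempty dense set contains a cycle, so dense sets can replace cycles when minimizing and
when testing whether a set meets all cycles. Let `K` be the largest dense set (the 2-core) and `H`
the graph of the edges inside `K`. All cycles of `G` lie in `K`, and so does every path of `G`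
between two vertices of `K`; hence nothing is lost by working in `H`.

Give weight `n` to the branch vertices of `H` (those with three neighbours) and weight `1` to all
others, and let `C` be a nonempty dense set of least weight. It is the vertex set of a cycle. If
some cycle of `H` has distance more than `d` from `C`, there is a packing. Otherwise every nonempty
dense set meets the ball of radius `d` around `C`, and two facts give the set `X`.

First, `C` has at most `4 * d + 12` branch vertices (`MinDense.card_branch_le`). If some edge has an
end outside `C`, then `exists_ear` yields a vertex `y` outside `C` and walks to `C` from two
distinct neighbours of `y` that avoid `y` and weigh at most `n * (d + 2)` each. Together with either
arc of `C` between their ends they close up to a cycle at least as heavy as `C`; adding the two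
inequalities bounds the weight of `C` by `(4 * d + 10) * n`. If all edges lie inside `C`, a chord
bounds the weight by `2 * n`, and without branch vertices in `C` it is at most `n`.

Second, the ball of radius `d` around the branch vertices of `C`, with one more vertex of `C`, meets
every nonempty dense set (`MinDense.exists_mem_of_ball`): a walk can leave `C` only at a branch
vertex, and a dense set that meets `C` but none of its branch vertices contains all of `C`. A
geometric sum bounds the size of this ball.

To find `C`, take each vertex `v` as the root of a weighted shortest path tree. For any two vertices
`z` and `p`, the core of the union of their tree paths is dense and has weight at most `D z + D p +
w v`. If `v` lies in `C`, a suitable edge `z p` outside the tree makes this at most the weight of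
`C` and the core nonempty (`IsTree.exists_dense`). Everything is programmed with loops that run
exactly `n` times, so the time is polynomial for syntactic reasons (`runs_compile`), and correctness
is proved by loop invariants (`for_rule`). -/

namespace CoarseErdosPosa

/-! ### Programs whose loops are bounded by register `0` -/

/-- Store `v` in register `x`. -/
def setReg (s : Memory) (x v : ℕ) : Memory := ⟨Function.update s.reg x v, s.arr⟩

/-- Store `v` in cell `i` of array `a`. -/
def setCell (s : Memory) (a i v : ℕ) : Memory :=
  ⟨s.reg, Function.update s.arr a (Function.update (s.arr a) i v)⟩

@[simp] theorem reg_setReg (s : Memory) (x v y : ℕ) :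
    (setReg s x v).reg y = if y = x then v else s.reg y := by
  simp [setReg, Function.update_apply]

@[simp] theorem arr_setReg (s : Memory) (x v : ℕ) : (setReg s x v).arr = s.arr := rfl

@[simp] theorem reg_setCell (s : Memory) (a i v : ℕ) : (setCell s a i v).reg = s.reg := rfl

@[simp] theorem arr_setCell (s : Memory) (a i v b : ℕ) :
    (setCell s a i v).arr b = if b = a then Function.update (s.arr a) i v else s.arr b := by
  simp only [setCell, Function.update_apply]

/-- Programs with bounded loops: `for_ i P` runs `P` with register `i` equal to `0, …, n - 1`, where
`n` is the value of register `0`. -/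
inductive ForProgram where
  | skip
  | assign (x : ℕ) (e : Expr)
  | write (a : ℕ) (i e : Expr)
  | seq (P Q : ForProgram)
  | ite (e : Expr) (P Q : ForProgram)
  | for_ (i : ℕ) (P : ForProgram)

namespace ForProgram

/-- The machine program for a program with bounded loops. -/
def compile : ForProgram → Program
  | skip => .skip
  | assign x e => .assign x e
  | write a i e => .write a i e
  | seq P Q => .seq P.compile Q.compile
  | ite e P Q => .ite e P.compile Q.compile
  | for_ i P => .seq (.assign i (.const 0)) (.loop (.sub (.reg 0) (.reg i))
      (.seq P.compile (.assign i (.add (.reg i) (.const 1)))))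

/-- Apply `f 0, …, f (k - 1)` in turn. -/
def iter (f : ℕ → Memory → Memory) (s : Memory) : ℕ → Memory
  | 0 => s
  | k + 1 => f k (iter f s k)

/-- The final memory of a program with bounded loops. -/
def denote : ForProgram → Memory → Memory
  | skip, s => s
  | assign x e, s => setReg s x (e.eval s)
  | write a i e, s => setCell s a (i.eval s) (e.eval s)
  | seq P Q, s => Q.denote (P.denote s)
  | ite e P Q, s => if e.eval s ≠ 0 then P.denote s else Q.denote s
  | for_ i P, s => setReg (iter (fun k s => P.denote (setReg s i k)) s (s.reg 0)) i (s.reg 0)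

/-- The registers that a program may change. -/
def regs : ForProgram → List ℕ
  | skip => []
  | assign x _ => [x]
  | write _ _ _ => []
  | seq P Q => P.regs ++ Q.regs
  | ite _ P Q => P.regs ++ Q.regs
  | for_ i P => i :: P.regs

/-- The arrays that a program may change. -/
def arrs : ForProgram → List ℕ
  | skip => []
  | assign _ _ => []
  | write a _ _ => [a]
  | seq P Q => P.arrs ++ Q.arrs
  | ite _ P Q => P.arrs ++ Q.arrs
  | for_ _ P => P.arrs

/-- No loop changes its index or register `0`. -/
def wf : ForProgram → Bool
  | skip => true
  | assign _ _ => true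
  | write _ _ _ => true
  | seq P Q => P.wf && Q.wf
  | ite _ P Q => P.wf && Q.wf
  | for_ i P => P.wf && !P.regs.contains i && !(i :: P.regs).contains 0

/-- A bound for the running time, as a polynomial in the value of register `0`. -/
noncomputable def cost : ForProgram → Polynomial ℕ
  | skip => 1
  | assign _ e => .C (e.cost + 1)
  | write _ i e => .C (i.cost + e.cost + 1)
  | seq P Q => P.cost + Q.cost
  | ite e P Q => .C (e.cost + 1) + P.cost + Q.cost
  | for_ _ P => .X * (P.cost + 8) + 8

theorem reg_iter {f : ℕ → Memory → Memory} {r : ℕ} (h : ∀ k s, (f k s).reg r = s.reg r)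
    (s : Memory) (k : ℕ) : (iter f s k).reg r = s.reg r := by
  induction k with
  | zero => rfl
  | succ k ih => rw [iter, h, ih]

theorem arr_iter {f : ℕ → Memory → Memory} {a : ℕ} (h : ∀ k s, (f k s).arr a = s.arr a)
    (s : Memory) (k : ℕ) : (iter f s k).arr a = s.arr a := by
  induction k with
  | zero => rfl
  | succ k ih => rw [iter, h, ih]

theorem reg_denote (P : ForProgram) {r : ℕ} (h : r ∉ P.regs) (s : Memory) :
    (P.denote s).reg r = s.reg r := by
  induction P generalizing s with
  | skip => rfl
  | assign x e => simp only [regs, List.mem_singleton] at h; simp [denote, h]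
  | write => rfl
  | seq P Q ihP ihQ =>
    simp only [regs, List.mem_append, not_or] at h
    rw [denote, ihQ h.2, ihP h.1]
  | ite e P Q ihP ihQ =>
    simp only [regs, List.mem_append, not_or] at h
    rw [denote]; split_ifs
    · exact ihP h.1 s
    · exact ihQ h.2 s
  | for_ i P ih =>
    simp only [regs, List.mem_cons, not_or] at h
    rw [denote, reg_setReg, if_neg h.1, reg_iter]
    intro k s
    rw [ih h.2, reg_setReg, if_neg h.1]

theorem arr_denote (P : ForProgram) {a : ℕ} (h : a ∉ P.arrs) (s : Memory) :
    (P.denote s).arr a = s.arr a := by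
  induction P generalizing s with
  | skip => rfl
  | assign x e => rfl
  | write => simp only [arrs, List.mem_singleton] at h; simp [denote, h]
  | seq P Q ihP ihQ =>
    simp only [arrs, List.mem_append, not_or] at h
    rw [denote, ihQ h.2, ihP h.1]
  | ite e P Q ihP ihQ =>
    simp only [arrs, List.mem_append, not_or] at h
    rw [denote]; split_ifs
    · exact ihP h.1 s
    · exact ihQ h.2 s
  | for_ i P ih =>
    simp only [arrs] at h
    rw [denote, arr_setReg, arr_iter]
    intro k s
    rw [ih h, arr_setReg]

/-- No loop body changes its own index or register `0`, so every loop makes exactly `s.reg 0` rounds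
and one number serves as the argument of all nested cost polynomials. -/
theorem runs_compile (P : ForProgram) (hP : P.wf = true) (hP0 : 0 ∉ P.regs) (s : Memory) :
    ∃ T, Runs P.compile s T (P.denote s) ∧ T ≤ P.cost.eval (s.reg 0) := by
  induction P generalizing s with
  | skip => exact ⟨1, .skip s, by simp [cost]⟩
  | assign x e => exact ⟨_, .assign s x e, by simp [cost]⟩
  | write a i e => exact ⟨_, .write s a i e, by simp only [cost, Polynomial.eval_C]; exact le_rfl⟩
  | seq P Q ihP ihQ =>
    simp only [regs, List.mem_append, not_or] at hP0
    simp only [wf, Bool.and_eq_true] at hP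
    obtain ⟨T, h, hT⟩ := ihP hP.1 hP0.1 s
    obtain ⟨T', h', hT'⟩ := ihQ hP.2 hP0.2 (P.denote s)
    rw [reg_denote P hP0.1] at hT'
    refine ⟨_, .seq h h', ?_⟩
    simp only [cost, Polynomial.eval_add]; omega
  | ite e P Q ihP ihQ =>
    simp only [regs, List.mem_append, not_or] at hP0
    simp only [wf, Bool.and_eq_true] at hP
    obtain ⟨T, h, hT⟩ := ihP hP.1 hP0.1 s
    obtain ⟨T', h', hT'⟩ := ihQ hP.2 hP0.2 s
    by_cases he : e.eval s = 0
    · refine ⟨_, by rw [denote, if_neg (not_not.2 he)]; exact .ite_false he h', ?_⟩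
      simp only [cost, Polynomial.eval_add, Polynomial.eval_C]; omega
    · refine ⟨_, by rw [denote, if_pos he]; exact .ite_true he h, ?_⟩
      simp only [cost, Polynomial.eval_add, Polynomial.eval_C]; omega
  | for_ i P ih =>
    simp only [wf, Bool.and_eq_true, Bool.not_eq_true', List.contains_eq_mem,
      decide_eq_false_iff_not, List.mem_cons, not_or] at hP
    obtain ⟨⟨hwf, hi⟩, h0i, h0⟩ := hP
    set f : ℕ → Memory → Memory := fun k s => P.denote (setReg s i k) with hf
    have hreg0 : ∀ k, (iter f s k).reg 0 = s.reg 0 := fun k => reg_iter (by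
      intro k s; rw [hf]; simp only; rw [reg_denote P h0, reg_setReg, if_neg h0i]) s k
    set n := s.reg 0 with hn
    -- Besides the body, a round costs 4 for the test and 4 for the increment of the index; the
    -- final failing test costs 4.
    have main : ∀ m k, k + m = n → ∃ T,
        Runs (.loop (.sub (.reg 0) (.reg i))
          (.seq P.compile (.assign i (.add (.reg i) (.const 1))))) (setReg (iter f s k) i k) T
          (setReg (iter f s n) i n) ∧ T ≤ m * (P.cost.eval n + 8) + 4 := by
      intro m
      induction m with
      | zero =>
        intro k hk
        obtain rfl : k = n := by omega
        refine ⟨_, .loop_done ?_, ?_⟩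
        · simp [Expr.eval, h0i, hreg0]
        · simp [Expr.cost]
      | succ m ihm =>
        intro k hk
        obtain ⟨T, hT, hTle⟩ := ihm (k + 1) (by omega)
        obtain ⟨T', hT', hTle'⟩ := ih hwf h0 (setReg (iter f s k) i k)
        have e : (⟨Function.update (P.denote (setReg (iter f s k) i k)).reg i
            ((Expr.add (.reg i) (.const 1)).eval (P.denote (setReg (iter f s k) i k))),
            (P.denote (setReg (iter f s k) i k)).arr⟩ : Memory)
            = setReg (iter f s (k + 1)) i (k + 1) := by
          rw [Expr.eval, Expr.eval, Expr.eval, reg_denote P hi, reg_setReg, if_pos rfl]; rfl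
        refine ⟨_, .loop_step ?_ (.seq hT' (.assign _ _ _)) (e ▸ hT), ?_⟩
        · simp only [Expr.eval, reg_setReg, if_neg h0i, hreg0, if_true]; omega
        · rw [reg_setReg, if_neg h0i, hreg0] at hTle'
          simp only [Expr.cost]
          nlinarith
    obtain ⟨T, hT, hTle⟩ := main n 0 (by omega)
    refine ⟨_, .seq (.assign _ _ _) hT, ?_⟩
    simp only [Expr.cost, cost, Polynomial.eval_add, Polynomial.eval_mul, Polynomial.eval_X]
    have : Polynomial.eval n (8 : Polynomial ℕ) = 8 := Polynomial.eval_ofNat ..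
    rw [this]; omega

/-- The memories `s` and `s'` differ only where `P` may change them. -/
def Frame (P : ForProgram) (s s' : Memory) : Prop :=
  (∀ r, r ∉ P.regs → s'.reg r = s.reg r) ∧ ∀ a, a ∉ P.arrs → s'.arr a = s.arr a

theorem frame_denote (P : ForProgram) (s : Memory) : P.Frame s (P.denote s) :=
  ⟨fun _ h => reg_denote P h s, fun _ h => arr_denote P h s⟩

/-- The invariant rule for bounded loops. -/
theorem for_rule {i : ℕ} {P : ForProgram} {s : Memory} (I : ℕ → Memory → Prop)
    (hset : ∀ k s' x, I k s' → I k (setReg s' i x)) (h0 : I 0 s)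
    (hstep : ∀ k s', k < s.reg 0 → Frame (for_ i P) s s' → s'.reg i = k → I k s' →
      I (k + 1) (P.denote s')) :
    I (s.reg 0) ((for_ i P).denote s) := by
  -- The loop leaves its index at `s.reg 0`; this last change is absorbed by `hset`. The frame is
  -- carried along so that each step may use all that the body leaves untouched.
  suffices ∀ k ≤ s.reg 0, Frame (for_ i P) s (iter (fun k s => P.denote (setReg s i k)) s k) ∧
      I k (iter (fun k s => P.denote (setReg s i k)) s k) from hset _ _ _ (this _ le_rfl).2
  intro k hk
  induction k with
  | zero => exact ⟨⟨fun _ _ => rfl, fun _ _ => rfl⟩, h0⟩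
  | succ k ih =>
    obtain ⟨hF, hI⟩ := ih (by omega)
    have hF' : Frame (for_ i P) s
        (setReg (iter (fun k s => P.denote (setReg s i k)) s k) i k) := by
      refine ⟨fun r hr => ?_, fun a ha => hF.2 a ha⟩
      rw [reg_setReg, if_neg, hF.1 r hr]
      simp only [regs, List.mem_cons, not_or] at hr; exact hr.1
    refine ⟨⟨fun r hr => ?_, fun a ha => ?_⟩, hstep k _ (by omega) hF' (by simp) (hset _ _ _ hI)⟩
    · rw [iter, reg_denote, hF'.1 r hr]
      simp only [regs, List.mem_cons, not_or] at hr; exact hr.2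
    · rw [iter, arr_denote, hF'.2 a ha]; exact ha

end ForProgram

/-! ### Sets of minimum degree two -/

section Dense

variable {V : Type*} {H : SimpleGraph V}

/-- Every vertex of `U` has two distinct neighbours in `U`. -/
def Dense (H : SimpleGraph V) (U : Finset V) : Prop :=
  ∀ x ∈ U, ∃ y ∈ U, ∃ z ∈ U, y ≠ z ∧ H.Adj x y ∧ H.Adj x z

theorem Dense.mono {H' : SimpleGraph V} {U : Finset V} (hU : Dense H U)
    (h : ∀ x ∈ U, ∀ y ∈ U, H.Adj x y → H'.Adj x y) : Dense H' U := by
  intro x hx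
  obtain ⟨y, hy, z, hz, hyz, h1, h2⟩ := hU x hx
  exact ⟨y, hy, z, hz, hyz, h x hx y hy h1, h x hx z hz h2⟩

theorem exists_walk_of_seq {g : ℕ → V} (k : ℕ) (hadj : ∀ l < k, H.Adj (g l) (g (l + 1))) :
    ∃ p : H.Walk (g 0) (g k), p.support = (List.range (k + 1)).map g := by
  induction k with
  | zero => exact ⟨.nil, by simp⟩
  | succ k ih =>
    obtain ⟨p, hp⟩ := ih fun l hl => hadj l (by omega)
    refine ⟨p.concat (hadj k (by omega)), ?_⟩
    rw [SimpleGraph.Walk.support_concat, hp, List.range_succ (n := k + 1), List.map_append]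
    simp

theorem exists_cycle_of_seq {g : ℕ → V} {k : ℕ} (hk : 3 ≤ k)
    (hadj : ∀ l < k, H.Adj (g l) (g (l + 1))) (h0 : g k = g 0)
    (hinj : ∀ a b, a < b → b < k → g a ≠ g b) :
    ∃ w : H.Walk (g 0) (g 0), w.IsCycle ∧ w.support = (List.range (k + 1)).map g := by
  obtain ⟨p, hp⟩ := exists_walk_of_seq k hadj
  refine ⟨p.copy rfl h0, ?_, by simpa using hp⟩
  have hlen : (p.copy rfl h0).length = k := by
    have := congrArg List.length hp
    simpa using this
  rw [SimpleGraph.Walk.isCycle_iff_isPath_tail_and_le_length]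
  refine ⟨?_, by omega⟩
  rw [SimpleGraph.Walk.isPath_def, SimpleGraph.Walk.support_tail_of_not_nil]
  · rw [SimpleGraph.Walk.support_copy, hp, List.range_succ_eq_map]
    simp only [List.map_cons, List.tail_cons, List.map_map]
    refine List.Nodup.map_on ?_ List.nodup_range
    intro a ha b hb hab
    simp only [List.mem_range, Function.comp, Nat.succ_eq_add_one] at ha hb hab
    by_contra hne
    -- After dropping the first vertex the indices run from `1` to `k`, and `g k = g 0` takes the
    -- place of the missing index `0`.
    have key : ∀ a b, a < b → b < k → g (a + 1) ≠ g (b + 1) := by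
      intro a b hab hb h
      rcases Nat.lt_or_ge (b + 1) k with h' | h'
      · exact hinj _ _ (by omega) h' h
      · obtain rfl : b + 1 = k := by omega
        exact hinj 0 (a + 1) (by omega) (by omega) (by rw [h, h0])
    rcases Nat.lt_or_gt_of_ne hne with h | h
    · exact key a b h hb hab
    · exact key b a h ha hab.symm
  · rw [← SimpleGraph.Walk.length_eq_zero_iff]; omega

/-- When the cycle is rotated to start at a given vertex, its second and its penultimate vertex are
two distinct neighbours of that vertex. -/
theorem dense_of_isCycle [DecidableEq V] {u : V} {w : H.Walk u u} (hw : w.IsCycle) :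
    Dense H w.support.toFinset := by
  intro x hx
  rw [List.mem_toFinset] at hx
  have hc := hw.rotate hx
  have hmem : ∀ y ∈ (w.rotate x hx).support, y ∈ w.support.toFinset := fun y hy => by
    rw [List.mem_toFinset]; exact (w.mem_support_rotate_iff x hx).1 hy
  exact ⟨_, hmem _ (SimpleGraph.Walk.getVert_mem_support _ _), _,
    hmem _ (SimpleGraph.Walk.getVert_mem_support _ _), hc.snd_ne_penultimate,
    SimpleGraph.Walk.adj_snd hc.not_nil, (SimpleGraph.Walk.adj_penultimate hc.not_nil).symm⟩

/-- The walk joins the ends of the edge without using it, so the edge lies on a cycle. Working in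
the graph of all edges between vertices of the walk keeps this cycle inside the support. The walk
need not be a path, so closed walks can be glued together without care. -/
theorem exists_dense_of_walk [DecidableEq V] {x y : V} (h : H.Adj x y) (p : H.Walk x y)
    (hp : s(x, y) ∉ p.edges) : ∃ U : Finset V, U ⊆ p.support.toFinset ∧ U.Nonempty ∧ Dense H U := by
  let H' : SimpleGraph V :=
    { Adj := fun a b => H.Adj a b ∧ a ∈ p.support ∧ b ∈ p.support
      symm := ⟨fun a b h => ⟨h.1.symm, h.2.2, h.2.1⟩⟩
      loopless := ⟨fun a h => h.1.ne rfl⟩ }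
  have hreach : (H' \ SimpleGraph.fromEdgeSet {s(x, y)}).Reachable x y := by
    refine ⟨p.transfer _ ?_⟩
    intro e he
    induction e with | h a b => ?_
    rw [SimpleGraph.mem_edgeSet, SimpleGraph.sdiff_adj, SimpleGraph.fromEdgeSet_adj]
    refine ⟨⟨p.adj_of_mem_edges he, p.fst_mem_support_of_mem_edges he,
      p.snd_mem_support_of_mem_edges he⟩, fun hh => hp ?_⟩
    rw [← Set.mem_singleton_iff.1 hh.1]; exact he
  obtain ⟨u, w, hw, -⟩ := SimpleGraph.adj_and_reachable_delete_edges_iff_exists_cycle.1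
    ⟨(⟨h, p.start_mem_support, p.end_mem_support⟩ : H'.Adj x y), hreach⟩
  refine ⟨w.support.toFinset, fun z hz => ?_, ⟨u, by simp⟩, ?_⟩
  · obtain ⟨a, -, -, -, -, ha, -⟩ := dense_of_isCycle hw z hz
    exact List.mem_toFinset.2 ha.2.1
  · exact (dense_of_isCycle hw).mono fun _ _ _ _ h => h.1

/-- A non-backtracking walk in a dense set. -/
theorem Dense.exists_seq {U : Finset V} (hU : Dense H U) (hne : U.Nonempty) :
    ∃ f : ℕ → V, (∀ i, f i ∈ U) ∧ (∀ i, H.Adj (f i) (f (i + 1))) ∧ ∀ i, f (i + 2) ≠ f i := by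
  -- The states are oriented edges inside `U`. The head of such an edge has two neighbours in `U`,
  -- and one of them is not the tail.
  have step : ∀ q : {q : V × V // q.1 ∈ U ∧ q.2 ∈ U ∧ H.Adj q.1 q.2},
      ∃ q' : {q : V × V // q.1 ∈ U ∧ q.2 ∈ U ∧ H.Adj q.1 q.2},
        q'.1.1 = q.1.2 ∧ q'.1.2 ≠ q.1.1 := by
    rintro ⟨⟨a, b⟩, ha, hb, hab⟩
    obtain ⟨y, hy, z, hz, hyz, h1, h2⟩ := hU b hb
    by_cases h : y = a
    · exact ⟨⟨(b, z), hb, hz, h2⟩, rfl, fun h' => hyz (h.trans h'.symm)⟩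
    · exact ⟨⟨(b, y), hb, hy, h1⟩, rfl, h⟩
  choose F hF1 hF2 using step
  obtain ⟨x, hx⟩ := hne
  obtain ⟨y, hy, -, -, -, h, -⟩ := hU x hx
  let q : ℕ → {q : V × V // q.1 ∈ U ∧ q.2 ∈ U ∧ H.Adj q.1 q.2} :=
    fun i => F^[i] ⟨(x, y), hx, hy, h⟩
  have hq : ∀ i, q (i + 1) = F (q i) := fun i => Function.iterate_succ_apply' F i _
  have h1 : ∀ i, (q (i + 1)).1.1 = (q i).1.2 := fun i => by rw [hq]; exact hF1 _
  refine ⟨fun i => (q i).1.1, fun i => (q i).2.1, fun i => ?_, fun i => ?_⟩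
  · simp only [h1]; exact (q i).2.2.2
  · simp only [h1 (i + 1)]; rw [hq]; exact hF2 _

/-- The part of a non-backtracking walk in a finite graph between a vertex and its first
repetition is a cycle. -/
theorem exists_cycle_of_gap {f : ℕ → V} {m i k : ℕ}
    (hadj : ∀ l < m, H.Adj (f l) (f (l + 1))) (hback : ∀ l, l + 2 ≤ m → f (l + 2) ≠ f l)
    (him : i + k ≤ m) (hk : 0 < k) (hik : f (i + k) = f i)
    (hmin : ∀ a b, a < b → b ≤ m → f a = f b → k ≤ b - a) :
    ∃ w : H.Walk (f i) (f i), w.IsCycle ∧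
      w.support = (List.range (k + 1)).map fun l => f (i + l) := by
  have hk3 : 3 ≤ k := by
    rcases (by omega : k = 1 ∨ k = 2 ∨ 3 ≤ k) with rfl | rfl | h
    · exact absurd hik.symm (hadj i (by omega)).ne
    · exact absurd hik (hback i him)
    · exact h
  exact exists_cycle_of_seq (g := fun l => f (i + l)) hk3
    (fun l hl => hadj (i + l) (by omega)) (by simpa using hik)
    fun a b hab hb h => by have := hmin (i + a) (i + b) (by omega) (by omega) h; omega

theorem exists_gap [Fintype V] (f : ℕ → V) :
    ∃ i k, i + k ≤ Fintype.card V ∧ 0 < k ∧ f (i + k) = f i := by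
  obtain ⟨a, b, hab, h⟩ := Fintype.exists_ne_map_eq_of_card_lt
    (fun i : Fin (Fintype.card V + 1) => f i) (by simp)
  rcases Nat.lt_or_gt_of_ne (Fin.val_ne_of_ne hab) with h' | h'
  · exact ⟨a, b - a, by omega, by omega, by rw [Nat.add_sub_cancel' h'.le]; exact h.symm⟩
  · exact ⟨b, a - b, by omega, by omega, by rw [Nat.add_sub_cancel' h'.le]; exact h⟩

/-- Among the first `card V + 1` entries of a non-backtracking walk some vertex repeats, and a
repetition at the least possible gap closes a cycle. -/
theorem Dense.exists_isCycle [Fintype V] {U : Finset V} (hU : Dense H U) (hne : U.Nonempty) :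
    ∃ (u : V) (w : H.Walk u u), w.IsCycle ∧ ∀ x ∈ w.support, x ∈ U := by
  classical
  obtain ⟨f, hf, hadj, hback⟩ := hU.exists_seq hne
  have hex : ∃ k, 0 < k ∧ ∃ i, i + k ≤ Fintype.card V ∧ f (i + k) = f i := by
    obtain ⟨i, k, h1, h2, h3⟩ := exists_gap f
    exact ⟨k, h2, i, h1, h3⟩
  obtain ⟨hk, i, him, hik⟩ := Nat.find_spec hex
  obtain ⟨w, hw, hs⟩ := exists_cycle_of_gap (fun l _ => hadj l) (fun l _ => hback l) him hk hik
    fun a b hab hb h => Nat.find_min' hex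
      ⟨by omega, a, by omega, by rw [Nat.add_sub_cancel' hab.le]; exact h.symm⟩
  refine ⟨_, w, hw, fun x hx => ?_⟩
  rw [hs, List.mem_map] at hx
  obtain ⟨l, -, rfl⟩ := hx
  exact hf _

end Dense

/-! ### Weights of walks and minimum dense sets -/

section MinDense

variable {V : Type*} {H : SimpleGraph V} {w : V → ℕ}

/-- The total weight of the vertices of a walk, with multiplicity. -/
def walkWeight (w : V → ℕ) {a b : V} (p : H.Walk a b) : ℕ := (p.support.map w).sum

@[simp] theorem walkWeight_nil (a : V) : walkWeight w (.nil : H.Walk a a) = w a := by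
  simp [walkWeight]

@[simp] theorem walkWeight_cons {a b c : V} (h : H.Adj a b) (p : H.Walk b c) :
    walkWeight w (.cons h p) = w a + walkWeight w p := by
  simp [walkWeight]

@[simp] theorem walkWeight_reverse {a b : V} (p : H.Walk a b) :
    walkWeight w p.reverse = walkWeight w p := by
  simp [walkWeight, List.sum_reverse]

theorem walkWeight_append {a b c : V} (p : H.Walk a b) (q : H.Walk b c) :
    walkWeight w (p.append q) + w b = walkWeight w p + walkWeight w q := by
  induction p with
  | nil => simp [add_comm]
  | cons h p ih => simp only [SimpleGraph.Walk.cons_append, walkWeight_cons]; have := ih q; omega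

theorem exists_split_of_mem_edges {a b x y : V} (p : H.Walk a b) (h : s(x, y) ∈ p.edges) :
    ∃ (x' y' : V) (h' : H.Adj x' y') (q : H.Walk a x') (r : H.Walk y' b),
      s(x', y') = s(x, y) ∧ p = q.append (.cons h' r) := by
  induction p with
  | nil => simp at h
  | cons hadj p ih =>
    rw [SimpleGraph.Walk.edges_cons, List.mem_cons] at h
    rcases h with h | h
    · exact ⟨_, _, hadj, .nil, p, h.symm, rfl⟩
    · obtain ⟨x', y', h', q, r, e, rfl⟩ := ih h
      exact ⟨x', y', h', .cons hadj q, r, e, rfl⟩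

/-- A nonempty dense set of minimum weight. -/
structure MinDense (H : SimpleGraph V) (w : V → ℕ) (C : Finset V) : Prop where
  nonempty : C.Nonempty
  dense : Dense H C
  le : ∀ U : Finset V, U.Nonempty → Dense H U → ∑ x ∈ C, w x ≤ ∑ x ∈ U, w x

theorem exists_minDense [Fintype V] {U : Finset V} (hne : U.Nonempty) (hU : Dense H U) :
    ∃ C, MinDense H w C := by
  classical
  obtain ⟨C, hC, hmin⟩ := (Finset.univ.filter fun U : Finset V => U.Nonempty ∧ Dense H U)
    |>.exists_min_image (fun U => ∑ x ∈ U, w x) ⟨U, by simp [hne, hU]⟩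
  simp only [Finset.mem_filter, Finset.mem_univ, true_and] at hC hmin
  exact ⟨C, hC.1, hC.2, fun U h h' => hmin U ⟨h, h'⟩⟩

theorem weight_start_le {a b : V} (p : H.Walk a b) : w a ≤ walkWeight w p := by
  cases p <;> simp

variable [DecidableEq V]

theorem sum_toFinset_le (l : List V) : ∑ x ∈ l.toFinset, w x ≤ (l.map w).sum := by
  induction l with
  | nil => simp
  | cons a l ih =>
    rw [List.toFinset_cons, List.map_cons, List.sum_cons]
    by_cases h : a ∈ l.toFinset
    · rw [Finset.insert_eq_of_mem h]; omega
    · rw [Finset.sum_insert h]; omega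

theorem sum_support_le {a b : V} (p : H.Walk a b) :
    ∑ x ∈ p.support.toFinset, w x ≤ walkWeight w p := sum_toFinset_le _

theorem walkWeight_eq_of_isPath {a b : V} {p : H.Walk a b} (hp : p.IsPath) :
    walkWeight w p = ∑ x ∈ p.support.toFinset, w x :=
  (List.sum_toFinset w hp.support_nodup).symm

theorem walkWeight_dropUntil_le {a b x : V} (p : H.Walk a b) (hx : x ∈ p.support) (ha : x ≠ a) :
    walkWeight w (p.dropUntil x hx) + w a ≤ walkWeight w p := by
  have h := walkWeight_append (w := w) (p.takeUntil x hx) (p.dropUntil x hx)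
  rw [SimpleGraph.Walk.take_spec] at h
  have : w a + w x ≤ walkWeight w (p.takeUntil x hx) := by
    generalize p.takeUntil x hx = q
    cases q with
    | nil => exact absurd rfl ha
    | cons h q =>
      rw [walkWeight_cons]
      have := weight_start_le (w := w) q.reverse
      rw [walkWeight_reverse] at this; omega
  omega

theorem walkWeight_of_isCycle {u : V} {p : H.Walk u u} (hp : p.IsCycle) :
    walkWeight w p = ∑ x ∈ p.support.toFinset, w x + w u := by
  have h1 : p.support = u :: p.support.tail := p.cons_tail_support.symm
  have h2 : p.support.toFinset = p.support.tail.toFinset := by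
    ext x
    rw [List.mem_toFinset, List.mem_toFinset, h1]
    simp only [List.tail_cons, List.mem_cons]
    exact ⟨fun h => h.elim (fun h => h ▸ p.end_mem_tail_support hp.not_nil) id, Or.inr⟩
  rw [h2, List.sum_toFinset w hp.support_nodup, walkWeight]
  conv_lhs => rw [h1]
  rw [List.map_cons, List.sum_cons, add_comm]

variable {C : Finset V}

/-- With positive weights a proper subset is strictly lighter, so a set of minimum weight is also
minimal under inclusion. This is what turns `C` into the vertex set of a cycle. -/
theorem MinDense.eq_of_subset (hC : MinDense H w C) (hw : ∀ x, 0 < w x) {U : Finset V}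
    (hUC : U ⊆ C) (hne : U.Nonempty) (hU : Dense H U) : U = C := by
  by_contra h
  obtain ⟨x, hx, hxU⟩ := Finset.exists_of_ssubset (hUC.ssubset_of_ne h)
  exact absurd (hC.le U hne hU)
    (not_le.2 (Finset.sum_lt_sum_of_subset hUC hx hxU (hw x) fun _ _ _ => Nat.zero_le _))

theorem MinDense.exists_isCycle [Fintype V] (hC : MinDense H w C) (hw : ∀ x, 0 < w x) {u : V}
    (hu : u ∈ C) : ∃ p : H.Walk u u, p.IsCycle ∧ p.support.toFinset = C := by
  obtain ⟨v, p, hp, hpC⟩ := hC.dense.exists_isCycle hC.nonempty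
  have h := hC.eq_of_subset hw (fun x hx => hpC x (List.mem_toFinset.1 hx)) ⟨v, by simp⟩
    (dense_of_isCycle hp)
  have hu' : u ∈ p.support := by rw [← List.mem_toFinset, h]; exact hu
  refine ⟨p.rotate u hu', hp.rotate hu', ?_⟩
  rw [← h]; ext x
  simp only [List.mem_toFinset, SimpleGraph.Walk.mem_support_rotate_iff]

/-- Two vertices of a minimum dense set are joined by two arcs. -/
theorem exists_arcs {a b : V} {p : H.Walk b b} (hp : p.IsCycle) (hpC : p.support.toFinset = C)
    (ha : a ∈ C) :
    ∃ q r : H.Walk b a, (∀ x ∈ q.support, x ∈ C) ∧ (∀ x ∈ r.support, x ∈ C) ∧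
      (∀ e ∈ q.edges, e ∈ p.edges) ∧ (∀ e ∈ r.edges, e ∈ p.edges) ∧
      walkWeight w q + walkWeight w r = ∑ x ∈ C, w x + w a + w b := by
  have ha' : a ∈ p.support := by rw [← List.mem_toFinset, hpC]; exact ha
  refine ⟨p.takeUntil a ha', (p.dropUntil a ha').reverse, fun x hx => ?_, fun x hx => ?_,
    fun e he => p.edges_takeUntil_subset_edges ha' he, fun e he => ?_, ?_⟩
  · rw [← hpC, List.mem_toFinset]; exact p.support_takeUntil_subset_support ha' hx
  · rw [← hpC, List.mem_toFinset]
    rw [SimpleGraph.Walk.support_reverse, List.mem_reverse] at hx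
    exact p.support_dropUntil_subset_support ha' hx
  · rw [SimpleGraph.Walk.edges_reverse, List.mem_reverse] at he
    exact p.edges_dropUntil_subset_edges ha' he
  · have h := walkWeight_append (w := w) (p.takeUntil a ha') (p.dropUntil a ha')
    rw [SimpleGraph.Walk.take_spec, walkWeight_of_isCycle hp, hpC] at h
    rw [walkWeight_reverse]; omega

/-- The walk and the edge closing it contain a dense set. All upper bounds on the weight of `C` come
from this inequality, applied to walks that run along an arc of `C`. -/
theorem MinDense.le_walkWeight (hC : MinDense H w C) {x y : V} (h : H.Adj x y) (p : H.Walk x y)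
    (hp : s(x, y) ∉ p.edges) : ∑ x ∈ C, w x ≤ walkWeight w p := by
  obtain ⟨U, hUp, hne, hU⟩ := exists_dense_of_walk h p hp
  exact (hC.le U hne hU).trans ((Finset.sum_le_sum_of_subset hUp).trans (sum_support_le p))

/-- Go from `y` through `x'` to `C`, along one of the two arcs of `C`, and back to `x`. This walk
avoids the edge from `y` to `x`, because its other parts do not visit `y`; so it weighs at least as
much as `C`. The two arcs weigh as much as `C` with their ends counted twice, and summing over both
arcs leaves one copy of the weight of `C` on the left. -/
theorem MinDense.weight_le_of_ear [Fintype V] (hC : MinDense H w C) (hw : ∀ x, 0 < w x)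
    {x x' y a b : V} (hxx' : x ≠ x') (hx : H.Adj y x) (hx' : H.Adj y x') (hy : y ∉ C)
    (ha : a ∈ C) (hb : b ∈ C) (p : H.Walk x a) (p' : H.Walk x' b) (hp : y ∉ p.support)
    (hp' : y ∉ p'.support) :
    ∑ x ∈ C, w x ≤ 2 * (w y + walkWeight w p + walkWeight w p') := by
  obtain ⟨c, hc, hcC⟩ := hC.exists_isCycle hw hb
  obtain ⟨q, r, hq, hr, -, -, hqr⟩ := exists_arcs (w := w) hc hcC ha
  have key : ∀ q : H.Walk b a, (∀ x ∈ q.support, x ∈ C) →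
      ∑ x ∈ C, w x + w a + w b ≤
        w y + walkWeight w p + walkWeight w p' + walkWeight w q := by
    intro q hq
    have := hC.le_walkWeight hx (.cons hx' (p'.append (q.append p.reverse))) (by
      rw [SimpleGraph.Walk.edges_cons, SimpleGraph.Walk.edges_append,
        SimpleGraph.Walk.edges_append, List.mem_cons, List.mem_append, List.mem_append]
      rintro (h | h | h | h)
      · rcases Sym2.eq_iff.1 h with h | h
        · exact hxx' h.2
        · exact hx'.ne h.1
      · exact hp' (p'.fst_mem_support_of_mem_edges h)
      · exact hy (hq _ (q.fst_mem_support_of_mem_edges h))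
      · rw [SimpleGraph.Walk.edges_reverse, List.mem_reverse] at h
        exact hp (p.fst_mem_support_of_mem_edges h))
    have h1 := walkWeight_append (w := w) p' (q.append p.reverse)
    have h2 := walkWeight_append (w := w) q p.reverse
    rw [walkWeight_cons] at this
    rw [walkWeight_reverse] at h2
    omega
  have h1 := key q hq
  have h2 := key r hr
  omega

/-- One of the three edges at `y` is a chord `y x` of the cycle. Each of the two arcs between its
ends is closed by the chord and thus weighs at least as much as `C`, while together they exceed the
weight of `C` only by `w x + w y`. -/
theorem MinDense.weight_le_of_chord [Fintype V] (hC : MinDense H w C) (hw : ∀ x, 0 < w x)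
    {y z₁ z₂ z₃ : V} (hy : y ∈ C) (hz₁ : z₁ ∈ C) (hz₂ : z₂ ∈ C) (hz₃ : z₃ ∈ C)
    (h₁₂ : z₁ ≠ z₂) (h₁₃ : z₁ ≠ z₃) (h₂₃ : z₂ ≠ z₃) (h₁ : H.Adj y z₁) (h₂ : H.Adj y z₂)
    (h₃ : H.Adj y z₃) {m : ℕ} (hm : ∀ x, w x ≤ m) : ∑ x ∈ C, w x ≤ 2 * m := by
  obtain ⟨c, hc, hcC⟩ := hC.exists_isCycle hw hy
  obtain ⟨x, hx, hxC, hx1, hx2⟩ : ∃ x, H.Adj y x ∧ x ∈ C ∧ x ≠ c.snd ∧ x ≠ c.penultimate := by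
    by_contra! hcon
    by_cases e1 : z₁ = c.snd
    · have e2 := hcon z₂ h₂ hz₂ (fun h => h₁₂ (e1.trans h.symm))
      have e3 := hcon z₃ h₃ hz₃ (fun h => h₁₃ (e1.trans h.symm))
      exact h₂₃ (e2.trans e3.symm)
    · have e1' := hcon z₁ h₁ hz₁ e1
      by_cases e2 : z₂ = c.snd
      · exact h₁₃ (e1'.trans (hcon z₃ h₃ hz₃ (fun h => h₂₃ (e2.trans h.symm))).symm)
      · exact h₁₂ (e1'.trans (hcon z₂ h₂ hz₂ e2).symm)
  -- The cycle starts at `y`, so its only edges at `y` are the first and the last one.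
  have hce : s(y, x) ∉ c.edges := by
    intro h
    cases c with
    | nil => simp at h
    | cons hadj c =>
      rw [SimpleGraph.Walk.edges_cons, List.mem_cons] at h
      rcases h with h | h
      · rcases Sym2.eq_iff.1 h with h | h
        · exact hx1 (by simpa using h.2)
        · exact hx.ne h.2.symm
      · have hpath := ((SimpleGraph.Walk.cons_isCycle_iff _ _).1 hc).1
        have hnil : ¬ c.Nil := SimpleGraph.Walk.not_nil_of_ne hadj.symm.ne
        rw [SimpleGraph.Walk.penultimate_cons_of_not_nil _ _ hnil] at hx2
        exact hx2 (hpath.eq_penultimate_of_mem_edges h)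
  obtain ⟨q, r, -, -, hq, hr, hqr⟩ := exists_arcs (w := w) hc hcC hxC
  have h1 := hC.le_walkWeight hx q fun h => hce (hq _ h)
  have h2 := hC.le_walkWeight hx r fun h => hce (hr _ h)
  have := hm x
  have := hm y
  omega

end MinDense

/-! ### Minimum dense sets with few branch vertices -/

section Branch

variable {V : Type*} {H : SimpleGraph V}

/-- The vertex `x` has at least three neighbours. -/
def Branch (H : SimpleGraph V) (x : V) : Prop :=
  ∃ a b c, a ≠ b ∧ a ≠ c ∧ b ≠ c ∧ H.Adj x a ∧ H.Adj x b ∧ H.Adj x c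

/-- The set `X` contains all vertices at distance at most `d` from `S`. -/
def ContainsBall (H : SimpleGraph V) (d : ℕ) (S X : Finset V) : Prop :=
  ∀ a ∈ S, ∀ x, ∀ p : H.Walk a x, p.length ≤ d → x ∈ X

open scoped Classical in
/-- A vertex that a walk with at most `m` branch vertices joins to `C`. -/
def Near (H : SimpleGraph V) (C : Finset V) (m : ℕ) (x : V) : Prop :=
  ∃ a ∈ C, ∃ p : H.Walk x a, (p.support.toFinset.filter (Branch H)).card ≤ m

variable {C : Finset V} {w : V → ℕ}

theorem Near.of_walk {m : ℕ} {x y : V} (hx : Near H C m x) (h : H.Adj y x) (hy : ¬ Branch H y) :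
    Near H C m y := by
  classical
  obtain ⟨a, ha, p, hp⟩ := hx
  refine ⟨a, ha, .cons h p, ?_⟩
  rwa [SimpleGraph.Walk.support_cons, List.toFinset_cons, Finset.filter_insert, if_neg hy]

theorem Near.of_mem_support {m : ℕ} {x y a : V} (ha : a ∈ C) (p : H.Walk x a)
    [DecidableEq V] [DecidablePred (Branch H)]
    (hp : (p.support.toFinset.filter (Branch H)).card ≤ m) (hy : y ∈ p.support) :
    Near H C m y := by
  classical
  refine ⟨a, ha, p.dropUntil y hy, le_trans (Finset.card_le_card ?_) hp⟩
  intro z hz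
  simp only [Finset.mem_filter, List.mem_toFinset] at hz ⊢
  exact ⟨p.support_dropUntil_subset_support hy hz.1, hz.2⟩

variable [Fintype V]

/-- Shortcut the walk to a path. Its at most `m` branch vertices weigh at most `card V` each, and
its other vertices weigh at most `card V` together. -/
theorem Near.exists_walk {m : ℕ} {x : V} (hx : Near H C m x)
    (hb : ∀ x, w x ≤ Fintype.card V) (hn : ∀ x, ¬ Branch H x → w x = 1) :
    ∃ a ∈ C, ∃ p : H.Walk x a, walkWeight w p ≤ Fintype.card V * (m + 1) ∧
      (∀ y ∈ p.support, Near H C m y) := by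
  classical
  obtain ⟨a, ha, p, hp⟩ := hx
  have hp' : (p.bypass.support.toFinset.filter (Branch H)).card ≤ m := by
    refine le_trans (Finset.card_le_card ?_) (le_of_eq_of_le (by congr) hp)
    intro z hz
    simp only [Finset.mem_filter, List.mem_toFinset] at hz ⊢
    exact ⟨p.support_bypass_subset_support hz.1, hz.2⟩
  refine ⟨a, ha, p.bypass, ?_, fun y hy => .of_mem_support ha p.bypass hp' hy⟩
  rw [walkWeight_eq_of_isPath p.bypass_isPath,
    ← Finset.sum_filter_add_sum_filter_not _ (Branch H)]
  have h1 : ∑ x ∈ p.bypass.support.toFinset with Branch H x, w x ≤ m * Fintype.card V :=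
    (Finset.sum_le_card_nsmul _ _ _ fun x _ => hb x).trans (Nat.mul_le_mul_right _ hp')
  have h2 : ∑ x ∈ p.bypass.support.toFinset with ¬ Branch H x, w x ≤ Fintype.card V * 1 := by
    refine (Finset.sum_le_card_nsmul _ _ 1 fun x hx => ?_).trans
      (Nat.mul_le_mul_right _ (Finset.card_le_univ _))
    exact (hn x (Finset.mem_filter.1 hx).2).le
  nlinarith

/-- If no nonempty dense set avoids the ball of radius `d` around `C`, then some vertex outside `C`
is joined to `C` by two edges followed by light walks that avoid this vertex, unless `C` contains
all edges. -/
theorem exists_ear {d : ℕ} (hb : ∀ x, w x ≤ Fintype.card V) (hw : ∀ x, 0 < w x)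
    (hn : ∀ x, ¬ Branch H x → w x = 1)
    (hdeg : ∀ x y, H.Adj x y → ∃ z, z ≠ y ∧ H.Adj x z)
    (hB : ∀ U, U.Nonempty → Dense H U → ∃ u ∈ U, ∃ c ∈ C, ∃ p : H.Walk c u, p.length ≤ d)
    (hex : ∃ y z, y ∉ C ∧ H.Adj y z) :
    ∃ y, y ∉ C ∧ ∃ x x', x ≠ x' ∧ H.Adj y x ∧ H.Adj y x' ∧
      (∃ a ∈ C, ∃ p : H.Walk x a, y ∉ p.support ∧ walkWeight w p ≤ Fintype.card V * (d + 2)) ∧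
      ∃ a ∈ C, ∃ p : H.Walk x' a, y ∉ p.support ∧ walkWeight w p ≤ Fintype.card V * (d + 2) := by
  classical
  have hnearC : ∀ x ∈ C, Near H C (d + 1) x := fun x hx =>
    ⟨x, hx, .nil, (Finset.card_filter_le _ _).trans (by simp)⟩
  by_cases hY : ∃ y z, ¬ Near H C (d + 1) y ∧ H.Adj y z
  -- Suppose that some vertex with a neighbour is not near. The set `Y` of all such vertices is not
  -- dense: otherwise a walk of length at most `d`, which has at most `d + 1` vertices, would join
  -- one of them to `C`. So some `y` in `Y` has at most one neighbour in `Y`.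
  · set Y : Finset V := Finset.univ.filter fun y => ¬ Near H C (d + 1) y ∧ ∃ z, H.Adj y z with hYdef
    have hYd : ¬ Dense H Y := by
      intro h
      obtain ⟨y, z, hy, hyz⟩ := hY
      obtain ⟨u, hu, c, hc, p, hp⟩ := hB Y ⟨y, by simp [hYdef, hy]; exact ⟨z, hyz⟩⟩ h
      simp only [hYdef, Finset.mem_filter, Finset.mem_univ, true_and] at hu
      refine hu.1 ⟨c, hc, p.reverse, (Finset.card_filter_le _ _).trans ?_⟩
      refine (List.toFinset_card_le _).trans ?_
      rw [SimpleGraph.Walk.length_support, SimpleGraph.Walk.length_reverse]; omega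
    simp only [Dense, not_forall] at hYd
    obtain ⟨y, hyY, hy⟩ := hYd
    simp only [hYdef, Finset.mem_filter, Finset.mem_univ, true_and] at hyY
    have hy2 : ∀ a b, a ≠ b → H.Adj y a → H.Adj y b → Near H C (d + 1) a ∨ Near H C (d + 1) b := by
      intro a b hab ha hb
      by_contra! hcon
      exact hy ⟨a, by simp [hYdef, hcon.1]; exact ⟨y, ha.symm⟩, b,
        by simp [hYdef, hcon.2]; exact ⟨y, hb.symm⟩, hab, ha, hb⟩
    -- Otherwise one of two neighbours of `y` is near, and prepending `y` adds no branch vertex to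
    -- the walk.
    have hbr : Branch H y := by
      by_contra hbr
      obtain ⟨z, hz⟩ := hyY.2
      obtain ⟨z', hzz', hz'⟩ := hdeg y z hz
      rcases hy2 _ _ hzz' hz' hz with h | h
      · exact hyY.1 (h.of_walk hz' hbr)
      · exact hyY.1 (h.of_walk hz hbr)
    have key : ∀ x, Near H C (d + 1) x → ∃ a ∈ C, ∃ p : H.Walk x a, y ∉ p.support ∧
        walkWeight w p ≤ Fintype.card V * (d + 2) := by
      intro x hx
      obtain ⟨a, ha, p, hp, hp'⟩ := hx.exists_walk hb hn
      exact ⟨a, ha, p, fun h => hyY.1 (hp' y h), hp⟩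
    refine ⟨y, fun h => hyY.1 (hnearC y h), ?_⟩
    obtain ⟨a, b, c, hab, hac, hbc, ha, hb, hc⟩ := hbr
    by_cases hna : Near H C (d + 1) a
    · rcases hy2 b c hbc hb hc with h | h
      · exact ⟨a, b, hab, ha, hb, key a hna, key b h⟩
      · exact ⟨a, c, hac, ha, hc, key a hna, key c h⟩
    · exact ⟨b, c, hbc, hb, hc, key b ((hy2 a b hab ha hb).resolve_left hna),
        key c ((hy2 a c hac ha hc).resolve_left hna)⟩
  · push Not at hY
    have hnear : ∀ y z, H.Adj y z → Near H C (d + 1) y := fun y z h => by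
      by_contra hc; exact hY y z hc h
    -- Now all vertices with a neighbour are near, and `E` is their weighted distance to `C`. Choose
    -- `y` outside `C` with `E y` largest: if a lightest walk from a neighbour outside `C` passed
    -- through `y`, that neighbour would be strictly farther from `C`.
    set P : V → ℕ → Prop := fun x m => ∃ a ∈ C, ∃ p : H.Walk x a, walkWeight w p = m with hP
    set E : V → ℕ := fun x => sInf {m | P x m} with hE
    have hEle : ∀ x a, a ∈ C → ∀ p : H.Walk x a, E x ≤ walkWeight w p := fun x a ha p =>
      Nat.sInf_le ⟨a, ha, p, rfl⟩
    have hEmem : ∀ y z, H.Adj y z → P y (E y) := fun y z h => by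
      obtain ⟨a, ha, p, -, -⟩ := (hnear y z h).exists_walk hb hn
      exact Nat.sInf_mem (s := {m | P y m}) ⟨_, a, ha, p, rfl⟩
    obtain ⟨y₀, z₀, hy₀, hz₀⟩ := hex
    obtain ⟨y, hy, hmax⟩ := (Finset.univ.filter fun y => y ∉ C ∧ ∃ z, H.Adj y z).exists_max_image E
      ⟨y₀, by simp [hy₀]; exact ⟨z₀, hz₀⟩⟩
    simp only [Finset.mem_filter, Finset.mem_univ, true_and] at hy hmax
    have key : ∀ x, H.Adj x y → ∃ a ∈ C, ∃ p : H.Walk x a, y ∉ p.support ∧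
        walkWeight w p ≤ Fintype.card V * (d + 2) := by
      intro x hx
      by_cases hxC : x ∈ C
      · refine ⟨x, hxC, .nil, by simpa using hx.ne', ?_⟩
        rw [walkWeight_nil]
        exact (hb x).trans (Nat.le_mul_of_pos_right _ (by omega))
      · obtain ⟨a, ha, p, hp⟩ := hEmem x y hx
        refine ⟨a, ha, p, fun h => ?_, ?_⟩
        · have h1 := walkWeight_dropUntil_le (w := w) p h hx.ne'
          have h2 := hEle y a ha (p.dropUntil y h)
          have h3 := hmax x ⟨hxC, y, hx⟩
          have h4 := hw x
          omega
        · obtain ⟨b, hbC, q, hq, -⟩ := (hnear x y hx).exists_walk hb hn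
          rw [hp]; exact (hEle x b hbC q).trans hq
    obtain ⟨x, hx⟩ := hy.2
    obtain ⟨x', hxx', hx'⟩ := hdeg y x hx
    exact ⟨y, hy.1, x', x, hxx', hx', hx, key _ hx'.symm, key _ hx.symm⟩

/-- Each branch vertex of `C` contributes `card V` to its weight, so it suffices to bound the
weight. An ear gives `2 * (1 + 2 * (d + 2)) = 4 * d + 10` times `card V`. If no edge has an end
outside `C`, either a branch vertex in `C` has a chord, or all vertices of `C` have weight `1`. -/
theorem MinDense.card_branch_le [DecidablePred (Branch H)] {d : ℕ} (hC : MinDense H w C)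
    (hw : ∀ x, w x = if Branch H x then Fintype.card V else 1)
    (hdeg : ∀ x y, H.Adj x y → ∃ z, z ≠ y ∧ H.Adj x z)
    (hB : ∀ U, U.Nonempty → Dense H U → ∃ u ∈ U, ∃ c ∈ C, ∃ p : H.Walk c u, p.length ≤ d) :
    (C.filter (Branch H)).card ≤ 4 * d + 12 := by
  classical
  obtain ⟨x₀, hx₀⟩ := hC.nonempty
  have hn : 0 < Fintype.card V := Fintype.card_pos_iff.2 ⟨x₀⟩
  have hb : ∀ x, w x ≤ Fintype.card V := fun x => by rw [hw]; split_ifs <;> omega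
  have hpos : ∀ x, 0 < w x := fun x => by rw [hw]; split_ifs <;> omega
  have hle : (C.filter (Branch H)).card * Fintype.card V ≤ ∑ x ∈ C, w x := by
    rw [← smul_eq_mul]
    refine (Finset.card_nsmul_le_sum _ w _ fun x hx => ?_).trans
      (Finset.sum_le_sum_of_subset (Finset.filter_subset (Branch H) C))
    rw [hw, if_pos (Finset.mem_filter.1 hx).2]
  suffices ∑ x ∈ C, w x ≤ (4 * d + 12) * Fintype.card V from
    Nat.le_of_mul_le_mul_right (hle.trans this) hn
  by_cases hex : ∃ y z, y ∉ C ∧ H.Adj y z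
  · obtain ⟨y, hy, x, x', hxx', hx, hx', ⟨a, ha, p, hp, hpw⟩, b, hbC, q, hq, hqw⟩ :=
      exists_ear hb hpos (fun x hx => by rw [hw, if_neg hx]) hdeg hB hex
    have := hC.weight_le_of_ear hpos hxx' hx hx' hy ha hbC p q hp hq
    have := hb y
    nlinarith
  · push Not at hex
    have hCadj : ∀ y z, H.Adj y z → y ∈ C := fun y z h => by
      by_contra hc; exact hex y z hc h
    by_cases hbr : ∃ y ∈ C, Branch H y
    · obtain ⟨y, hy, a, b, c, hab, hac, hbc, ha, hb', hc⟩ := hbr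
      have := hC.weight_le_of_chord hpos hy (hCadj _ _ ha.symm) (hCadj _ _ hb'.symm)
        (hCadj _ _ hc.symm) hab hac hbc ha hb' hc hb
      nlinarith
    · push Not at hbr
      have : ∑ x ∈ C, w x ≤ C.card * 1 :=
        Finset.sum_le_card_nsmul _ _ 1 fun x hx => by rw [hw, if_neg (hbr x hx)]
      have := Finset.card_le_univ C
      nlinarith

omit [Fintype V] in
-- Where the walk first leaves `C`, the vertex of `C` has two neighbours inside `C` and a third one
-- outside.
theorem exists_branch_of_walk (hC : Dense H C) {c u : V} (hc : c ∈ C) (hu : u ∉ C)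
    (p : H.Walk c u) : ∃ b ∈ C, Branch H b ∧ ∃ q : H.Walk b u, q.length ≤ p.length := by
  induction p with
  | nil => exact absurd hc hu
  | @cons c c' u h p ih =>
    by_cases hc' : c' ∈ C
    · obtain ⟨b, hb, hb', q, hq⟩ := ih hc' hu
      exact ⟨b, hb, hb', q, by rw [SimpleGraph.Walk.length_cons]; omega⟩
    · obtain ⟨y, hy, z, hz, hyz, h1, h2⟩ := hC c hc
      exact ⟨c, hc, ⟨y, z, c', hyz, fun e => hc' (e ▸ hy), fun e => hc' (e ▸ hz), h1, h2, h⟩,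
        .cons h p, le_rfl⟩

omit [Fintype V] in
/-- The balls around the branch vertices of `C`, with one further vertex of `C`, meet all dense sets
that the ball around `C` meets. -/
theorem MinDense.exists_mem_of_ball [DecidablePred (Branch H)] {d : ℕ} (hC : MinDense H w C)
    (hw : ∀ x, 0 < w x)
    (hB : ∀ U, U.Nonempty → Dense H U → ∃ u ∈ U, ∃ c ∈ C, ∃ p : H.Walk c u, p.length ≤ d)
    {X : Finset V} {c₀ : V} (hc₀ : c₀ ∈ C) (hc₀X : c₀ ∈ X)
    (hX : ContainsBall H d (C.filter (Branch H)) X) {U : Finset V} (hne : U.Nonempty)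
    (hU : Dense H U) : ∃ x ∈ U, x ∈ X := by
  classical
  obtain ⟨u, hu, c, hc, p, hp⟩ := hB U hne hU
  by_cases huC : u ∈ C
  · by_cases hbr : ∃ b ∈ U ∩ C, Branch H b
    · obtain ⟨b, hb, hb'⟩ := hbr
      rw [Finset.mem_inter] at hb
      exact ⟨b, hb.1, hX b (Finset.mem_filter.2 ⟨hb.2, hb'⟩) b .nil (by simp)⟩
    · push Not at hbr
      -- A vertex of `U ∩ C` that is not a branch vertex has all its neighbours in `C`, so its two
      -- neighbours in `U` lie in `U ∩ C`. Minimality then gives `U ∩ C = C`; the extra vertex `c₀`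
      -- exists to catch this case.
      have hd : Dense H (U ∩ C) := by
        intro x hx
        obtain ⟨hxU, hxC⟩ := Finset.mem_inter.1 hx
        obtain ⟨y, hy, z, hz, hyz, h1, h2⟩ := hU x hxU
        obtain ⟨y', hy', z', hz', hyz', h1', h2'⟩ := hC.dense x hxC
        have hmem : ∀ t, H.Adj x t → t ∈ C := by
          intro t ht
          by_contra htC
          exact hbr x hx ⟨y', z', t, hyz', fun e => htC (e ▸ hy'), fun e => htC (e ▸ hz'),
            h1', h2', ht⟩
        exact ⟨y, Finset.mem_inter.2 ⟨hy, hmem y h1⟩, z, Finset.mem_inter.2 ⟨hz, hmem z h2⟩,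
          hyz, h1, h2⟩
      have := hC.eq_of_subset hw Finset.inter_subset_right ⟨u, Finset.mem_inter.2 ⟨hu, huC⟩⟩ hd
      rw [← this] at hc₀
      exact ⟨c₀, (Finset.mem_inter.1 hc₀).1, hc₀X⟩
  · obtain ⟨b, hb, hb', q, hq⟩ := exists_branch_of_walk hC.dense hc huC p
    exact ⟨u, hu, hX b (Finset.mem_filter.2 ⟨hb, hb'⟩) u q (hq.trans hp)⟩

/-- The size of a ball of radius `d` in a graph with degrees at most `t`. -/
theorem card_le_of_ball [DecidableRel H.Adj] {t : ℕ}
    (ht : ∀ x, (Finset.univ.filter (H.Adj x)).card ≤ t) {S X : Finset V} {d : ℕ}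
    (hX : ∀ x ∈ X, ∃ a ∈ S, ∃ p : H.Walk a x, p.length ≤ d) :
    X.card ≤ S.card * ∑ i ∈ Finset.range (d + 1), t ^ i := by
  classical
  -- The set `N i` contains the ends of all walks of length exactly `i` that start in `S`.
  let N : ℕ → Finset V := fun i =>
    Nat.rec S (fun _ T => T.biUnion fun x => Finset.univ.filter (H.Adj x)) i
  have hN : ∀ i, (N i).card ≤ S.card * t ^ i := by
    intro i
    induction i with
    | zero => simp [N]
    | succ i ih =>
      calc (N (i + 1)).card ≤ (N i).card * t := Finset.card_biUnion_le_card_mul _ _ _ fun x _ => ht x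
        _ ≤ S.card * t ^ i * t := Nat.mul_le_mul_right _ ih
        _ = S.card * t ^ (i + 1) := by ring
  have hmem : ∀ i a x, ∀ p : H.Walk a x, a ∈ N i → x ∈ N (i + p.length) := by
    intro i a x p
    induction p generalizing i with
    | nil => exact id
    | @cons a b x h p ih =>
      intro ha
      have := ih (i + 1) (Finset.mem_biUnion.2 ⟨a, ha, by simpa using h⟩)
      rwa [SimpleGraph.Walk.length_cons, ← add_assoc, add_right_comm]
  have hsub : X ⊆ (Finset.range (d + 1)).biUnion N := by
    intro x hx
    obtain ⟨a, ha, p, hp⟩ := hX x hx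
    refine Finset.mem_biUnion.2 ⟨p.length, by simp; omega, ?_⟩
    simpa using hmem 0 a x p ha
  calc X.card ≤ ∑ i ∈ Finset.range (d + 1), (N i).card :=
        (Finset.card_le_card hsub).trans Finset.card_biUnion_le
    _ ≤ ∑ i ∈ Finset.range (d + 1), S.card * t ^ i := Finset.sum_le_sum fun i _ => hN i
    _ = _ := by rw [Finset.mul_sum]

end Branch

/-! ### Shortest path trees -/

section Tree

variable {V : Type*} [DecidableEq V] [Fintype V] {H : SimpleGraph V} {w : V → ℕ}

omit [DecidableEq V] [Fintype V] in
-- The values `D` do not count the weight of the starting vertex, which is therefore added on the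
-- left.
theorem dist_le_walkWeight {D : V → ℕ} (hrel : ∀ u x, H.Adj u x → D x ≤ D u + w x) {a b : V}
    (p : H.Walk a b) : D b + w a ≤ D a + walkWeight w p := by
  induction p with
  | nil => simp
  | cons h p ih => rw [walkWeight_cons]; have := hrel _ _ h; omega

/-- The function `D` with the parents `par` describes a weighted shortest path tree with root `v`
on the vertices with value less than `m`. -/
structure IsTree (H : SimpleGraph V) (w : V → ℕ) (v : V) (m : ℕ) (D : V → ℕ) (par : V → V) :
    Prop where
  root : D v = 0
  par_root : par v = v
  relaxed : ∀ u x, H.Adj u x → D x ≤ D u + w x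
  adj : ∀ x, x ≠ v → D x < m → H.Adj x (par x)
  le : ∀ x, x ≠ v → D x < m → D (par x) + w x ≤ D x

variable {v : V} {m : ℕ} {D : V → ℕ} {par : V → V}

/-- The set of the first `card V` vertices on the way from `z` to the root. -/
def ancestors (par : V → V) (z : V) : Finset V :=
  (Finset.range (Fintype.card V)).image fun i => par^[i] z

/-- Weights are positive, so `D` strictly decreases from a vertex to its parent and following
parents traces a path. The root is its own parent; hence iterating `card V` times yields the
vertices of this path and no others. -/
theorem IsTree.exists_walk (hT : IsTree H w v m D par) (hw : ∀ x, 0 < w x) {z : V} (hz : D z < m) :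
    ∃ q : H.Walk z v, q.support.toFinset = ancestors par z ∧ walkWeight w q ≤ D z + w v ∧
      (∀ e ∈ q.edges, ∃ u, u ≠ v ∧ D u < m ∧ e = s(u, par u)) ∧
      ∑ x ∈ q.support.toFinset, w x = walkWeight w q := by
  have main : ∀ k z, D z = k → D z < m → ∃ q : H.Walk z v, q.IsPath ∧
      (∀ i, par^[i] z ∈ q.support) ∧ (∀ x ∈ q.support, D x ≤ D z ∧ ∃ i ≤ q.length, x = par^[i] z) ∧
      walkWeight w q ≤ D z + w v ∧
      (∀ e ∈ q.edges, ∃ u, u ≠ v ∧ D u < m ∧ e = s(u, par u)) := by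
    intro k
    induction k using Nat.strong_induction_on with
    | _ k ih =>
      intro z hk hz
      by_cases hzv : z = v
      · subst hzv
        refine ⟨.nil, .nil, fun i => ?_, fun x hx => ?_, by simp, by simp⟩
        · simp [Function.iterate_fixed hT.par_root]
        · obtain rfl : x = z := by simpa using hx
          exact ⟨le_rfl, 0, le_rfl, rfl⟩
      · have hlt := hT.le z hzv hz
        have hwz := hw z
        obtain ⟨q, hq, h1, h2, h3, h4⟩ := ih (D (par z)) (by omega) (par z) rfl (by omega)
        refine ⟨.cons (hT.adj z hzv hz) q, ?_, fun i => ?_, fun x hx => ?_, ?_, ?_⟩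
        · rw [SimpleGraph.Walk.cons_isPath_iff]
          exact ⟨hq, fun h => by have := (h2 z h).1; omega⟩
        · rw [SimpleGraph.Walk.support_cons, List.mem_cons]
          cases i with
          | zero => exact Or.inl rfl
          | succ i => exact Or.inr (h1 i)
        · rw [SimpleGraph.Walk.support_cons, List.mem_cons] at hx
          rcases hx with rfl | hx
          · exact ⟨le_rfl, 0, Nat.zero_le _, rfl⟩
          · obtain ⟨hD, i, hi, rfl⟩ := h2 x hx
            exact ⟨by omega, i + 1, by rw [SimpleGraph.Walk.length_cons]; omega, rfl⟩
        · rw [walkWeight_cons]; omega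
        · intro e he
          rw [SimpleGraph.Walk.edges_cons, List.mem_cons] at he
          rcases he with rfl | he
          · exact ⟨z, hzv, hz, rfl⟩
          · exact h4 e he
  obtain ⟨q, hq, h1, h2, h3, h4⟩ := main _ z rfl hz
  refine ⟨q, ?_, h3, h4, (walkWeight_eq_of_isPath hq).symm⟩
  ext x
  simp only [List.mem_toFinset, ancestors, Finset.mem_image, Finset.mem_range]
  constructor
  · intro hx
    obtain ⟨-, i, hi, rfl⟩ := h2 x hx
    exact ⟨i, lt_of_le_of_lt hi hq.length_lt, rfl⟩
  · rintro ⟨i, -, rfl⟩; exact h1 i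

/-- Both tree paths contain the root, so in the union its weight is counted only once. -/
theorem IsTree.sum_le (hT : IsTree H w v m D par) (hw : ∀ x, 0 < w x) {z p : V} (hz : D z < m)
    (hp : D p < m) : ∑ x ∈ ancestors par z ∪ ancestors par p, w x ≤ D z + D p + w v := by
  obtain ⟨q, hq, hq', -, hqs⟩ := hT.exists_walk hw hz
  obtain ⟨r, hr, hr', -, hrs⟩ := hT.exists_walk hw hp
  rw [hq] at hqs
  rw [hr] at hrs
  have hi : w v ≤ ∑ x ∈ ancestors par z ∩ ancestors par p, w x := by
    refine Finset.single_le_sum (f := w) (fun _ _ => Nat.zero_le _) ?_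
    rw [← hq, ← hr]; simp
  have := Finset.sum_union_inter (s₁ := ancestors par z) (s₂ := ancestors par p) (f := w)
  omega

/-- A cycle through the root of a shortest path tree is at least as heavy as some cycle formed by
two tree paths and an edge. -/
theorem IsTree.exists_dense (hT : IsTree H w v m D par) (hw : ∀ x, 0 < w x) {C : Finset V}
    (hC : MinDense H w C) (hv : v ∈ C) (hm : ∑ x ∈ C, w x ≤ m) :
    ∃ z p, D z < m ∧ D p < m ∧ D z + D p + w v ≤ ∑ x ∈ C, w x ∧
      ∃ U ⊆ ancestors par z ∪ ancestors par p, U.Nonempty ∧ Dense H U := by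
  obtain ⟨c, hc, hcC⟩ := hC.exists_isCycle hw hv
  have hcw := walkWeight_of_isCycle (w := w) hc
  rw [hcC] at hcw
  -- For `x` other than the root, the arc of the cycle from `v` to `x` shows that `D x` is at most
  -- the weight of `C` without `w v`.
  have hDm : ∀ x ∈ C, D x < m := by
    intro x hx
    by_cases hxv : x = v
    · have h1 := Finset.single_le_sum (f := w) (fun _ _ => Nat.zero_le _) hv
      have h2 := hw v
      rw [hxv, hT.root]; omega
    have hx' : x ∈ c.support := by rw [← List.mem_toFinset, hcC]; exact hx
    have h1 := dist_le_walkWeight hT.relaxed (c.takeUntil x hx')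
    have h2 := walkWeight_append (w := w) (c.takeUntil x hx') (c.dropUntil x hx')
    rw [SimpleGraph.Walk.take_spec, hcw] at h2
    have h3 := walkWeight_dropUntil_le (w := w) (c.dropUntil x hx')
      (SimpleGraph.Walk.end_mem_support _) (Ne.symm hxv)
    have h4 := weight_start_le (w := w) ((c.dropUntil x hx').dropUntil v
      (SimpleGraph.Walk.end_mem_support _))
    rw [hT.root] at h1
    have := hw v
    omega
  -- Some edge of the cycle is not a tree edge. At a vertex `z` of `C` with `D z` largest, a tree
  -- edge of the cycle must lead to the parent of `z`, as a child would have a larger value; but the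
  -- cycle has two edges at `z` with distinct other ends.
  obtain ⟨e, he, heT⟩ : ∃ e ∈ c.edges, ¬ ∃ u, u ≠ v ∧ D u < m ∧ e = s(u, par u) := by
    by_contra! hcon
    obtain ⟨z, hz, hmax⟩ := C.exists_max_image D hC.nonempty
    have hz' : z ∈ c.support := by rw [← List.mem_toFinset, hcC]; exact hz
    have hcz := hc.rotate hz'
    have key : ∀ y, s(z, y) ∈ (c.rotate z hz').edges → y = par z := by
      intro y hy
      have hyC : y ∈ C := by
        rw [← hcC, List.mem_toFinset, ← c.mem_support_rotate_iff z hz']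
        exact SimpleGraph.Walk.snd_mem_support_of_mem_edges _ hy
      obtain ⟨u, huv, hum, hu⟩ := hcon _ ((c.rotate_edges z hz').perm.mem_iff.1 hy)
      rcases Sym2.eq_iff.1 hu with ⟨rfl, h⟩ | ⟨h, rfl⟩
      · exact h
      · have h1 := hT.le y huv hum
        have h2 := hmax y hyC
        have h3 := hw y
        rw [← h] at h1
        omega
    refine hcz.snd_ne_penultimate ?_
    rw [key _ (SimpleGraph.Walk.mk_start_snd_mem_edges hcz.not_nil),
      key (SimpleGraph.Walk.penultimate _) (by
        rw [Sym2.eq_swap]; exact SimpleGraph.Walk.mk_penultimate_end_mem_edges hcz.not_nil)]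
  induction e with | h a b => ?_
  obtain ⟨z, p, hzp, q, r, hab, hcqr⟩ := exists_split_of_mem_edges c he
  have hsup : ∀ x, x ∈ (q.append (.cons hzp r)).support → x ∈ C := fun x hx => by
    rw [← hcC, List.mem_toFinset, hcqr]; exact hx
  have hzC : z ∈ C := hsup z (by simp)
  have hpC : p ∈ C := hsup p (by simp)
  refine ⟨z, p, hDm z hzC, hDm p hpC, ?_, ?_⟩
  -- Without the edge `z p`, the cycle consists of walks from `v` to `z` and from `p` to `v`, which
  -- together weigh as much as `C` with `v` counted twice.
  · have h1 := dist_le_walkWeight hT.relaxed q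
    have h2 := dist_le_walkWeight hT.relaxed r.reverse
    have h3 := walkWeight_append (w := w) q (.cons hzp r)
    rw [walkWeight_reverse] at h2
    rw [walkWeight_cons, ← hcqr, hcw] at h3
    rw [hT.root] at h1 h2
    omega
  -- The two tree paths consist of tree edges, so they avoid `z p` and contain a dense set together
  -- with it.
  · obtain ⟨f, hf, -, hfe, -⟩ := hT.exists_walk hw (hDm z hzC)
    obtain ⟨g, hg, -, hge, -⟩ := hT.exists_walk hw (hDm p hpC)
    obtain ⟨U, hU, hne, hUd⟩ := exists_dense_of_walk hzp (f.append g.reverse) (by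
      rw [hab, SimpleGraph.Walk.edges_append, List.mem_append, SimpleGraph.Walk.edges_reverse,
        List.mem_reverse]
      rintro (h | h)
      · exact heT (hfe _ h)
      · exact heT (hge _ h))
    refine ⟨U, fun x hx => ?_, hne, hUd⟩
    have := List.mem_toFinset.1 (hU hx)
    rw [SimpleGraph.Walk.mem_support_append_iff, SimpleGraph.Walk.support_reverse,
      List.mem_reverse] at this
    rw [Finset.mem_union, ← hf, ← hg, List.mem_toFinset, List.mem_toFinset]
    exact this

end Tree

/-! ### The core of a graph -/

section Core

variable {V : Type*} {G : SimpleGraph V} {K : Finset V}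

/-- `K` is the largest dense subset of `S`. -/
structure IsCore (G : SimpleGraph V) (S K : Finset V) : Prop where
  subset : K ⊆ S
  dense : Dense G K
  max : ∀ U ⊆ S, Dense G U → U ⊆ K

/-- The graph of all edges inside `K`. -/
def restrict (G : SimpleGraph V) (K : Finset V) : SimpleGraph V where
  Adj x y := G.Adj x y ∧ x ∈ K ∧ y ∈ K
  symm := ⟨fun _ _ h => ⟨h.1.symm, h.2.2, h.2.1⟩⟩
  loopless := ⟨fun _ h => h.1.ne rfl⟩

theorem restrict_le : restrict G K ≤ G := fun _ _ h => h.1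

variable [Fintype V]

theorem IsCore.dense_restrict (hK : IsCore G Finset.univ K) {U : Finset V} (hU : Dense G U) :
    Dense (restrict G K) U :=
  hU.mono fun _ hx _ hy h =>
    ⟨h, hK.max U (Finset.subset_univ _) hU hx, hK.max U (Finset.subset_univ _) hU hy⟩

theorem IsCore.exists_adj (hK : IsCore G Finset.univ K) {x y : V} (h : (restrict G K).Adj x y) :
    ∃ z, z ≠ y ∧ (restrict G K).Adj x z := by
  obtain ⟨a, ha, b, hb, hab, h1, h2⟩ := hK.dense x h.2.1
  by_cases e : a = y
  · exact ⟨b, fun e' => hab (e.trans e'.symm), h2, h.2.1, hb⟩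
  · exact ⟨a, e, h1, h.2.1, ha⟩

/-- An inner vertex of a path has two neighbours on it, so adding the path to `K` gives a dense set,
which the maximality of `K` puts inside `K`. Hence distances between core vertices can be measured
in the core. -/
theorem IsCore.exists_walk [DecidableEq V] (hK : IsCore G Finset.univ K) {u v : V} (hu : u ∈ K)
    (hv : v ∈ K) {p : G.Walk u v} (hp : p.IsPath) :
    ∃ q : (restrict G K).Walk u v, q.length = p.length := by
  have hd : Dense G (K ∪ p.support.toFinset) := by
    intro x hx
    by_cases hxK : x ∈ K
    · obtain ⟨a, ha, b, hb, h⟩ := hK.dense x hxK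
      exact ⟨a, Finset.mem_union_left _ ha, b, Finset.mem_union_left _ hb, h⟩
    · obtain ⟨i, rfl, hi⟩ := SimpleGraph.Walk.mem_support_iff_exists_getVert.1
        (List.mem_toFinset.1 ((Finset.mem_union.1 hx).resolve_left hxK))
      have h0 : i ≠ 0 := by rintro rfl; simp [hu] at hxK
      have hl : i ≠ p.length := by rintro rfl; simp [hv] at hxK
      obtain ⟨j, rfl⟩ := Nat.exists_eq_succ_of_ne_zero h0
      have hm : ∀ k, p.getVert k ∈ K ∪ p.support.toFinset := fun k =>
        Finset.mem_union_right _ (List.mem_toFinset.2 (p.getVert_mem_support k))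
      refine ⟨_, hm j, _, hm (j + 1 + 1), fun h => ?_,
        (p.adj_getVert_succ (by omega)).symm, p.adj_getVert_succ (by omega)⟩
      have := hp.getVert_injOn (by simp; omega) (by simp; omega) h
      omega
  have hsub := hK.max _ (Finset.subset_univ _) hd
  have hs : ∀ x ∈ p.support, x ∈ K := fun x hx =>
    hsub (Finset.mem_union_right _ (List.mem_toFinset.2 hx))
  refine ⟨p.transfer _ fun e he => ?_, SimpleGraph.Walk.length_transfer ..⟩
  induction e with | h a b => ?_
  exact ⟨p.adj_of_mem_edges he, hs _ (p.fst_mem_support_of_mem_edges he),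
    hs _ (p.snd_mem_support_of_mem_edges he)⟩

omit [Fintype V] in
-- A cycle of `G - X` would be a nonempty dense set disjoint from `X`.
theorem isFeedbackVertexSet_of_dense [DecidableEq V] {X : Finset V}
    (h : ∀ U : Finset V, U.Nonempty → Dense G U → ∃ x ∈ U, x ∈ X) :
    IsFeedbackVertexSet G (X : Set V) := by
  intro u c hc
  have hd := dense_of_isCycle hc
  obtain ⟨x, hx, hxX⟩ := h (c.support.toFinset.image Subtype.val)
    ⟨u, Finset.mem_image_of_mem _ (by simp)⟩ (by
      intro x hx
      obtain ⟨x', hx', rfl⟩ := Finset.mem_image.1 hx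
      obtain ⟨y, hy, z, hz, hyz, h1, h2⟩ := hd x' hx'
      exact ⟨_, Finset.mem_image_of_mem _ hy, _, Finset.mem_image_of_mem _ hz,
        fun e => hyz (Subtype.ext e), h1, h2⟩)
  obtain ⟨x, -, rfl⟩ := Finset.mem_image.1 hx
  exact x.2 hxX

end Core

open ForProgram

/-! ### Computing the core of a set -/

/-- The entry of the adjacency matrix for the vertices in registers `u` and `v`, where array `3`
holds the positions at which the rows of the matrix start. -/
def adjExpr (u v : ℕ) : Expr := .cell 0 (.add (.cell 3 (.reg u)) (.reg v))

/-- The memory `s` holds the graph `H`. -/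
structure HasGraph {n : ℕ} (s : Memory) (H : SimpleGraph (Fin n)) : Prop where
  reg_zero : s.reg 0 = n
  adj : ∀ u v : Fin n, s.arr 0 (s.arr 3 u + v) ≠ 0 ↔ H.Adj u v

/-- The set whose indicator function is stored in array `a`. -/
def supp (n : ℕ) (s : Memory) (a : ℕ) : Finset (Fin n) := Finset.univ.filter fun x => s.arr a x ≠ 0

@[simp] theorem mem_supp {n : ℕ} {s : Memory} {a : ℕ} {x : Fin n} :
    x ∈ supp n s a ↔ s.arr a x ≠ 0 := by
  simp [supp]

theorem supp_congr {n : ℕ} {s s' : Memory} {a : ℕ} (h : s'.arr a = s.arr a) :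
    supp n s' a = supp n s a := by
  simp [supp, h]

section

variable {n : ℕ} {H : SimpleGraph (Fin n)} {s : Memory}

theorem HasGraph.congr (h : HasGraph s H) {s' : Memory} (h0 : s'.reg 0 = s.reg 0)
    (h1 : s'.arr 0 = s.arr 0) (h2 : s'.arr 3 = s.arr 3) : HasGraph s' H :=
  ⟨h0.trans h.reg_zero, by rw [h1, h2]; exact h.adj⟩

theorem HasGraph.setReg (h : HasGraph s H) {i : ℕ} (hi : i ≠ 0) (x : ℕ) :
    HasGraph (setReg s i x) H :=
  h.congr (by simp [hi.symm]) rfl rfl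

theorem HasGraph.frame {P : ForProgram} {s' : Memory} (h : HasGraph s H) (hF : Frame P s s')
    (h0 : 0 ∉ P.regs) (h1 : 0 ∉ P.arrs) (h2 : 3 ∉ P.arrs) : HasGraph s' H :=
  h.congr (hF.1 _ h0) (hF.2 _ h1) (hF.2 _ h2)

theorem HasGraph.denote {P : ForProgram} (h : HasGraph s H) (h0 : 0 ∉ P.regs) (h1 : 0 ∉ P.arrs)
    (h2 : 3 ∉ P.arrs) : HasGraph (P.denote s) H :=
  h.frame (frame_denote P s) h0 h1 h2

theorem HasGraph.adjExpr_eval (h : HasGraph s H) {u v : ℕ} {x y : Fin n} (hu : s.reg u = x)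
    (hv : s.reg v = y) : (adjExpr u v).eval s ≠ 0 ↔ H.Adj x y := by
  simp only [adjExpr, Expr.eval, hu, hv]; exact h.adj x y

/-- The loop that counts in register `c` the values of register `i` that pass two tests. -/
def countLoop (c i : ℕ) (e e' : Expr) : ForProgram :=
  .seq (.assign c (.const 0))
    (.for_ i (.ite e (.ite e' (.assign c (.add (.reg c) (.const 1))) .skip) .skip))

theorem card_filter_lt_succ (T : Finset (Fin n)) (k : Fin n) :
    (T.filter fun x : Fin n => (x : ℕ) < k + 1).card =
      (T.filter fun x : Fin n => (x : ℕ) < k).card + if k ∈ T then 1 else 0 := by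
  have h : (T.filter fun x : Fin n => (x : ℕ) < k + 1) =
      (T.filter fun x : Fin n => (x : ℕ) < k) ∪ (if k ∈ T then ({k} : Finset (Fin n)) else ∅) := by
    ext x
    have : (x : ℕ) < k + 1 ↔ (x : ℕ) < k ∨ x = k := by
      rw [Fin.ext_iff]; omega
    split_ifs with hk
    · simp only [Finset.mem_filter, this, Finset.mem_union, Finset.mem_singleton]
      constructor
      · tauto
      · rintro (h | rfl) <;> tauto
    · simp only [Finset.mem_filter, this, Finset.union_empty]
      constructor
      · rintro ⟨h, h' | rfl⟩ <;> tauto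
      · tauto
  rw [h, Finset.card_union_of_disjoint]
  · split_ifs <;> simp
  · split_ifs <;> simp

theorem countLoop_spec {c i : ℕ} {e e' : Expr} (hci : c ≠ i) (hc : c ≠ 0) (hn : s.reg 0 = n)
    (T : Finset (Fin n))
    (he : ∀ (k : Fin n) (s' : Memory), Frame (countLoop c i e e') s s' → s'.reg i = k →
      (e.eval s' ≠ 0 ∧ e'.eval s' ≠ 0 ↔ k ∈ T)) :
    ((countLoop c i e e').denote s).reg c = T.card := by
  have h := for_rule (i := i) (P := .ite e (.ite e' (.assign c (.add (.reg c) (.const 1))) .skip)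
      .skip) (s := setReg s c 0) (fun k s' => s'.reg c = (T.filter fun x : Fin n => (x : ℕ) < k).card)
    (fun k s' x h => by simpa [hci] using h) (by simp) (by
      intro k s' hk hF hi hI
      simp only [reg_setReg, if_neg hc.symm, hn] at hk
      have hF' : Frame (countLoop c i e e') s s' := by
        refine ⟨fun r hr => ?_, fun a ha => hF.2 a ha⟩
        simp only [countLoop, regs, List.mem_append, List.mem_cons, not_or] at hr
        rw [hF.1 r (by simp only [regs, List.mem_append, List.mem_cons]; tauto)]
        simp [hr.1]
      have hT := he ⟨k, hk⟩ s' hF' hi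
      rw [card_filter_lt_succ T ⟨k, hk⟩]
      simp only [ForProgram.denote]
      split_ifs with h1 h2 h3 h3 h3
      · simp [Expr.eval, hI]
      · exact absurd (hT.1 ⟨h1, h2⟩) h3
      · exact absurd (hT.2 h3).2 h2
      · simp [hI]
      · exact absurd (hT.2 h3).1 h1
      · simp [hI])
  simp only [reg_setReg, if_neg hc.symm, hn] at h
  rw [countLoop, ForProgram.denote]
  refine Eq.trans h ?_
  rw [Finset.filter_true_of_mem fun x _ => x.2]

/-- Remove the vertex in register `11` from the set in array `5` if it has fewer than two neighbours
there. -/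
def peelStep : ForProgram :=
  .seq (countLoop 12 13 (.cell 5 (.reg 13)) (adjExpr 11 13))
    (.ite (.sub (.const 2) (.reg 12)) (.write 5 (.reg 11) (.const 0)) .skip)

/-- Replace the set in array `5` by its core. -/
def peel : ForProgram := .for_ 10 (.for_ 11 peelStep)

theorem peelStep_spec (hG : HasGraph s H) {v : Fin n} (hv : s.reg 11 = v) :
    ((∃ y ∈ supp n s 5, ∃ z ∈ supp n s 5, y ≠ z ∧ H.Adj v y ∧ H.Adj v z) →
        supp n (peelStep.denote s) 5 = supp n s 5) ∧
      ((¬ ∃ y ∈ supp n s 5, ∃ z ∈ supp n s 5, y ≠ z ∧ H.Adj v y ∧ H.Adj v z) →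
        supp n (peelStep.denote s) 5 = (supp n s 5).erase v) := by
  classical
  have hc := countLoop_spec (c := 12) (i := 13) (e := .cell 5 (.reg 13)) (e' := adjExpr 11 13)
    (by decide) (by decide) hG.reg_zero ((supp n s 5).filter (H.Adj v)) (by
      intro k s' hF hk
      rw [Finset.mem_filter, mem_supp,
        (hG.frame hF (by decide) (by decide) (by decide)).adjExpr_eval
          (by rw [hF.1 11 (by decide), hv]) hk]
      simp only [Expr.eval, hk, hF.2 5 (by decide)])
  have hiff : (∃ y ∈ supp n s 5, ∃ z ∈ supp n s 5, y ≠ z ∧ H.Adj v y ∧ H.Adj v z) ↔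
      1 < ((supp n s 5).filter (H.Adj v)).card := by
    rw [Finset.one_lt_card]
    simp only [Finset.mem_filter]
    constructor
    · rintro ⟨y, hy, z, hz, h, h1, h2⟩; exact ⟨y, ⟨hy, h1⟩, z, ⟨hz, h2⟩, h⟩
    · rintro ⟨y, ⟨hy, h1⟩, z, ⟨hz, h2⟩, h⟩; exact ⟨y, hy, z, hz, h, h1, h2⟩
  have hF := frame_denote (countLoop 12 13 (.cell 5 (.reg 13)) (adjExpr 11 13)) s
  rw [hiff, peelStep, ForProgram.denote, ForProgram.denote]
  simp only [Expr.eval, hc]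
  constructor
  · intro h
    rw [if_neg (by omega)]
    exact supp_congr (hF.2 5 (by decide))
  · intro h
    rw [if_pos (by omega)]
    ext x
    simp only [ForProgram.denote, mem_supp, arr_setCell, if_true, Expr.eval,
      hF.2 5 (by decide), hF.1 11 (by decide), hv, Function.update_apply, Finset.mem_erase]
    split_ifs with hx <;> simp [hx, Fin.ext_iff]

/-- Sets only shrink during a pass, so if the final set equals the initial one, it never changed and
every one of its vertices passed the test against this same set. -/
theorem peelPass_spec (hG : HasGraph s H) :
    supp n ((for_ 11 peelStep).denote s) 5 ⊆ supp n s 5 ∧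
      (∀ U ⊆ supp n s 5, Dense H U → U ⊆ supp n ((for_ 11 peelStep).denote s) 5) ∧
      (supp n ((for_ 11 peelStep).denote s) 5 = supp n s 5 → Dense H (supp n s 5)) := by
  classical
  have h := for_rule (i := 11) (P := peelStep) (s := s)
    (fun k s' => supp n s' 5 ⊆ supp n s 5 ∧
      (∀ U ⊆ supp n s 5, Dense H U → U ⊆ supp n s' 5) ∧
      (supp n s' 5 = supp n s 5 → ∀ x ∈ supp n s 5, (x : ℕ) < k →
        ∃ y ∈ supp n s 5, ∃ z ∈ supp n s 5, y ≠ z ∧ H.Adj x y ∧ H.Adj x z))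
    (fun _ _ _ h => h) ⟨subset_rfl, fun _ h _ => h, fun _ _ _ h => absurd h (by omega)⟩ (by
      rintro k s' hk hF hi ⟨h1, h2, h3⟩
      rw [hG.reg_zero] at hk
      obtain ⟨p1, p2⟩ := peelStep_spec (v := ⟨k, hk⟩)
        (hG.frame hF (by decide) (by decide) (by decide)) hi
      by_cases hex : ∃ y ∈ supp n s' 5, ∃ z ∈ supp n s' 5, y ≠ z ∧ H.Adj ⟨k, hk⟩ y ∧
          H.Adj ⟨k, hk⟩ z
      · rw [p1 hex]
        refine ⟨h1, h2, fun he x hx hxk => ?_⟩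
        rcases Nat.lt_succ_iff_lt_or_eq.1 hxk with hlt | heq
        · exact h3 he x hx hlt
        · obtain rfl : x = ⟨k, hk⟩ := Fin.ext heq
          rwa [he] at hex
      · rw [p2 hex]
        refine ⟨(Finset.erase_subset _ _).trans h1, fun U hU hUd x hx => ?_, fun he x hx hxk => ?_⟩
        · refine Finset.mem_erase.2 ⟨?_, h2 U hU hUd hx⟩
          rintro rfl
          obtain ⟨y, hy, z, hz, h⟩ := hUd _ hx
          exact hex ⟨y, h2 U hU hUd hy, z, h2 U hU hUd hz, h⟩
        · have hs : supp n s' 5 = supp n s 5 :=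
            h1.antisymm (he ▸ Finset.erase_subset _ _)
          rcases Nat.lt_succ_iff_lt_or_eq.1 hxk with hlt | heq
          · exact h3 hs x hx hlt
          · obtain rfl : x = ⟨k, hk⟩ := Fin.ext heq
            rw [← he] at hx
            exact absurd rfl (Finset.mem_erase.1 hx).1)
  rw [hG.reg_zero] at h
  exact ⟨h.1, h.2.1, fun he x hx => h.2.2 he x hx x.2⟩

/-- A vertex of a dense subset always keeps two neighbours and is never deleted. Each pass deletes a
vertex unless the set is already dense, so `n` passes suffice. -/
theorem peel_spec (hG : HasGraph s H) : IsCore H (supp n s 5) (supp n (peel.denote s) 5) := by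
  have h := for_rule (i := 10) (P := for_ 11 peelStep) (s := s)
    (fun k s' => supp n s' 5 ⊆ supp n s 5 ∧
      (∀ U ⊆ supp n s 5, Dense H U → U ⊆ supp n s' 5) ∧
      (Dense H (supp n s' 5) ∨ (supp n s' 5).card + k ≤ n))
    (fun _ _ _ h => h)
    ⟨subset_rfl, fun _ h _ => h, Or.inr (by simpa using Finset.card_le_univ (supp n s 5))⟩ (by
      rintro k s' hk hF hi ⟨h1, h2, h3⟩
      obtain ⟨p1, p2, p3⟩ := peelPass_spec (hG.frame hF (by decide) (by decide) (by decide))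
      refine ⟨p1.trans h1, fun U hU hd => p2 U (h2 U hU hd) hd, ?_⟩
      by_cases he : supp n ((for_ 11 peelStep).denote s') 5 = supp n s' 5
      · left; rw [he]; exact p3 he
      · rcases h3 with h3 | h3
        · exact absurd (p1.antisymm (p2 _ subset_rfl h3)) he
        · right
          have := Finset.card_lt_card (p1.ssubset_of_ne he)
          omega)
  rw [hG.reg_zero] at h
  obtain ⟨h1, h2, h3⟩ := h
  refine ⟨h1, ?_, h2⟩
  rcases h3 with h3 | h3
  · exact h3
  · have : (supp n (peel.denote s) 5) = ∅ := Finset.card_eq_zero.1 (by rw [peel]; omega)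
    rw [this]; intro x hx; simp at hx

end

/-! ### Computing distances -/

section Dist

variable {V : Type*} {H : SimpleGraph V}

/-- The properties of a partially computed distance function from `Z` with weights `w`, where the
value `m` stands for infinity. -/
structure IsPreDist (H : SimpleGraph V) (w : V → ℕ) (Z : Finset V) (m : ℕ) (D : V → ℕ) : Prop where
  zero : ∀ x ∈ Z, D x = 0
  le : ∀ x, D x ≤ m
  pred : ∀ x, x ∉ Z → D x < m → ∃ u, H.Adj u x ∧ D u + w x ≤ D x

/-- No edge shortens a distance. -/
def Relaxed (H : SimpleGraph V) (w D : V → ℕ) : Prop := ∀ u x, H.Adj u x → D x ≤ D u + w x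

/-- Lowering a value cannot spoil the predecessor inequality of other vertices, since there the
value of the lowered vertex occurs only on the smaller side. -/
theorem IsPreDist.update [DecidableEq V] {w : V → ℕ} {Z : Finset V} {m : ℕ} {D : V → ℕ}
    (h : IsPreDist H w Z m D) {u x : V} (hux : H.Adj u x) (hlt : D u + w x < D x) :
    IsPreDist H w Z m (Function.update D x (D u + w x)) := by
  have hle : ∀ y, Function.update D x (D u + w x) y ≤ D y := by
    intro y
    rw [Function.update_apply]
    split_ifs with hy
    · rw [hy]; exact hlt.le
    · exact le_rfl
  refine ⟨fun y hy => Nat.le_zero.1 ((hle y).trans (h.zero y hy).le),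
    fun y => (hle y).trans (h.le y), fun y hy hym => ?_⟩
  by_cases hyx : y = x
  · subst hyx
    exact ⟨u, hux, by rw [Function.update_self]; exact Nat.add_le_add_right (hle u) _⟩
  · rw [Function.update_of_ne hyx] at hym ⊢
    obtain ⟨v, hv, hvy⟩ := h.pred y hy hym
    exact ⟨v, hv, (Nat.add_le_add_right (hle v) _).trans hvy⟩

variable {n d : ℕ} {G : SimpleGraph (Fin n)} {D : Fin n → ℕ} {Z : Finset (Fin n)}

theorem IsPreDist.exists_walk (h : IsPreDist G (fun _ => 1) Z (n * n) D) {x : Fin n}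
    (hx : D x < n * n) : ∃ a ∈ Z, ∃ p : G.Walk a x, p.length ≤ D x := by
  induction hk : D x using Nat.strong_induction_on generalizing x with
  | _ k ih =>
    by_cases hxZ : x ∈ Z
    · exact ⟨x, hxZ, .nil, by simp⟩
    · obtain ⟨u, hu, hux⟩ := h.pred x hxZ hx
      obtain ⟨a, ha, p, hp⟩ := ih (D u) (by omega) (x := u) (by omega) rfl
      exact ⟨a, ha, p.concat hu, by rw [SimpleGraph.Walk.length_concat]; omega⟩

/-- Shortcutting to a path gives a length below `n`, so the distance stays below the value `n * n`
that stands for infinity. -/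
theorem IsPreDist.lt_and_le_of_walk (h : IsPreDist G (fun _ => 1) Z (n * n) D)
    (hD : Relaxed G (fun _ => 1) D) {a x : Fin n} (ha : a ∈ Z) (p : G.Walk a x)
    (hp : p.length ≤ d) : D x < n * n ∧ D x ≤ d := by
  have h1 := dist_le_walkWeight hD p.bypass
  have h2 : walkWeight (fun _ => 1) p.bypass = p.bypass.length + 1 := by
    simp [walkWeight]
  have h3 := p.bypass_isPath.length_lt
  have h4 := p.length_bypass_le_length
  rw [h.zero a ha, h2] at h1
  rw [Fintype.card_fin] at h3
  exact ⟨by nlinarith, by omega⟩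

end Dist

/-- Use the edge from the vertex in register `13` to the vertex in register `14` to improve the
distances in array `6`, with the weights in array `11`. -/
def relaxStep : ForProgram :=
  .ite (adjExpr 13 14) (.ite (.sub (.cell 6 (.reg 14))
      (.add (.cell 6 (.reg 13)) (.cell 11 (.reg 14))))
    (.write 6 (.reg 14) (.add (.cell 6 (.reg 13)) (.cell 11 (.reg 14)))) .skip) .skip

/-- Use all edges to improve the distances. -/
def relaxPass : ForProgram := .for_ 13 (.for_ 14 relaxStep)

/-- Improve the distances until they are correct. -/
def relax : ForProgram := .for_ 10 (.for_ 11 (.for_ 12 relaxPass))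

/-- The contents of array `a`. -/
def values (n : ℕ) (s : Memory) (a : ℕ) (x : Fin n) : ℕ := s.arr a x

section

variable {n : ℕ} {H : SimpleGraph (Fin n)} {s : Memory} {Z : Finset (Fin n)} {m : ℕ}
  {w : Fin n → ℕ}

theorem values_congr {s' : Memory} {a : ℕ} (h : s'.arr a = s.arr a) :
    values n s' a = values n s a := by
  funext x; simp [values, h]

theorem relaxStep_spec (hG : HasGraph s H) {u x : Fin n} (hu : s.reg 13 = u) (hx : s.reg 14 = x)
    (hw : values n s 11 = w) (hD : IsPreDist H w Z m (values n s 6)) :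
    IsPreDist H w Z m (values n (relaxStep.denote s) 6) ∧
      (∀ y, values n (relaxStep.denote s) 6 y ≤ values n s 6 y) ∧
      (values n (relaxStep.denote s) 6 = values n s 6 →
        H.Adj u x → values n s 6 x ≤ values n s 6 u + w x) ∧
      (Relaxed H w (values n s 6) → values n (relaxStep.denote s) 6 = values n s 6) := by
  have hadj := hG.adjExpr_eval hu hx
  have he : (Expr.add (.cell 6 (.reg 13)) (.cell 11 (.reg 14))).eval s =
      values n s 6 u + w x := by simp [Expr.eval, hu, hx, values, ← hw]
  have he' : (Expr.sub (.cell 6 (.reg 14)) (.add (.cell 6 (.reg 13)) (.cell 11 (.reg 14)))).eval s =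
      values n s 6 x - (values n s 6 u + w x) := by
    rw [Expr.eval, he]; simp [Expr.eval, hx, values]
  simp only [relaxStep, ForProgram.denote, he']
  by_cases h1 : H.Adj u x
  · rw [if_pos (hadj.2 h1)]
    by_cases h2 : values n s 6 u + w x < values n s 6 x
    · rw [if_pos (by omega), he]
      have hup : values n (setCell s 6 ((Expr.reg 14).eval s) (values n s 6 u + w x)) 6 =
          Function.update (values n s 6) x (values n s 6 u + w x) := by
        funext y
        simp only [values, arr_setCell, if_true, Expr.eval, hx, Function.update_apply, Fin.ext_iff]
      rw [hup]
      refine ⟨hD.update h1 h2, fun y => ?_, fun h => ?_, fun h => ?_⟩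
      · rw [Function.update_apply]; split_ifs with hy
        · rw [hy]; exact h2.le
        · exact le_rfl
      · have := congrFun h x
        rw [Function.update_self] at this; omega
      · exact absurd (h u x h1) (by omega)
    · rw [if_neg (by omega)]
      exact ⟨hD, fun _ => le_rfl, fun _ _ => by omega, fun _ => rfl⟩
  · rw [if_neg (fun h => h1 (hadj.1 h))]
    exact ⟨hD, fun _ => le_rfl, fun _ h => absurd h h1, fun _ => rfl⟩

theorem relaxPass_spec (hG : HasGraph s H) (hw : values n s 11 = w)
    (hD : IsPreDist H w Z m (values n s 6)) :
    IsPreDist H w Z m (values n (relaxPass.denote s) 6) ∧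
      (∀ y, values n (relaxPass.denote s) 6 y ≤ values n s 6 y) ∧
      (values n (relaxPass.denote s) 6 = values n s 6 → Relaxed H w (values n s 6)) ∧
      (Relaxed H w (values n s 6) → values n (relaxPass.denote s) 6 = values n s 6) := by
  have h := for_rule (i := 13) (P := .for_ 14 relaxStep) (s := s)
    (fun k s' => IsPreDist H w Z m (values n s' 6) ∧
      (∀ y, values n s' 6 y ≤ values n s 6 y) ∧
      (values n s' 6 = values n s 6 → ∀ u x : Fin n, (u : ℕ) < k → H.Adj u x →
        values n s 6 x ≤ values n s 6 u + w x) ∧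
      (Relaxed H w (values n s 6) → values n s' 6 = values n s 6))
    (fun _ _ _ h => h) ⟨hD, fun _ => le_rfl, fun _ _ _ h => absurd h (by omega), fun _ => rfl⟩ (by
      rintro k s' hk hF hi ⟨h1, h2, h3, h4⟩
      rw [hG.reg_zero] at hk
      have hG' := hG.frame hF (by decide) (by decide) (by decide)
      have h := for_rule (i := 14) (P := relaxStep) (s := s')
        (fun l s'' => IsPreDist H w Z m (values n s'' 6) ∧
          (∀ y, values n s'' 6 y ≤ values n s' 6 y) ∧
          (values n s'' 6 = values n s' 6 → ∀ x : Fin n, (x : ℕ) < l → H.Adj ⟨k, hk⟩ x →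
            values n s' 6 x ≤ values n s' 6 ⟨k, hk⟩ + w x) ∧
          (Relaxed H w (values n s' 6) → values n s'' 6 = values n s' 6))
        (fun _ _ _ h => h) ⟨h1, fun _ => le_rfl, fun _ _ h => absurd h (by omega), fun _ => rfl⟩ (by
          rintro l s'' hl hF' hi' ⟨q1, q2, q3, q4⟩
          rw [hG'.reg_zero] at hl
          obtain ⟨r1, r2, r3, r4⟩ := relaxStep_spec (u := ⟨k, hk⟩) (x := ⟨l, hl⟩)
            (hG'.frame hF' (by decide) (by decide) (by decide))
            ((hF'.1 13 (by decide)).trans hi) hi'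
            (by rw [values_congr (hF'.2 11 (by decide)), values_congr (hF.2 11 (by decide)), hw]) q1
          refine ⟨r1, fun y => (r2 y).trans (q2 y), fun he x hx hadj => ?_, fun hR => ?_⟩
          · have e1 : values n s'' 6 = values n s' 6 :=
              funext fun y => le_antisymm (q2 y) (by rw [← he]; exact r2 y)
            rcases Nat.lt_succ_iff_lt_or_eq.1 hx with hlt | heq
            · exact q3 e1 x hlt hadj
            · obtain rfl : x = ⟨l, hl⟩ := Fin.ext heq
              rw [← e1]
              exact r3 (he.trans e1.symm) hadj
          · rw [← q4 hR]; exact r4 (by rwa [q4 hR]))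
      obtain ⟨r1, r2, r3, r4⟩ := h
      rw [hG'.reg_zero] at r3
      refine ⟨r1, fun y => (r2 y).trans (h2 y), fun he u x hu hadj => ?_, fun hR => ?_⟩
      · have e1 : values n s' 6 = values n s 6 :=
          funext fun y => le_antisymm (h2 y) (by rw [← he]; exact r2 y)
        rcases Nat.lt_succ_iff_lt_or_eq.1 hu with hlt | heq
        · exact h3 e1 u x hlt hadj
        · obtain rfl : u = ⟨k, hk⟩ := Fin.ext heq
          rw [← e1]
          exact r3 (he.trans e1.symm) x x.2 hadj
      · rw [← h4 hR]; exact r4 (by rwa [h4 hR]))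
  rw [hG.reg_zero] at h
  exact ⟨h.1, h.2.1, fun he u x hux => h.2.2.1 he u x u.2 hux, h.2.2.2⟩

/-- The sum of the `n` values is at most `n * (n * n)` at the start, and every pass lowers it unless
no edge shortens a distance. The three nested loops make exactly that many passes. -/
theorem relax_spec (hG : HasGraph s H) (hw : values n s 11 = w)
    (hD : IsPreDist H w Z (n * n) (values n s 6)) :
    IsPreDist H w Z (n * n) (values n (relax.denote s) 6) ∧
      Relaxed H w (values n (relax.denote s) 6) := by
  let Q : ℕ → Memory → Prop := fun k s' => HasGraph s' H ∧ values n s' 11 = w ∧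
    IsPreDist H w Z (n * n) (values n s' 6) ∧
    (Relaxed H w (values n s' 6) ∨ ∑ x, values n s' 6 x + k ≤ n * (n * n))
  have hQset : ∀ k s' i x, i ≠ 0 → Q k s' → Q k (setReg s' i x) :=
    fun k s' i x hi h => ⟨h.1.setReg hi x, h.2⟩
  have hpass : ∀ k s', Q k s' → Q (k + 1) (relaxPass.denote s') := by
    rintro k s' ⟨h1, h2, h3, h4⟩
    obtain ⟨p1, p2, p3, p4⟩ := relaxPass_spec h1 h2 h3
    refine ⟨h1.denote (by decide) (by decide) (by decide),
      by rw [values_congr (arr_denote relaxPass (by decide) s'), h2], p1, ?_⟩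
    by_cases he : values n (relaxPass.denote s') 6 = values n s' 6
    · left; rw [he]; exact p3 he
    · rcases h4 with h4 | h4
      · exact absurd (p4 h4) he
      · right
        obtain ⟨y, hy⟩ := Function.ne_iff.1 he
        have : ∑ x, values n (relaxPass.denote s') 6 x < ∑ x, values n s' 6 x :=
          Finset.sum_lt_sum (fun x _ => p2 x) ⟨y, Finset.mem_univ _, lt_of_le_of_ne (p2 y) hy⟩
        omega
  have h1 : ∀ k s', Q k s' → Q (k + n) ((for_ 12 relaxPass).denote s') := by
    intro k s' h
    have := for_rule (i := 12) (P := relaxPass) (s := s') (fun l => Q (k + l))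
      (fun l s'' x => hQset _ _ _ _ (by decide)) h fun l s'' _ _ _ h => hpass _ _ h
    rwa [h.1.reg_zero] at this
  have h2 : ∀ k s', Q k s' → Q (k + n * n) ((for_ 11 (for_ 12 relaxPass)).denote s') := by
    intro k s' h
    have := for_rule (i := 11) (P := for_ 12 relaxPass) (s := s') (fun l => Q (k + l * n))
      (fun l s'' x => hQset _ _ _ _ (by decide)) (by simpa using h) fun l s'' _ _ _ h => by
        rw [Nat.succ_mul, ← add_assoc]; exact h1 _ _ h
    rwa [h.1.reg_zero] at this
  have h3 : Q (n * (n * n)) (relax.denote s) := by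
    have := for_rule (i := 10) (P := for_ 11 (for_ 12 relaxPass)) (s := s)
      (fun l => Q (l * (n * n)))
      (fun l s'' x => hQset _ _ _ _ (by decide)) ⟨hG, hw, hD, Or.inr (by
        simp only [zero_mul, add_zero]
        refine (Finset.sum_le_card_nsmul _ _ (n * n) fun x _ => hD.le x).trans ?_
        simp)⟩ fun l s'' _ _ _ h => by rw [Nat.succ_mul]; exact h2 _ _ h
    rwa [hG.reg_zero] at this
  refine ⟨h3.2.2.1, h3.2.2.2.elim id fun h u x _ => ?_⟩
  have := Finset.single_le_sum (f := values n (relax.denote s) 6) (fun _ _ => Nat.zero_le _)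
    (Finset.mem_univ x)
  omega

/-- Fill array `6` with the value of register `4`. -/
def initDist : ForProgram := .for_ 10 (.write 6 (.reg 10) (.reg 4))

theorem initDist_spec (hn : s.reg 0 = n) (x : Fin n) :
    (initDist.denote s).arr 6 x = s.reg 4 := by
  have h := for_rule (i := 10) (P := .write 6 (.reg 10) (.reg 4)) (s := s)
    (fun k s' => ∀ x < k, s'.arr 6 x = s.reg 4) (fun _ _ _ h => h)
    (fun _ h => absurd h (by omega)) (by
      intro k s' hk hF hi h x hx
      simp only [ForProgram.denote, arr_setCell, if_true, Expr.eval, hi, Function.update_apply,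
        hF.1 4 (by decide)]
      split_ifs with hxk
      · rfl
      · exact h x (by omega))
  exact h x (by rw [hn]; exact x.2)

/-! ### Parents, tree paths and searching a set -/

/-- Put the parents for the distances in array `6` with root in register `20` into array `7`. -/
def parents : ForProgram :=
  .seq (.for_ 10 (.for_ 11 (.ite (adjExpr 11 10)
    (.ite (.sub (.add (.cell 6 (.reg 10)) (.const 1))
        (.add (.cell 6 (.reg 11)) (.cell 11 (.reg 10))))
      (.write 7 (.reg 10) (.reg 11)) .skip) .skip)))
    (.write 7 (.reg 20) (.reg 20))

/-- The hypothesis `h7` makes the entries that are never written vertices as well, so that `par` is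
a total function and following parents never leaves the vertex set. Adding `1` before the
subtraction turns the test into a non-strict inequality. -/
theorem parents_spec (hG : HasGraph s H) (hw : values n s 11 = w) {v : Fin n} (hv : s.reg 20 = v)
    (h7 : ∀ i : Fin n, s.arr 7 i < n) :
    ∃ par : Fin n → Fin n, (∀ x : Fin n, (parents.denote s).arr 7 x = par x) ∧ par v = v ∧
      ∀ x, x ≠ v → (∃ u, H.Adj u x ∧ values n s 6 u + w x ≤ values n s 6 x) →
        H.Adj (par x) x ∧ values n s 6 (par x) + w x ≤ values n s 6 x := by
  classical
  let R : Fin n → Fin n → Prop := fun u x => H.Adj u x ∧ values n s 6 u + w x ≤ values n s 6 x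
  have h := for_rule (i := 10) (P := .for_ 11 (.ite (adjExpr 11 10)
    (.ite (.sub (.add (.cell 6 (.reg 10)) (.const 1))
        (.add (.cell 6 (.reg 11)) (.cell 11 (.reg 10))))
      (.write 7 (.reg 10) (.reg 11)) .skip) .skip)) (s := s)
    (fun k s' => ∃ par : Fin n → Fin n, (∀ x : Fin n, s'.arr 7 x = par x) ∧
      ∀ x : Fin n, (x : ℕ) < k → (∃ u, R u x) → R (par x) x) (fun _ _ _ h => h)
    ⟨fun x => ⟨s.arr 7 x, h7 x⟩, fun _ => rfl, fun _ h => absurd h (by omega)⟩ (by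
      rintro k s' hk hF hi ⟨par, hpar, hR⟩
      rw [hG.reg_zero] at hk
      have hG' := hG.frame hF (by decide) (by decide) (by decide)
      have h := for_rule (i := 11) (P := .ite (adjExpr 11 10)
        (.ite (.sub (.add (.cell 6 (.reg 10)) (.const 1))
            (.add (.cell 6 (.reg 11)) (.cell 11 (.reg 10))))
          (.write 7 (.reg 10) (.reg 11)) .skip) .skip) (s := s')
        (fun l s'' => ∃ p : Fin n, (∀ x : Fin n, s''.arr 7 x = Function.update par ⟨k, hk⟩ p x) ∧
          ((∃ u : Fin n, (u : ℕ) < l ∧ R u ⟨k, hk⟩) → R p ⟨k, hk⟩)) (fun _ _ _ h => h)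
        ⟨par ⟨k, hk⟩, by simpa using hpar, fun ⟨_, h, _⟩ => absurd h (by omega)⟩ (by
          rintro l s'' hl hF' hi' ⟨p, hp, hpR⟩
          rw [hG'.reg_zero] at hl
          have hG'' := hG'.frame hF' (by decide) (by decide) (by decide)
          have hk' : s''.reg 10 = k := (hF'.1 10 (by decide)).trans hi
          have h6 : s''.arr 6 = s.arr 6 := (hF'.2 6 (by decide)).trans (hF.2 6 (by decide))
          have h11 : s''.arr 11 = s.arr 11 := (hF'.2 11 (by decide)).trans (hF.2 11 (by decide))
          have hadj := hG''.adjExpr_eval (u := 11) (v := 10) (x := ⟨l, hl⟩) (y := ⟨k, hk⟩) hi' hk'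
          have hle : (Expr.sub (.add (.cell 6 (.reg 10)) (.const 1))
              (.add (.cell 6 (.reg 11)) (.cell 11 (.reg 10)))).eval s'' ≠ 0 ↔
              values n s 6 ⟨l, hl⟩ + w ⟨k, hk⟩ ≤ values n s 6 ⟨k, hk⟩ := by
            simp only [Expr.eval, hk', hi', h6, h11, values, ← hw]; omega
          have hiff : R ⟨l, hl⟩ ⟨k, hk⟩ ↔ _ := and_congr hadj.symm hle.symm
          simp only [ForProgram.denote]
          have hno : ¬ R ⟨l, hl⟩ ⟨k, hk⟩ →
              (∃ u : Fin n, (u : ℕ) < l + 1 ∧ R u ⟨k, hk⟩) → R p ⟨k, hk⟩ := by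
            rintro hn ⟨u, hu, hRu⟩
            rcases Nat.lt_succ_iff_lt_or_eq.1 hu with hlt | heq
            · exact hpR ⟨u, hlt, hRu⟩
            · obtain rfl : u = ⟨l, hl⟩ := Fin.ext heq
              exact absurd hRu hn
          split_ifs with c1 c2
          · refine ⟨⟨l, hl⟩, fun x => ?_, fun _ => hiff.2 ⟨c1, c2⟩⟩
            have := hp x
            simp only [arr_setCell, if_true, Expr.eval, hk', hi',
              Function.update_apply, Fin.ext_iff] at this ⊢
            split_ifs at this ⊢
            · rfl
            · exact this
          · exact ⟨p, hp, hno fun h => c2 (hiff.1 h).2⟩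
          · exact ⟨p, hp, hno fun h => c1 (hiff.1 h).1⟩)
      obtain ⟨p, hp, hpR⟩ := h
      rw [hG'.reg_zero] at hpR
      refine ⟨_, hp, fun x hx hex => ?_⟩
      rcases Nat.lt_succ_iff_lt_or_eq.1 hx with hlt | heq
      · rw [Function.update_of_ne (by rw [ne_eq, Fin.ext_iff]; simp; omega)]
        exact hR x hlt hex
      · obtain rfl : x = ⟨k, hk⟩ := Fin.ext heq
        obtain ⟨u, hu⟩ := hex
        rw [Function.update_self]; exact hpR ⟨u, u.2, hu⟩)
  obtain ⟨par, hpar, hR⟩ := h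
  rw [hG.reg_zero] at hR
  refine ⟨Function.update par v v, fun x => ?_, by simp, fun x hx hex => ?_⟩
  · have := hpar x
    have hv' := (reg_denote (.for_ 10 (.for_ 11 (.ite (adjExpr 11 10)
      (.ite (.sub (.add (.cell 6 (.reg 10)) (.const 1))
          (.add (.cell 6 (.reg 11)) (.cell 11 (.reg 10))))
        (.write 7 (.reg 10) (.reg 11)) .skip) .skip))) (r := 20) (by decide) s).trans hv
    rw [parents, ForProgram.denote]
    conv_lhs => rw [ForProgram.denote]
    simp only [arr_setCell, if_true, Expr.eval, hv', Function.update_apply, Fin.ext_iff]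
    split_ifs
    · rfl
    · exact this
  · rw [Function.update_of_ne hx]; exact hR x x.2 hex

/-- Add the vertices on the way from the vertex in register `r` to the root to the set in
array `5`. -/
def markFrom (r : ℕ) : ForProgram :=
  .seq (.assign 13 (.reg r))
    (.for_ 10 (.seq (.write 5 (.reg 13) (.const 1)) (.assign 13 (.cell 7 (.reg 13)))))

theorem markFrom_spec {r : ℕ} (hn : s.reg 0 = n) {z : Fin n} (hz : s.reg r = z)
    {par : Fin n → Fin n} (hpar : ∀ x : Fin n, s.arr 7 x = par x) :
    supp n ((markFrom r).denote s) 5 = supp n s 5 ∪ ancestors par z := by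
  have h := for_rule (i := 10) (P := .seq (.write 5 (.reg 13) (.const 1))
      (.assign 13 (.cell 7 (.reg 13)))) (s := setReg s 13 z)
    (fun k s' => s'.reg 13 = par^[k] z ∧
      supp n s' 5 = supp n s 5 ∪ (Finset.range k).image fun i => par^[i] z)
    (fun _ _ _ h => h) ⟨by simp, by
      rw [Finset.range_zero, Finset.image_empty, Finset.union_empty]; rfl⟩ (by
      rintro k s' hk hF hi ⟨h1, h2⟩
      constructor
      · simp only [ForProgram.denote, reg_setReg, if_true, Expr.eval, reg_setCell, h1, arr_setCell]
        rw [if_neg (by decide), hF.2 7 (by decide), arr_setReg, hpar,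
          Function.iterate_succ_apply']
      · rw [Finset.range_add_one, Finset.image_insert, Finset.union_insert, ← h2]
        ext x
        simp only [ForProgram.denote, mem_supp, arr_setReg, arr_setCell, if_true, Expr.eval, h1,
          Function.update_apply, Finset.mem_insert, Fin.ext_iff]
        split_ifs with hx <;> simp [hx])
  obtain ⟨-, h⟩ := h
  rw [reg_setReg, if_neg (by decide), hn] at h
  rw [markFrom, ForProgram.denote, ForProgram.denote, Expr.eval, hz, h, ancestors,
    Fintype.card_fin]

/-- Empty the set in array `5`. -/
def clearSet : ForProgram := .for_ 10 (.write 5 (.reg 10) (.const 0))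

theorem clearSet_spec (hn : s.reg 0 = n) : supp n (clearSet.denote s) 5 = ∅ := by
  have h := for_rule (i := 10) (P := .write 5 (.reg 10) (.const 0)) (s := s)
    (fun k s' => ∀ x < k, s'.arr 5 x = 0) (fun _ _ _ h => h)
    (fun _ h => absurd h (by omega)) (by
      intro k s' hk hF hi h x hx
      simp only [ForProgram.denote, arr_setCell, if_true, Expr.eval, hi, Function.update_apply]
      split_ifs with hxk
      · rfl
      · exact h x (by omega))
  ext x
  rw [mem_supp]
  simpa [clearSet] using h x (by rw [hn]; exact x.2)

/-- Find a member of the set in array `5`. -/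
def findMember : ForProgram :=
  .seq (.assign 14 (.const 0))
    (.for_ 10 (.ite (.cell 5 (.reg 10)) (.seq (.assign 14 (.const 1)) (.assign 15 (.reg 10))) .skip))

theorem findMember_spec (hn : s.reg 0 = n) :
    ((findMember.denote s).reg 14 = 0 ∧ supp n s 5 = ∅) ∨
      ((findMember.denote s).reg 14 ≠ 0 ∧
        ∃ x ∈ supp n s 5, (findMember.denote s).reg 15 = x) := by
  have h := for_rule (i := 10) (P := .ite (.cell 5 (.reg 10))
      (.seq (.assign 14 (.const 1)) (.assign 15 (.reg 10))) .skip) (s := setReg s 14 0)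
    (fun k s' => (s'.reg 14 = 0 ∧ ∀ x ∈ supp n s 5, ¬ (x : ℕ) < k) ∨
      (s'.reg 14 ≠ 0 ∧ ∃ x ∈ supp n s 5, s'.reg 15 = x))
    (fun _ _ _ h => h) (Or.inl (by simp)) (by
      intro k s' hk hF hi h
      rw [reg_setReg, if_neg (by decide), hn] at hk
      simp only [ForProgram.denote, Expr.eval, hi, hF.2 5 (by decide), arr_setReg]
      split_ifs with h5
      · right
        exact ⟨by simp, ⟨k, hk⟩, mem_supp.2 h5, by simp [hi]⟩
      · rcases h with ⟨h1, h2⟩ | h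
        · left
          refine ⟨h1, fun x hx hxk => ?_⟩
          rcases Nat.lt_succ_iff_lt_or_eq.1 hxk with hlt | heq
          · exact h2 x hx hlt
          · rw [mem_supp, heq] at hx; exact h5 hx
        · exact Or.inr h)
  rw [reg_setReg, if_neg (by decide), hn] at h
  rcases h with ⟨h1, h2⟩ | h
  · exact Or.inl ⟨h1, Finset.eq_empty_of_forall_notMem fun x hx => h2 x hx x.2⟩
  · exact Or.inr h

end

/-! ### Finding a cycle in a dense set -/

/-- A test for inequality. -/
def neExpr (e f : Expr) : Expr := .add (.sub e f) (.sub f e)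

theorem neExpr_eval {s : Memory} {e f : Expr} :
    (neExpr e f).eval s ≠ 0 ↔ e.eval s ≠ f.eval s := by
  simp only [neExpr, Expr.eval]; omega

/-- Find a neighbour, in the set in array `5`, of the vertex in register `13` other than the vertex
in register `12`. -/
def nextVertex : ForProgram :=
  .for_ 11 (.ite (.cell 5 (.reg 11)) (.ite (adjExpr 13 11)
    (.ite (neExpr (.reg 11) (.reg 12)) (.assign 14 (.reg 11)) .skip) .skip) .skip)

/-- Extend a non-backtracking walk in array `9`. -/
def extendWalk : ForProgram :=
  .seq nextVertex (.seq (.assign 12 (.reg 13)) (.seq (.assign 13 (.reg 14))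
    (.write 9 (.add (.reg 10) (.const 1)) (.reg 13))))

/-- Put a non-backtracking walk into array `9`. -/
def findWalk : ForProgram :=
  .seq (.assign 13 (.reg 15)) (.seq (.assign 12 (.reg 0)) (.seq (.write 9 (.const 0) (.reg 13))
    (.for_ 10 extendWalk)))

/-- Find a closest repetition in array `9`. -/
def findGap : ForProgram :=
  .seq (.assign 16 (.reg 0)) (.for_ 10 (.for_ 11 (.ite (.sub (.reg 0) (.add (.reg 10) (.reg 11)))
    (.ite (neExpr (.cell 9 (.reg 10)) (.cell 9 (.add (.add (.reg 10) (.reg 11)) (.const 1)))) .skip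
      (.ite (.sub (.reg 16) (.reg 11)) (.seq (.assign 16 (.reg 11)) (.assign 17 (.reg 10))) .skip))
    .skip)))

/-- Copy the part of array `9` that starts at the repetition to array `a`. -/
def copyLoop (a : ℕ) : ForProgram :=
  .for_ 10 (.write a (.reg 10) (.cell 9 (.add (.reg 17) (.reg 10))))

/-- Put the cycle found in array `9` into array `a`. -/
def copyCycle (a : ℕ) : ForProgram :=
  .seq (copyLoop a) (.seq (.write a (.add (.reg 16) (.const 1)) (.cell 9 (.reg 17)))
      (.assign a (.add (.reg 16) (.const 2))))

/-- Put a cycle in the dense set in array `5` into array `a`. -/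
def findCycle (a : ℕ) : ForProgram := .seq findWalk (.seq findGap (copyCycle a))

section

variable {n : ℕ} {H : SimpleGraph (Fin n)} {s : Memory}

theorem nextVertex_spec (hG : HasGraph s H) {x : Fin n} (hx : s.reg 13 = x)
    (h : ∃ y ∈ supp n s 5, H.Adj x y ∧ (y : ℕ) ≠ s.reg 12) :
    ∃ y ∈ supp n s 5, H.Adj x y ∧ (y : ℕ) ≠ s.reg 12 ∧ (nextVertex.denote s).reg 14 = y := by
  have h' := for_rule (i := 11) (P := .ite (.cell 5 (.reg 11)) (.ite (adjExpr 13 11)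
    (.ite (neExpr (.reg 11) (.reg 12)) (.assign 14 (.reg 11)) .skip) .skip) .skip) (s := s)
    (fun k s' => (∃ y ∈ supp n s 5, (y : ℕ) < k ∧ H.Adj x y ∧ (y : ℕ) ≠ s.reg 12) →
      ∃ y ∈ supp n s 5, H.Adj x y ∧ (y : ℕ) ≠ s.reg 12 ∧ s'.reg 14 = y)
    (fun _ _ _ h => by simpa using h) (fun ⟨_, _, h, _⟩ => absurd h (by omega)) (by
      intro k s' hk hF hi hI
      rw [hG.reg_zero] at hk
      have hadj := (hG.frame hF (by decide) (by decide) (by decide)).adjExpr_eval (u := 13)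
        (v := 11) (x := x) (y := ⟨k, hk⟩) ((hF.1 13 (by decide)).trans hx) hi
      have hne := neExpr_eval (s := s') (e := .reg 11) (f := .reg 12)
      have h5 : (Expr.cell 5 (.reg 11)).eval s' = s.arr 5 k := by
        simp only [Expr.eval, hi, hF.2 5 (by decide)]
      have hne' : (Expr.reg 11).eval s' ≠ (Expr.reg 12).eval s' ↔ k ≠ s.reg 12 := by
        simp only [Expr.eval, hi, hF.1 12 (by decide)]
      rw [hne'] at hne
      have hno : ¬ (s.arr 5 k ≠ 0 ∧ H.Adj x ⟨k, hk⟩ ∧ k ≠ s.reg 12) →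
          (∃ y ∈ supp n s 5, (y : ℕ) < k + 1 ∧ H.Adj x y ∧ (y : ℕ) ≠ s.reg 12) →
          ∃ y ∈ supp n s 5, H.Adj x y ∧ (y : ℕ) ≠ s.reg 12 ∧ s'.reg 14 = y := by
        rintro hno ⟨y, hy, hyk, h1, h2⟩
        rcases Nat.lt_succ_iff_lt_or_eq.1 hyk with hlt | heq
        · exact hI ⟨y, hy, hlt, h1, h2⟩
        · obtain rfl : y = ⟨k, hk⟩ := Fin.ext heq
          exact absurd ⟨mem_supp.1 hy, h1, h2⟩ hno
      simp only [ForProgram.denote, h5]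
      split_ifs with c1 c2 c3
      · exact fun _ => ⟨⟨k, hk⟩, mem_supp.2 c1, hadj.1 c2, hne.1 c3, by simp [Expr.eval, hi]⟩
      · exact hno fun h => c3 (hne.2 h.2.2)
      · exact hno fun h => c2 (hadj.2 h.2.1)
      · exact hno fun h => c1 h.1)
  rw [hG.reg_zero] at h'
  obtain ⟨y, hy, h1, h2⟩ := h
  exact h' ⟨y, hy, y.2, h1, h2⟩

/-- Register `12` holds the previous vertex, which must not come next. It starts with the value `n`,
which is no vertex, so that the first step is unrestricted; later steps succeed because a second
neighbour exists. -/
theorem findWalk_spec (hG : HasGraph s H) (hd : Dense H (supp n s 5)) {x : Fin n}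
    (hx : x ∈ supp n s 5) (h15 : s.reg 15 = x) :
    ∃ f : ℕ → Fin n, (∀ i ≤ n, (findWalk.denote s).arr 9 i = f i) ∧ (∀ i ≤ n, f i ∈ supp n s 5) ∧
      (∀ l < n, H.Adj (f l) (f (l + 1))) ∧ ∀ l, l + 2 ≤ n → f (l + 2) ≠ f l := by
  set s₁ : Memory := setCell (setReg (setReg s 13 x) 12 n) 9 0 x with hs₁
  have hG₁ : HasGraph s₁ H := hG.congr (by simp [hs₁]) (by simp [hs₁]) (by simp [hs₁])
  have h5₁ : s₁.arr 5 = s.arr 5 := by simp [hs₁]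
  have h := for_rule (i := 10) (P := extendWalk) (s := s₁)
    (fun k s' => ∃ f : ℕ → Fin n, (∀ i ≤ k, s'.arr 9 i = f i) ∧ (∀ i ≤ k, f i ∈ supp n s 5) ∧
      (∀ l < k, H.Adj (f l) (f (l + 1))) ∧ (∀ l, l + 2 ≤ k → f (l + 2) ≠ f l) ∧
      s'.reg 13 = f k ∧ s'.reg 12 = if k = 0 then n else f (k - 1))
    (fun _ _ _ h => by simpa using h)
    ⟨fun _ => x, fun i hi => by simp [hs₁, Nat.le_zero.1 hi], fun _ _ => hx,
      fun _ h => absurd h (by omega), fun _ h => absurd h (by omega), by simp [hs₁],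
      by simp [hs₁]⟩ (by
      rintro k s' hk hF hi ⟨f, f1, f2, f3, f4, f5, f6⟩
      have hG' := hG₁.frame hF (by decide) (by decide) (by decide)
      have hsupp : supp n s' 5 = supp n s 5 := by
        rw [supp_congr (hF.2 5 (by decide)), supp_congr h5₁]
      obtain ⟨y, hy, hxy, hne, hy'⟩ := nextVertex_spec hG' f5 (by
        rw [hsupp]
        obtain ⟨a, ha, b, hb, hab, h1, h2⟩ := hd _ (f2 k le_rfl)
        by_cases e : (a : ℕ) = s'.reg 12
        · exact ⟨b, hb, h2, fun e' => hab (Fin.ext (e.trans e'.symm))⟩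
        · exact ⟨a, ha, h1, e⟩)
      have hN := frame_denote nextVertex s'
      refine ⟨Function.update f (k + 1) y, fun i hi' => ?_, fun i hi' => ?_, fun l hl => ?_,
        fun l hl => ?_, ?_, ?_⟩
      · simp only [extendWalk, ForProgram.denote, arr_setCell, if_true, Expr.eval, reg_setReg,
          arr_setReg, hN.1 10 (by decide), hi, hy', hN.2 9 (by decide), Function.update_apply]
        simp only [Nat.reduceEqDiff, if_false]
        split_ifs
        · rfl
        · exact f1 i (by omega)
      · rw [Function.update_apply]
        split_ifs
        · rw [← hsupp]; exact hy
        · exact f2 i (by omega)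
      · rw [Function.update_apply, Function.update_apply, if_neg (by omega)]
        split_ifs with e
        · obtain rfl : l = k := by omega
          exact hxy
        · exact f3 l (by omega)
      · rw [Function.update_apply, Function.update_apply, if_neg (by omega : ¬ l = k + 1)]
        split_ifs with e
        · obtain rfl : l + 1 = k := by omega
          rw [f6, if_neg (by omega), Nat.add_sub_cancel] at hne
          exact fun e => hne (by rw [e])
        · exact f4 l (by omega)
      · simp only [extendWalk, ForProgram.denote, reg_setCell, reg_setReg, Expr.eval, hy',
          Function.update_self]
        simp
      · simp only [extendWalk, ForProgram.denote, reg_setCell, reg_setReg, Expr.eval,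
          hN.1 13 (by decide), f5]
        simp)
  rw [hG₁.reg_zero] at h
  obtain ⟨f, f1, f2, f3, f4, -, -⟩ := h
  refine ⟨f, fun i hi => ?_, f2, f3, f4⟩
  rw [← f1 i hi]
  simp only [findWalk, ForProgram.denote, Expr.eval, h15, reg_setReg, hs₁, hG.reg_zero]
  simp [hG.reg_zero]

theorem findGap_spec (hn : s.reg 0 = n) {f : ℕ → Fin n} (hf : ∀ i ≤ n, s.arr 9 i = f i) :
    ∃ i k, i + k ≤ n ∧ 0 < k ∧ f (i + k) = f i ∧
      (∀ a b, a < b → b ≤ n → f a = f b → k ≤ b - a) ∧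
      (findGap.denote s).reg 16 + 1 = k ∧ (findGap.denote s).reg 17 = i := by
  -- Register `16` holds the gap minus one, and the value `n` means that no repetition has been
  -- seen. The pigeonhole principle excludes this value at the end.
  let A : Memory → Prop := fun s' => s'.reg 16 = n ∨
    (s'.reg 17 + s'.reg 16 + 1 ≤ n ∧ f (s'.reg 17 + s'.reg 16 + 1) = f (s'.reg 17))
  let B : ℕ → ℕ → Prop := fun i j => i + j + 1 ≤ n ∧ f (i + j + 1) = f i
  have h := for_rule (i := 10) (P := .for_ 11 (.ite (.sub (.reg 0) (.add (.reg 10) (.reg 11)))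
    (.ite (neExpr (.cell 9 (.reg 10)) (.cell 9 (.add (.add (.reg 10) (.reg 11)) (.const 1)))) .skip
      (.ite (.sub (.reg 16) (.reg 11)) (.seq (.assign 16 (.reg 11)) (.assign 17 (.reg 10))) .skip))
    .skip)) (s := setReg s 16 n)
    (fun k s' => A s' ∧ ∀ i < k, ∀ j, B i j → s'.reg 16 ≤ j)
    (fun _ _ _ h => by simpa [A] using h) ⟨Or.inl (by simp), fun _ h => absurd h (by omega)⟩ (by
      rintro k s' hk hF hi ⟨hA, hB⟩
      have hn' : s'.reg 0 = n := by rw [hF.1 0 (by decide)]; simpa using hn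
      have h' := for_rule (i := 11) (P := .ite (.sub (.reg 0) (.add (.reg 10) (.reg 11)))
        (.ite (neExpr (.cell 9 (.reg 10)) (.cell 9 (.add (.add (.reg 10) (.reg 11)) (.const 1))))
          .skip
          (.ite (.sub (.reg 16) (.reg 11)) (.seq (.assign 16 (.reg 11)) (.assign 17 (.reg 10)))
            .skip)) .skip) (s := s')
        (fun l s'' => A s'' ∧ s''.reg 16 ≤ s'.reg 16 ∧ ∀ j < l, B k j → s''.reg 16 ≤ j)
        (fun _ _ _ h => by simpa [A] using h) ⟨hA, le_rfl, fun _ h => absurd h (by omega)⟩ (by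
          rintro l s'' hl hF' hi' ⟨hA', hle, hB'⟩
          have hk' : s''.reg 10 = k := (hF'.1 10 (by decide)).trans hi
          have e1 : (Expr.sub (.reg 0) (.add (.reg 10) (.reg 11))).eval s'' ≠ 0 ↔
              k + l + 1 ≤ n := by
            simp only [Expr.eval, hk', hi', hF'.1 0 (by decide), hn']; omega
          have e2 : k + l + 1 ≤ n →
              ((neExpr (.cell 9 (.reg 10)) (.cell 9 (.add (.add (.reg 10) (.reg 11)) (.const 1)))).eval
                s'' ≠ 0 ↔ f (k + l + 1) ≠ f k) := by
            intro hkl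
            rw [neExpr_eval]
            simp only [Expr.eval, hk', hi', hF'.2 9 (by decide), hF.2 9 (by decide), arr_setReg]
            rw [hf k (by omega), hf _ hkl, ne_comm, ne_eq, ne_eq, Fin.ext_iff]
          have e3 : (Expr.sub (.reg 16) (.reg 11)).eval s'' ≠ 0 ↔ l < s''.reg 16 := by
            simp only [Expr.eval, hi']; omega
          have hno : (B k l → s''.reg 16 ≤ l) → ∀ j < l + 1, B k j → s''.reg 16 ≤ j := by
            intro h j hj hkj
            rcases Nat.lt_succ_iff_lt_or_eq.1 hj with hlt | rfl
            · exact hB' j hlt hkj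
            · exact h hkj
          simp only [ForProgram.denote]
          split_ifs with c1 c2 c3
          · exact ⟨hA', hle, hno fun h => absurd h.2 ((e2 (e1.1 c1)).1 c2)⟩
          · have hkl := e1.1 c1
            have hfe : f (k + l + 1) = f k := by
              by_contra hc; exact c2 ((e2 hkl).2 hc)
            have hlt := e3.1 c3
            simp only [Expr.eval, reg_setReg, hi', hk', A]
            refine ⟨Or.inr (by simpa using ⟨hkl, hfe⟩), by simp; omega, fun j hj hkj => ?_⟩
            rcases Nat.lt_succ_iff_lt_or_eq.1 hj with hj' | rfl
            · have := hB' j hj' hkj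
              simp; omega
            · simp
          · exact ⟨hA', hle, hno fun _ => by have := fun h => c3 (e3.2 h); omega⟩
          · exact ⟨hA', hle, hno fun h => absurd (e1.2 h.1) c1⟩)
      rw [hn'] at h'
      obtain ⟨h1, h2, h3⟩ := h'
      refine ⟨h1, fun i hi' j hij => ?_⟩
      rcases Nat.lt_succ_iff_lt_or_eq.1 hi' with hlt | rfl
      · exact h2.trans (hB i hlt j hij)
      · exact h3 j (by have := hij.1; omega) hij)
  have hs : findGap.denote s = (ForProgram.for_ 10 (.for_ 11
    (.ite (.sub (.reg 0) (.add (.reg 10) (.reg 11)))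
    (.ite (neExpr (.cell 9 (.reg 10)) (.cell 9 (.add (.add (.reg 10) (.reg 11)) (.const 1)))) .skip
      (.ite (.sub (.reg 16) (.reg 11)) (.seq (.assign 16 (.reg 11)) (.assign 17 (.reg 10))) .skip))
    .skip))).denote (setReg s 16 n) := by
    rw [findGap, ForProgram.denote, ForProgram.denote, Expr.eval, hn]
  rw [← hs] at h
  rw [reg_setReg, if_neg (by decide), hn] at h
  obtain ⟨hA, hB⟩ := h
  have hlt : (findGap.denote s).reg 16 < n := by
    obtain ⟨i, k, h1, h2, h3⟩ := exists_gap f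
    rw [Fintype.card_fin] at h1
    have := hB i (by omega) (k - 1) ⟨by omega, by
      rw [show i + (k - 1) + 1 = i + k by omega]; exact h3⟩
    omega
  rcases hA with hA | ⟨h1, h2⟩
  · omega
  · refine ⟨_, (findGap.denote s).reg 16 + 1, h1, Nat.succ_pos _, h2,
      fun a b hab hb he => ?_, rfl, rfl⟩
    have := hB a (by omega) (b - a - 1) ⟨by omega, by
      rw [show a + (b - a - 1) + 1 = b by omega]; exact he.symm⟩
    omega

/-- The loop fills only the cells `0, …, n - 1`, while the closing vertex belongs in cell `k`, and
`k` may equal `n`. Hence the separate write. Surplus cells are harmless, as the list length is `k +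
1`. -/
theorem copyCycle_spec {a : ℕ} (ha : a = 1 ∨ a = 2) (hn : s.reg 0 = n) {f : ℕ → Fin n}
    (hf : ∀ i ≤ n, s.arr 9 i = f i) {i k : ℕ} (hik : i + k ≤ n) (hfk : f (i + k) = f i)
    (h16 : s.reg 16 + 1 = k) (h17 : s.reg 17 = i) :
    ((copyCycle a).denote s).list a = (List.range (k + 1)).map fun l => (f (i + l) : ℕ) := by
  have ha9 : 9 ≠ a := by omega
  have h := for_rule (i := 10) (P := .write a (.reg 10) (.cell 9 (.add (.reg 17) (.reg 10))))
    (s := s) (fun m s' => ∀ l < m, s'.arr a l = s.arr 9 (i + l))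
    (fun _ _ _ h => h) (fun _ h => absurd h (by omega)) (by
      intro m s' hm hF hi hI l hl
      have h9 : s'.arr 9 = s.arr 9 := hF.2 9 (by simpa [arrs] using ha9)
      simp only [ForProgram.denote, arr_setCell, if_true, Expr.eval, hi, hF.1 17 (by simp [regs]),
        h17, h9, Function.update_apply]
      split_ifs with hlm
      · rw [hlm]
      · exact hI l (by omega))
  have hF := frame_denote (copyLoop a) s
  have h9 := hF.2 9 (by simpa [arrs, copyLoop] using ha9)
  have e16 := hF.1 16 (by simp [regs, copyLoop])
  have e17 := hF.1 17 (by simp [regs, copyLoop])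
  rw [hn, ← copyLoop] at h
  have hreg : ((copyCycle a).denote s).reg a = k + 1 := by
    simp only [copyCycle, ForProgram.denote, reg_setReg, if_true, Expr.eval, reg_setCell, e16]
    omega
  rw [Memory.list, hreg]
  refine List.map_congr_left fun l hl => ?_
  rw [List.mem_range] at hl
  simp only [copyCycle, ForProgram.denote, arr_setReg, arr_setCell, if_true, Expr.eval, e16, e17,
    h9, reg_setCell, h17, Function.update_apply, h16]
  split_ifs with hlk
  · rw [hlk, hfk, hf i (by omega)]
  · rw [h l (by omega), hf _ (by omega)]

theorem findCycle_spec {a : ℕ} (ha : a = 1 ∨ a = 2) (hG : HasGraph s H)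
    (hd : Dense H (supp n s 5)) {x : Fin n} (hx : x ∈ supp n s 5) (h15 : s.reg 15 = x) :
    ∃ (u : Fin n) (p : H.Walk u u), p.IsCycle ∧ (∀ y ∈ p.support, y ∈ supp n s 5) ∧
      p.support.map (fun v : Fin n => (v : ℕ)) = ((findCycle a).denote s).list a := by
  obtain ⟨f, f1, f2, f3, f4⟩ := findWalk_spec hG hd hx h15
  have hG₁ : HasGraph (findWalk.denote s) H := hG.denote (by decide) (by decide) (by decide)
  obtain ⟨i, k, hik, hk, hfk, hmin, h16, h17⟩ := findGap_spec hG₁.reg_zero f1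
  obtain ⟨p, hp, hps⟩ := exists_cycle_of_gap f3 f4 hik hk hfk hmin
  have hF := frame_denote findGap (findWalk.denote s)
  have hl := copyCycle_spec ha ((hF.1 0 (by decide)).trans hG₁.reg_zero)
    (f := f) (by rw [hF.2 9 (by decide)]; exact f1) hik hfk h16 h17
  refine ⟨_, p, hp, fun y hy => ?_, ?_⟩
  · rw [hps, List.mem_map] at hy
    obtain ⟨l, hl, rfl⟩ := hy
    rw [List.mem_range] at hl
    exact f2 _ (by omega)
  · rw [hps, List.map_map, findCycle, ForProgram.denote, ForProgram.denote, hl]; rfl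

end

/-! ### Finding a lightest cycle -/

/-- Copy the set in array `5` to array `8`. -/
def saveSet : ForProgram := .for_ 10 (.write 8 (.reg 10) (.cell 5 (.reg 10)))

/-- Save the set in array `5` and its weight. -/
def commit : ForProgram :=
  .seq (.assign 23 (.const 1)) (.seq (.assign 24 (.reg 16)) saveSet)

/-- Save the set in array `5` if it is nonempty and its weight is the least so far. -/
def commitIfBetter : ForProgram :=
  .seq findMember (.ite (.reg 14)
    (.seq (.assign 16 (.add (.add (.cell 6 (.reg 21)) (.cell 6 (.reg 22))) (.cell 11 (.reg 20))))
      (.ite (.reg 23) (.ite (.sub (.reg 24) (.reg 16)) commit .skip) commit)) .skip)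

/-- Consider the core of the tree paths from the vertices in registers `21` and `22`. -/
def tryPair : ForProgram :=
  .ite (.sub (.reg 4) (.cell 6 (.reg 21))) (.ite (.sub (.reg 4) (.cell 6 (.reg 22)))
    (.seq clearSet (.seq (markFrom 21) (.seq (markFrom 22) (.seq peel commitIfBetter))))
    .skip) .skip

/-- Compute the shortest path tree with root in register `20`. -/
def findTree : ForProgram :=
  .seq initDist (.seq (.write 6 (.reg 20) (.const 0)) (.seq relax parents))

/-- Consider all pairs of paths of the shortest path tree with root in register `20`. -/
def tryRoot : ForProgram := .seq findTree (.for_ 21 (.for_ 22 tryPair))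

section

variable {n : ℕ} {H : SimpleGraph (Fin n)} {s : Memory} {w : Fin n → ℕ} {v : Fin n}

/-- The set in array `8`, if there is one, is dense, and its weight is bounded by register `24`. -/
def ValidSet (H : SimpleGraph (Fin n)) (w : Fin n → ℕ) (s : Memory) : Prop :=
  s.reg 23 = 0 ∨ ((supp n s 8).Nonempty ∧ Dense H (supp n s 8) ∧ ∑ x ∈ supp n s 8, w x ≤ s.reg 24)

/-- A set with a weight bound of at most `m` has been found. -/
def FoundLight (m : ℕ) (s : Memory) : Prop := s.reg 23 ≠ 0 ∧ s.reg 24 ≤ m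

theorem ValidSet.setReg (h : ValidSet H w s) {i : ℕ} (hi : i < 23) (a : ℕ) :
    ValidSet H w (setReg s i a) := by
  unfold ValidSet at h ⊢
  rw [reg_setReg, reg_setReg, if_neg (by omega), if_neg (by omega)]
  exact h

theorem FoundLight.setReg {m : ℕ} (h : FoundLight m s) {i : ℕ} (hi : i < 23) (a : ℕ) :
    FoundLight m (setReg s i a) := by
  unfold FoundLight at h ⊢
  rw [reg_setReg, reg_setReg, if_neg (by omega), if_neg (by omega)]
  exact h

theorem commit_spec (hn : s.reg 0 = n) : (commit.denote s).reg 23 = 1 ∧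
    (commit.denote s).reg 24 = s.reg 16 ∧ supp n (commit.denote s) 8 = supp n s 5 := by
  set s₁ := setReg (setReg s 23 1) 24 (s.reg 16) with hs₁
  have e : commit.denote s = saveSet.denote s₁ := by
    simp only [commit, ForProgram.denote, Expr.eval, hs₁]; simp
  have h := for_rule (i := 10) (P := .write 8 (.reg 10) (.cell 5 (.reg 10))) (s := s₁)
    (fun k s' => ∀ x < k, s'.arr 8 x = s.arr 5 x) (fun _ _ _ h => h)
    (fun _ h => absurd h (by omega)) (by
      intro k s' hk hF hi h x hx
      simp only [ForProgram.denote, arr_setCell, if_true, Expr.eval, hi, hF.2 5 (by decide),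
        Function.update_apply]
      split_ifs with hxk
      · rw [hxk]; rfl
      · exact h x (by omega))
  have hF := frame_denote saveSet s₁
  rw [e, hF.1 23 (by decide), hF.1 24 (by decide)]
  refine ⟨by simp [hs₁], by simp [hs₁], ?_⟩
  ext x
  rw [mem_supp, mem_supp, saveSet, h x (by simp [hs₁, hn])]

/-- The number compared and stored is the bound `m` and not the weight of the set. This is enough:
the bound is always valid, and some root and pair make it at most the minimum weight. -/
theorem commitIfBetter_spec (hG : HasGraph s H) (hV : ValidSet H w s) {m : ℕ}
    (hm : s.arr 6 (s.reg 21) + s.arr 6 (s.reg 22) + s.arr 11 (s.reg 20) = m)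
    (hd : Dense H (supp n s 5)) (hle : ∑ x ∈ supp n s 5, w x ≤ m) :
    ValidSet H w (commitIfBetter.denote s) ∧
      (∀ m', FoundLight m' s → FoundLight m' (commitIfBetter.denote s)) ∧
      ((supp n s 5).Nonempty → FoundLight m (commitIfBetter.denote s)) := by
  have hF := frame_denote findMember s
  have hV' : ValidSet H w (findMember.denote s) := by
    unfold ValidSet
    rw [hF.1 23 (by decide), hF.1 24 (by decide), supp_congr (hF.2 8 (by decide))]
    exact hV
  have hfound : ∀ m', FoundLight m' s → FoundLight m' (findMember.denote s) := by
    intro m'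
    unfold FoundLight
    rw [hF.1 23 (by decide), hF.1 24 (by decide)]
    exact id
  simp only [commitIfBetter, ForProgram.denote]
  rcases findMember_spec hG.reg_zero with ⟨h14, h5⟩ | ⟨h14, x, hx, -⟩
  · rw [if_neg (by simp [Expr.eval, h14])]
    exact ⟨hV', hfound, fun h => absurd h (by simp [h5])⟩
  · rw [if_pos (by simpa [Expr.eval] using h14)]
    have he : (Expr.add (.add (.cell 6 (.reg 21)) (.cell 6 (.reg 22))) (.cell 11 (.reg 20))).eval
        (findMember.denote s) = m := by
      simp only [Expr.eval, hF.1 20 (by decide), hF.1 21 (by decide), hF.1 22 (by decide),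
        hF.2 6 (by decide), hF.2 11 (by decide), hm]
    simp only [he]
    set s₁ := setReg (findMember.denote s) 16 m with hs₁
    have hn₁ : s₁.reg 0 = n := by
      rw [hs₁, reg_setReg, if_neg (by decide), hF.1 0 (by decide), hG.reg_zero]
    have h23 : s₁.reg 23 = s.reg 23 := by
      rw [hs₁, reg_setReg, if_neg (by decide), hF.1 23 (by decide)]
    have h24 : s₁.reg 24 = s.reg 24 := by
      rw [hs₁, reg_setReg, if_neg (by decide), hF.1 24 (by decide)]
    obtain ⟨c23, c24, c8⟩ := commit_spec hn₁
    have h16 : s₁.reg 16 = m := by simp [hs₁]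
    have h5 : supp n s₁ 5 = supp n s 5 := supp_congr (hF.2 5 (by decide))
    rw [h16] at c24
    rw [h5] at c8
    have hcV : ValidSet H w (commit.denote s₁) :=
      Or.inr (by rw [c8, c24]; exact ⟨⟨x, hx⟩, hd, hle⟩)
    have hcF : FoundLight m (commit.denote s₁) := ⟨by rw [c23]; decide, c24.le⟩
    by_cases k23 : s.reg 23 = 0
    · rw [if_neg (by simp [Expr.eval, h23, k23])]
      exact ⟨hcV, fun m' h => absurd k23 h.1, fun _ => hcF⟩
    · rw [if_pos (by simpa [Expr.eval, h23] using k23)]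
      by_cases hlt : m < s.reg 24
      · rw [if_pos (by simp [Expr.eval, h24, h16]; omega)]
        exact ⟨hcV, fun m' h => ⟨hcF.1, hcF.2.trans (hlt.le.trans h.2)⟩, fun _ => hcF⟩
      · rw [if_neg (by simp [Expr.eval, h24, h16]; omega)]
        refine ⟨hV', fun m' h => ?_, fun _ => ?_⟩
        · exact hfound m' h
        · exact hfound m ⟨k23, by omega⟩

/-- The core of the union of two tree paths is dense and no heavier than the union, whether or not
the two end vertices are adjacent. So all pairs may be tried without looking for edges outside the
tree. -/
theorem tryPair_spec (hG : HasGraph s H) (hw : ∀ x, 0 < w x) (hV : ValidSet H w s)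
    (hw11 : values n s 11 = w) {D : Fin n → ℕ} {par : Fin n → Fin n} (hD : values n s 6 = D)
    (hpar : ∀ x : Fin n, s.arr 7 x = par x) (hT : IsTree H w v (n * n) D par)
    (h4 : s.reg 4 = n * n) (h20 : s.reg 20 = v) {x y : Fin n} (h21 : s.reg 21 = x)
    (h22 : s.reg 22 = y) :
    ValidSet H w (tryPair.denote s) ∧
      (∀ m, FoundLight m s → FoundLight m (tryPair.denote s)) ∧
      (D x < n * n → D y < n * n →
        (∃ U ⊆ ancestors par x ∪ ancestors par y, U.Nonempty ∧ Dense H U) →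
        FoundLight (D x + D y + w v) (tryPair.denote s)) := by
  have ex : (Expr.sub (.reg 4) (.cell 6 (.reg 21))).eval s ≠ 0 ↔ D x < n * n := by
    simp only [Expr.eval, h4, h21, ← hD, values]; omega
  have ey : (Expr.sub (.reg 4) (.cell 6 (.reg 22))).eval s ≠ 0 ↔ D y < n * n := by
    simp only [Expr.eval, h4, h22, ← hD, values]; omega
  simp only [tryPair, ForProgram.denote]
  split_ifs with c1 c2
  · set s₁ := clearSet.denote s with hs₁
    set s₂ := (markFrom 21).denote s₁ with hs₂
    set s₃ := (markFrom 22).denote s₂ with hs₃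
    set s₄ := peel.denote s₃ with hs₄
    have F₁ := frame_denote clearSet s
    have F₂ := frame_denote (markFrom 21) s₁
    have F₃ := frame_denote (markFrom 22) s₂
    have F₄ := frame_denote peel s₃
    have hG₁ : HasGraph s₁ H := hG.denote (by decide) (by decide) (by decide)
    have hG₂ : HasGraph s₂ H := hG₁.denote (by decide) (by decide) (by decide)
    have hG₃ : HasGraph s₃ H := hG₂.denote (by decide) (by decide) (by decide)
    have hG₄ : HasGraph s₄ H := hG₃.denote (by decide) (by decide) (by decide)
    have reg4 : ∀ r ∉ [10, 11, 12, 13], s₄.reg r = s.reg r := by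
      intro r hr
      simp only [List.mem_cons, not_or, List.not_mem_nil, not_false_eq_true, and_true] at hr
      rw [F₄.1 r (by simp [regs, peel, peelStep, countLoop]; tauto),
        F₃.1 r (by simp [regs, markFrom]; tauto), F₂.1 r (by simp [regs, markFrom]; tauto),
        F₁.1 r (by simp [regs, clearSet]; tauto)]
    have arr4 : ∀ a, a ≠ 5 → s₄.arr a = s.arr a := by
      intro a ha
      rw [F₄.2 a (by simp [arrs, peel, peelStep, countLoop, ha]),
        F₃.2 a (by simp [arrs, markFrom, ha]), F₂.2 a (by simp [arrs, markFrom, ha]),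
        F₁.2 a (by simp [arrs, clearSet, ha])]
    have e₁ : supp n s₁ 5 = ∅ := clearSet_spec hG.reg_zero
    have e₂ : supp n s₂ 5 = ancestors par x := by
      rw [hs₂, markFrom_spec (z := x) (par := par) hG₁.reg_zero
        ((F₁.1 21 (by decide)).trans h21) (by rw [F₁.2 7 (by decide)]; exact hpar), e₁,
        Finset.empty_union]
    have e₃ : supp n s₃ 5 = ancestors par x ∪ ancestors par y := by
      rw [hs₃, markFrom_spec (z := y) (par := par) hG₂.reg_zero
        (((F₂.1 22 (by decide)).trans (F₁.1 22 (by decide))).trans h22)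
        (by rw [F₂.2 7 (by decide), F₁.2 7 (by decide)]; exact hpar), e₂]
    have hcore := peel_spec hG₃
    rw [e₃, ← hs₄] at hcore
    have hm : s₄.arr 6 (s₄.reg 21) + s₄.arr 6 (s₄.reg 22) + s₄.arr 11 (s₄.reg 20) =
        D x + D y + w v := by
      rw [reg4 20 (by decide), reg4 21 (by decide), reg4 22 (by decide), arr4 6 (by decide),
        arr4 11 (by decide), h20, h21, h22, ← hD, ← hw11]; rfl
    have hV₄ : ValidSet H w s₄ := by
      unfold ValidSet
      rw [reg4 23 (by decide), reg4 24 (by decide), supp_congr (arr4 8 (by decide))]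
      exact hV
    obtain ⟨r1, r2, r3⟩ := commitIfBetter_spec hG₄ hV₄ hm hcore.dense
      ((Finset.sum_le_sum_of_subset hcore.subset).trans (hT.sum_le hw (ex.1 c1) (ey.1 c2)))
    refine ⟨r1, fun m h => r2 m ?_, fun _ _ ⟨U, hU, hne, hUd⟩ => r3 (hne.mono (hcore.max U hU hUd))⟩
    unfold FoundLight
    rw [reg4 23 (by decide), reg4 24 (by decide)]
    exact h
  · exact ⟨hV, fun _ => id, fun _ h => absurd (ey.2 h) c2⟩
  · exact ⟨hV, fun _ => id, fun h => absurd (ex.2 h) c1⟩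

theorem findTree_spec (hG : HasGraph s H) (hw11 : values n s 11 = w)
    (h4 : s.reg 4 = n * n) (h20 : s.reg 20 = v) (h7 : ∀ i : Fin n, s.arr 7 i < n) :
    ∃ par : Fin n → Fin n, (∀ x : Fin n, (findTree.denote s).arr 7 x = par x) ∧
      IsTree H w v (n * n) (values n (findTree.denote s) 6) par := by
  set s₁ := initDist.denote s with hs₁
  set s₂ := setCell s₁ 6 v 0 with hs₂
  set s₃ := relax.denote s₂ with hs₃
  have F₁ := frame_denote initDist s
  have F₃ := frame_denote relax s₂
  have F₄ := frame_denote parents s₃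
  have e : findTree.denote s = parents.denote s₃ := by
    have : (initDist.denote s).reg 20 = v := (F₁.1 20 (by decide)).trans h20
    simp only [findTree, ForProgram.denote, Expr.eval, this, hs₃, hs₂, hs₁]
  have hG₁ : HasGraph s₁ H := hG.denote (by decide) (by decide) (by decide)
  have hG₂ : HasGraph s₂ H := hG₁.congr (by simp [hs₂]) (by simp [hs₂]) (by simp [hs₂])
  have hG₃ : HasGraph s₃ H := hG₂.denote (by decide) (by decide) (by decide)
  have hw₂ : values n s₂ 11 = w := by
    rw [← hw11]
    have : s₂.arr 11 = s₁.arr 11 := by simp [hs₂]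
    exact values_congr (this.trans (F₁.2 11 (by decide)))
  have h6 : ∀ x, values n s₂ 6 x = if x = v then 0 else n * n := by
    intro x
    simp only [values, hs₂, arr_setCell, if_true, Function.update_apply, Fin.ext_iff]
    split_ifs
    · rfl
    · rw [initDist_spec hG.reg_zero, h4]
  obtain ⟨hD, hR⟩ := relax_spec (Z := {v}) hG₂ hw₂
    ⟨fun x hx => by rw [h6, if_pos (Finset.mem_singleton.1 hx)],
      fun x => by rw [h6]; split_ifs <;> omega, fun x hx h => by
        rw [h6, if_neg (fun h => hx (Finset.mem_singleton.2 h))] at h; omega⟩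
  rw [← hs₃] at hD hR
  have hw₃ : values n s₃ 11 = w := by rw [values_congr (F₃.2 11 (by decide)), hw₂]
  obtain ⟨par, p1, p2, p3⟩ := parents_spec (v := v) hG₃ hw₃
    (by rw [F₃.1 20 (by decide), hs₂, reg_setCell, F₁.1 20 (by decide), h20])
    (fun i => by
      rw [F₃.2 7 (by decide), hs₂, arr_setCell, if_neg (by decide), F₁.2 7 (by decide)]
      exact h7 i)
  rw [e, values_congr (F₄.2 6 (by decide))]
  have key : ∀ x, x ≠ v → values n s₃ 6 x < n * n →
      H.Adj (par x) x ∧ values n s₃ 6 (par x) + w x ≤ values n s₃ 6 x :=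
    fun x hx hxm => p3 x hx (hD.pred x (fun h => hx (Finset.mem_singleton.1 h)) hxm)
  exact ⟨par, p1, hD.zero v (Finset.mem_singleton_self v), p2, hR,
    fun x hx hxm => (key x hx hxm).1.symm, fun x hx hxm => (key x hx hxm).2⟩

theorem tryRoot_spec (hG : HasGraph s H) (hw : ∀ x, 0 < w x) (hwn : ∀ x, w x ≤ n)
    (hV : ValidSet H w s) (hw11 : values n s 11 = w)
    (h4 : s.reg 4 = n * n) (h20 : s.reg 20 = v) (h7 : ∀ i : Fin n, s.arr 7 i < n) :
    ValidSet H w (tryRoot.denote s) ∧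
      (∀ m, FoundLight m s → FoundLight m (tryRoot.denote s)) ∧
      (∀ C, MinDense H w C → v ∈ C → FoundLight (∑ x ∈ C, w x) (tryRoot.denote s)) ∧
      ∀ i : Fin n, (tryRoot.denote s).arr 7 i < n := by
  obtain ⟨par, hpar, hT⟩ := findTree_spec hG hw11 h4 h20 h7
  set s₁ := findTree.denote s with hs₁
  have F₁ := frame_denote findTree s
  have hG₁ : HasGraph s₁ H := hG.denote (by decide) (by decide) (by decide)
  set D := values n s₁ 6 with hD
  let A : Fin n → Fin n → Prop := fun x y => D x < n * n ∧ D y < n * n ∧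
    ∃ U ⊆ ancestors par x ∪ ancestors par y, U.Nonempty ∧ Dense H U
  have h := for_rule (i := 21) (P := .for_ 22 tryPair) (s := s₁)
    (fun k s' => ValidSet H w s' ∧ (∀ m, FoundLight m s → FoundLight m s') ∧
      ∀ x y : Fin n, (x : ℕ) < k → A x y → FoundLight (D x + D y + w v) s')
    (fun k s' a h => ⟨h.1.setReg (by decide) a, fun m hm => (h.2.1 m hm).setReg (by decide) a,
      fun x y hx hA => (h.2.2 x y hx hA).setReg (by decide) a⟩)
    ⟨by
      unfold ValidSet
      rw [F₁.1 23 (by decide), F₁.1 24 (by decide), supp_congr (F₁.2 8 (by decide))]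
      exact hV, fun m hm => by
      unfold FoundLight
      rw [F₁.1 23 (by decide), F₁.1 24 (by decide)]
      exact hm, fun _ _ h => absurd h (by omega)⟩ (by
      rintro k s' hk hF hi ⟨i1, i2, i3⟩
      rw [hG₁.reg_zero] at hk
      have hG' := hG₁.frame hF (by decide) (by decide) (by decide)
      have h := for_rule (i := 22) (P := tryPair) (s := s')
        (fun l s'' => ValidSet H w s'' ∧ (∀ m, FoundLight m s' → FoundLight m s'') ∧
          ∀ y : Fin n, (y : ℕ) < l → A ⟨k, hk⟩ y → FoundLight (D ⟨k, hk⟩ + D y + w v) s'')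
        (fun k s' a h => ⟨h.1.setReg (by decide) a,
          fun m hm => (h.2.1 m hm).setReg (by decide) a,
          fun y hy hA => (h.2.2 y hy hA).setReg (by decide) a⟩)
        ⟨i1, fun _ => id, fun _ h => absurd h (by omega)⟩ (by
          rintro l s'' hl hF' hi' ⟨j1, j2, j3⟩
          rw [hG'.reg_zero] at hl
          obtain ⟨r1, r2, r3⟩ := tryPair_spec (v := v) (D := D) (par := par) (x := ⟨k, hk⟩)
            (y := ⟨l, hl⟩) (hG'.frame hF' (by decide) (by decide) (by decide)) hw j1
            (by rw [values_congr (hF'.2 11 (by decide)), values_congr (hF.2 11 (by decide)),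
              values_congr (F₁.2 11 (by decide)), hw11])
            (by rw [values_congr (hF'.2 6 (by decide)), values_congr (hF.2 6 (by decide))])
            (by rw [hF'.2 7 (by decide), hF.2 7 (by decide)]; exact hpar) hT
            (by rw [hF'.1 4 (by decide), hF.1 4 (by decide), F₁.1 4 (by decide), h4])
            (by rw [hF'.1 20 (by decide), hF.1 20 (by decide), F₁.1 20 (by decide), h20])
            ((hF'.1 21 (by decide)).trans hi) hi'
          refine ⟨r1, fun m hm => r2 m (j2 m hm), fun y hy hA => ?_⟩
          rcases Nat.lt_succ_iff_lt_or_eq.1 hy with hlt | heq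
          · exact r2 _ (j3 y hlt hA)
          · obtain rfl : y = ⟨l, hl⟩ := Fin.ext heq
            exact r3 hA.1 hA.2.1 hA.2.2)
      rw [hG'.reg_zero] at h
      obtain ⟨r1, r2, r3⟩ := h
      refine ⟨r1, fun m hm => r2 m (i2 m hm), fun x y hx hA => ?_⟩
      rcases Nat.lt_succ_iff_lt_or_eq.1 hx with hlt | heq
      · exact r2 _ (i3 x y hlt hA)
      · obtain rfl : x = ⟨k, hk⟩ := Fin.ext heq
        exact r3 y y.2 hA)
  rw [hG₁.reg_zero] at h
  have e : tryRoot.denote s = (ForProgram.for_ 21 (.for_ 22 tryPair)).denote s₁ := rfl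
  rw [e]
  obtain ⟨r1, r2, r3⟩ := h
  refine ⟨r1, r2, fun C hC hv => ?_, fun i => ?_⟩
  -- At most `n` vertices of weight at most `n` each: this is why `n * n` can serve as infinity.
  · have hsum : ∑ x ∈ C, w x ≤ n * n := by
      refine (Finset.sum_le_card_nsmul _ _ n fun x _ => hwn x).trans ?_
      exact Nat.mul_le_mul_right _ (by simpa using Finset.card_le_univ C)
    obtain ⟨x, y, hx, hy, hxy, hU⟩ := hT.exists_dense hw hC hv hsum
    have := r3 x y x.2 ⟨hx, hy, hU⟩
    exact ⟨this.1, this.2.trans hxy⟩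
  · rw [arr_denote _ (by decide), hpar]
    exact (par i).2

/-- Find a lightest nonempty dense set. -/
def findLightest : ForProgram := .for_ 20 tryRoot

/-- The stored set is dense and weighs at most the stored bound. A minimum dense set contains some
vertex, and the search with that vertex as root pushes the bound down to the minimum weight, so the
stored set is itself minimum. -/
theorem findLightest_spec (hG : HasGraph s H) (hw : ∀ x, 0 < w x) (hwn : ∀ x, w x ≤ n)
    (hw11 : values n s 11 = w) (h4 : s.reg 4 = n * n) (h7 : ∀ i, s.arr 7 i = 0)
    (h23 : s.reg 23 = 0) :
    ((findLightest.denote s).reg 23 = 0 ∧ ∀ U, Dense H U → U = ∅) ∨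
      ((findLightest.denote s).reg 23 ≠ 0 ∧ MinDense H w (supp n (findLightest.denote s) 8)) := by
  have h := for_rule (i := 20) (P := tryRoot) (s := s)
    (fun k s' => ValidSet H w s' ∧
      (∀ C, ∀ v : Fin n, (v : ℕ) < k → MinDense H w C → v ∈ C → FoundLight (∑ x ∈ C, w x) s') ∧
      ∀ i : Fin n, s'.arr 7 i < n)
    (fun k s' a h => ⟨h.1.setReg (by decide) a,
      fun C v hv hC hvC => (h.2.1 C v hv hC hvC).setReg (by decide) a, h.2.2⟩)
    ⟨Or.inl h23, fun _ _ h => absurd h (by omega), fun i => by rw [h7]; have := i.2; omega⟩ (by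
      rintro k s' hk hF hi ⟨i1, i2, i3⟩
      rw [hG.reg_zero] at hk
      obtain ⟨r1, r2, r3, r4⟩ := tryRoot_spec (v := ⟨k, hk⟩)
        (hG.frame hF (by decide) (by decide) (by decide)) hw hwn i1
        (by rw [values_congr (hF.2 11 (by decide)), hw11]) ((hF.1 4 (by decide)).trans h4) hi i3
      refine ⟨r1, fun C v hvk hC hv => ?_, r4⟩
      rcases Nat.lt_succ_iff_lt_or_eq.1 hvk with hlt | heq
      · exact r2 _ (i2 C v hlt hC hv)
      · obtain rfl : v = ⟨k, hk⟩ := Fin.ext heq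
        exact r3 C hC hv)
  rw [hG.reg_zero] at h
  rw [← findLightest] at h
  obtain ⟨hV, hF, -⟩ := h
  by_cases h0 : (findLightest.denote s).reg 23 = 0
  · refine Or.inl ⟨h0, fun U hU => ?_⟩
    by_contra hne
    obtain ⟨C, hC⟩ := exists_minDense (w := w) (Finset.nonempty_iff_ne_empty.2 hne) hU
    obtain ⟨v, hv⟩ := hC.nonempty
    exact (hF C v v.2 hC hv).1 h0
  · obtain ⟨hne, hd, hsum⟩ := hV.resolve_left h0
    refine Or.inr ⟨h0, hne, hd, fun U hUne hU => ?_⟩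
    obtain ⟨C, hC⟩ := exists_minDense (w := w) hUne hU
    obtain ⟨v, hv⟩ := hC.nonempty
    exact hsum.trans ((hF C v v.2 hC hv).2.trans (hC.le U hUne hU))

end

/-! ### Preparing the input -/

/-- Put the positions of the rows of the adjacency matrix into array `3`. -/
def buildRows : ForProgram :=
  .seq (.assign 5 (.const 0))
    (.for_ 10 (.seq (.write 3 (.reg 10) (.reg 5)) (.assign 5 (.add (.reg 5) (.reg 0)))))

/-- Store the set of all vertices in array `5`. -/
def fullSet : ForProgram := .for_ 10 (.write 5 (.reg 10) (.const 1))

/-- Delete the edge between the vertices in registers `10` and `11`. -/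
def deleteEdge : ForProgram := .write 0 (.add (.cell 3 (.reg 10)) (.reg 11)) (.const 0)

/-- Delete the edges that are not inside the set in array `5`. -/
def prune : ForProgram :=
  .for_ 10 (.for_ 11 (.ite (.cell 5 (.reg 10)) (.ite (.cell 5 (.reg 11)) .skip deleteEdge)
    deleteEdge))

/-- Mark the branch vertices in array `4` and store the weights in array `11`. -/
def findBranch : ForProgram :=
  .for_ 10 (.seq (countLoop 12 13 (.const 1) (adjExpr 10 13))
    (.ite (.sub (.reg 12) (.const 2))
      (.seq (.write 4 (.reg 10) (.const 1)) (.write 11 (.reg 10) (.reg 0)))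
      (.seq (.write 4 (.reg 10) (.const 0)) (.write 11 (.reg 10) (.const 1)))))

/-- Save the parameters and replace the graph by its core. -/
def setup : ForProgram :=
  .seq (.assign 3 (.reg 1)) (.seq buildRows (.seq (.assign 4 (.reg 5)) (.seq fullSet
    (.seq peel (.seq prune findBranch)))))

section

variable {n : ℕ} {s : Memory}

/-- Repeated addition replaces the missing multiplication. The last value, `n * n`, is kept to
represent infinity. -/
theorem buildRows_spec (hn : s.reg 0 = n) : (buildRows.denote s).reg 5 = n * n ∧
    ∀ x < n, (buildRows.denote s).arr 3 x = x * n := by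
  have h := for_rule (i := 10) (P := .seq (.write 3 (.reg 10) (.reg 5))
    (.assign 5 (.add (.reg 5) (.reg 0)))) (s := setReg s 5 0)
    (fun k s' => s'.reg 5 = k * n ∧ ∀ x < k, s'.arr 3 x = x * n)
    (fun _ _ _ h => by simpa using h) (by simp) (by
      rintro k s' hk hF hi ⟨h1, h2⟩
      have h0 := hF.1 0 (by decide)
      rw [reg_setReg, if_neg (by decide), hn] at h0
      refine ⟨?_, fun x hx => ?_⟩
      · simp [ForProgram.denote, Expr.eval, h1, h0]; ring
      · simp only [ForProgram.denote, arr_setReg, arr_setCell, if_true, Expr.eval, hi, h1,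
          Function.update_apply]
        split_ifs with hxk
        · rw [hxk]
        · exact h2 x (by omega))
  rw [reg_setReg, if_neg (by decide), hn] at h
  exact h

theorem fullSet_spec (hn : s.reg 0 = n) : supp n (fullSet.denote s) 5 = Finset.univ := by
  have h := for_rule (i := 10) (P := .write 5 (.reg 10) (.const 1)) (s := s)
    (fun k s' => ∀ x < k, s'.arr 5 x = 1) (fun _ _ _ h => h)
    (fun _ h => absurd h (by omega)) (by
      intro k s' hk hF hi h x hx
      simp only [ForProgram.denote, arr_setCell, if_true, Expr.eval, hi, Function.update_apply]
      split_ifs with hxk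
      · rfl
      · exact h x (by omega))
  ext x
  rw [mem_supp, fullSet, h x (by rw [hn]; exact x.2)]
  simp

theorem index_inj {i i' : ℕ} {j j' : ℕ} (hj : j < n) (hj' : j' < n)
    (h : i * n + j = i' * n + j') : i = i' ∧ j = j' := by
  have h1 : (i * n + j) % n = (i' * n + j') % n := by rw [h]
  rw [mul_comm i, mul_comm i', Nat.mul_add_mod, Nat.mul_add_mod, Nat.mod_eq_of_lt hj,
    Nat.mod_eq_of_lt hj'] at h1
  refine ⟨?_, h1⟩
  subst h1
  exact Nat.eq_of_mul_eq_mul_right (by omega) (Nat.add_right_cancel h)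

theorem prune_spec {G : SimpleGraph (Fin n)} (hG : HasGraph s G)
    (h3 : ∀ x < n, s.arr 3 x = x * n) : HasGraph (prune.denote s) (restrict G (supp n s 5)) := by
  set K := supp n s 5 with hK
  have h := for_rule (i := 10) (P := .for_ 11 (.ite (.cell 5 (.reg 10))
      (.ite (.cell 5 (.reg 11)) .skip deleteEdge) deleteEdge)) (s := s)
    (fun k s' => ∀ x y : Fin n, s'.arr 0 (x * n + y) ≠ 0 ↔
      G.Adj x y ∧ ((x : ℕ) < k → x ∈ K ∧ y ∈ K)) (fun _ _ _ h => h)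
    (fun x y => by simpa [h3 x x.2] using hG.adj x y) (by
      intro k s' hk hF hi hI
      rw [hG.reg_zero] at hk
      have hn' : s'.reg 0 = n := (hF.1 0 (by decide)).trans hG.reg_zero
      have h := for_rule (i := 11) (P := .ite (.cell 5 (.reg 10))
        (.ite (.cell 5 (.reg 11)) .skip deleteEdge) deleteEdge) (s := s')
        (fun l s'' => ∀ x y : Fin n, s''.arr 0 (x * n + y) ≠ 0 ↔
          G.Adj x y ∧ ((x : ℕ) < k ∨ (x : ℕ) = k ∧ (y : ℕ) < l → x ∈ K ∧ y ∈ K))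
        (fun _ _ _ h => h) (fun x y => by simpa using hI x y) (by
          intro l s'' hl hF' hi' hI'
          rw [hn'] at hl
          have hk' : s''.reg 10 = k := (hF'.1 10 (by decide)).trans hi
          have h5 : s''.arr 5 = s.arr 5 := (hF'.2 5 (by decide)).trans (hF.2 5 (by decide))
          have hr : s''.arr 3 k = k * n := by
            rw [hF'.2 3 (by decide), hF.2 3 (by decide), h3 k hk]
          have ek : (Expr.cell 5 (.reg 10)).eval s'' ≠ 0 ↔ (⟨k, hk⟩ : Fin n) ∈ K := by
            simp only [Expr.eval, hk', h5, hK, mem_supp]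
          have el : (Expr.cell 5 (.reg 11)).eval s'' ≠ 0 ↔ (⟨l, hl⟩ : Fin n) ∈ K := by
            simp only [Expr.eval, hi', h5, hK, mem_supp]
          have hdel : ¬ ((⟨k, hk⟩ : Fin n) ∈ K ∧ (⟨l, hl⟩ : Fin n) ∈ K) → ∀ x y : Fin n,
              (deleteEdge.denote s'').arr 0 (x * n + y) ≠ 0 ↔ G.Adj x y ∧
                ((x : ℕ) < k ∨ (x : ℕ) = k ∧ (y : ℕ) < l + 1 → x ∈ K ∧ y ∈ K) := by
            intro hno x y
            simp only [deleteEdge, ForProgram.denote, arr_setCell, if_true, Expr.eval, hk', hi', hr,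
              Function.update_apply]
            split_ifs with heq
            · obtain ⟨e1, e2⟩ := index_inj y.2 hl heq
              refine iff_of_false (by simp) fun h => hno ?_
              have := h.2 (Or.inr ⟨e1, by omega⟩)
              rwa [show x = ⟨k, hk⟩ from Fin.ext e1, show y = ⟨l, hl⟩ from Fin.ext e2] at this
            · rw [hI' x y]
              refine and_congr_right fun _ => imp_congr_left (or_congr_right ?_)
              refine and_congr_right fun hx => ⟨fun h => by omega, fun h => ?_⟩
              refine lt_of_le_of_ne (by omega) fun hy => heq (by rw [hx, hy])
          simp only [ForProgram.denote]
          split_ifs with c1 c2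
          · intro x y
            rw [hI' x y]
            refine and_congr_right fun _ => ⟨fun h hxy => ?_, fun h hxy => h ?_⟩
            · rcases hxy with hx | ⟨hx, hy⟩
              · exact h (Or.inl hx)
              · rcases Nat.lt_succ_iff_lt_or_eq.1 hy with hlt | heq
                · exact h (Or.inr ⟨hx, hlt⟩)
                · rw [show x = ⟨k, hk⟩ from Fin.ext hx, show y = ⟨l, hl⟩ from Fin.ext heq]
                  exact ⟨ek.1 c1, el.1 c2⟩
            · exact hxy.imp id fun h => ⟨h.1, by omega⟩
          · exact hdel fun h => c2 (el.2 h.2)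
          · exact hdel fun h => c1 (ek.2 h.1))
      rw [hn'] at h
      intro x y
      rw [h x y]
      refine and_congr_right fun _ => imp_congr_left ?_
      have := y.2
      constructor
      · rintro (h | h) <;> omega
      · intro h; rcases Nat.lt_succ_iff_lt_or_eq.1 h with h | h
        · exact Or.inl h
        · exact Or.inr ⟨h, y.2⟩)
  rw [hG.reg_zero, ← prune] at h
  have F := frame_denote prune s
  refine ⟨(F.1 0 (by decide)).trans hG.reg_zero, fun x y => ?_⟩
  rw [F.2 3 (by decide), h3 x x.2, h x y]
  exact and_congr_right fun _ => ⟨fun h => h x.2, fun h _ => h⟩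

open scoped Classical in
theorem branch_iff_two_lt {H : SimpleGraph (Fin n)} {x : Fin n} :
    Branch H x ↔ 2 < (Finset.univ.filter (H.Adj x)).card := by
  rw [Finset.two_lt_card]
  simp only [Branch, Finset.mem_filter, Finset.mem_univ, true_and]
  constructor
  · rintro ⟨a, b, c, hab, hac, hbc, ha, hb, hc⟩; exact ⟨a, ha, b, hb, c, hc, hab, hac, hbc⟩
  · rintro ⟨a, ha, b, hb, c, hc, hab, hac, hbc⟩; exact ⟨a, b, c, hab, hac, hbc, ha, hb, hc⟩

open scoped Classical in
theorem findBranch_spec {H : SimpleGraph (Fin n)} (hG : HasGraph s H) :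
    (∀ x : Fin n, (findBranch.denote s).arr 4 x ≠ 0 ↔ Branch H x) ∧
      values n (findBranch.denote s) 11 = fun x => if Branch H x then n else 1 := by
  have h := for_rule (i := 10) (P := .seq (countLoop 12 13 (.const 1) (adjExpr 10 13))
    (.ite (.sub (.reg 12) (.const 2))
      (.seq (.write 4 (.reg 10) (.const 1)) (.write 11 (.reg 10) (.reg 0)))
      (.seq (.write 4 (.reg 10) (.const 0)) (.write 11 (.reg 10) (.const 1))))) (s := s)
    (fun k s' => ∀ x : Fin n, (x : ℕ) < k → (s'.arr 4 x ≠ 0 ↔ Branch H x) ∧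
      s'.arr 11 x = if Branch H x then n else 1) (fun _ _ _ h => h)
    (fun _ h => absurd h (by omega)) (by
      intro k s' hk hF hi hI x hx
      rw [hG.reg_zero] at hk
      have hG' := hG.frame hF (by decide) (by decide) (by decide)
      have hc := countLoop_spec (c := 12) (i := 13) (e := .const 1) (e' := adjExpr 10 13)
        (by decide) (by decide) hG'.reg_zero (Finset.univ.filter (H.Adj ⟨k, hk⟩)) (by
          intro l s'' hF' hl
          rw [(hG'.frame hF' (by decide) (by decide) (by decide)).adjExpr_eval (x := ⟨k, hk⟩)
            ((hF'.1 10 (by decide)).trans hi) hl]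
          simp [Expr.eval])
      have hF' := frame_denote (countLoop 12 13 (.const 1) (adjExpr 10 13)) s'
      set s₁ := (countLoop 12 13 (.const 1) (adjExpr 10 13)).denote s' with hs₁
      have hk₁ : s₁.reg 10 = k := (hF'.1 10 (by decide)).trans hi
      have h0 : s₁.reg 0 = n := (hF'.1 0 (by decide)).trans hG'.reg_zero
      have hbr : (Expr.sub (.reg 12) (.const 2)).eval s₁ ≠ 0 ↔ Branch H ⟨k, hk⟩ := by
        rw [branch_iff_two_lt, ← hc]
        simp only [Expr.eval]; omega
      have hold : (x : ℕ) ≠ k → (s₁.arr 4 x ≠ 0 ↔ Branch H x) ∧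
          s₁.arr 11 x = if Branch H x then n else 1 := by
        intro hxk
        rw [hF'.2 4 (by decide), hF'.2 11 (by decide)]
        exact hI x (by omega)
      rw [ForProgram.denote, ← hs₁, ForProgram.denote]
      by_cases hxk : (x : ℕ) = k
      · obtain rfl : x = ⟨k, hk⟩ := Fin.ext hxk
        split_ifs with c1 c2 c2
        · simp [ForProgram.denote, Expr.eval, hk₁, h0, c2]
        · exact absurd (hbr.1 c1) c2
        · exact absurd (hbr.2 c2) c1
        · simp [ForProgram.denote, Expr.eval, hk₁, c2]
      · by_cases c1 : (Expr.sub (.reg 12) (.const 2)).eval s₁ ≠ 0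
        · rw [if_pos c1]
          simpa [ForProgram.denote, Expr.eval, hk₁, Function.update_apply, hxk] using hold hxk
        · rw [if_neg c1]
          simpa [ForProgram.denote, Expr.eval, hk₁, Function.update_apply, hxk] using hold hxk)
  rw [hG.reg_zero, ← findBranch] at h
  exact ⟨fun x => (h x x.2).1, funext fun x => (h x x.2).2⟩

open scoped Classical in
theorem setup_spec (G : SimpleGraph (Fin n)) [DecidableRel G.Adj] (d : ℕ) :
    ∃ K, IsCore G Finset.univ K ∧ HasGraph (setup.denote (inputMemory G d)) (restrict G K) ∧
      (setup.denote (inputMemory G d)).reg 3 = d ∧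
      (setup.denote (inputMemory G d)).reg 4 = n * n ∧
      (∀ x : Fin n, (setup.denote (inputMemory G d)).arr 4 x ≠ 0 ↔ Branch (restrict G K) x) ∧
      values n (setup.denote (inputMemory G d)) 11 =
        fun x => if Branch (restrict G K) x then n else 1 := by
  -- The parameter `d` moves to register `3`, because register `1` will hold the length of the list
  -- in array `1`.
  set s₁ := setReg (inputMemory G d) 3 d with hs₁
  set s₂ := buildRows.denote s₁ with hs₂
  set s₃ := setReg s₂ 4 (n * n) with hs₃
  set s₄ := fullSet.denote s₃ with hs₄
  set s₅ := peel.denote s₄ with hs₅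
  set s₆ := prune.denote s₅ with hs₆
  have hn₁ : s₁.reg 0 = n := rfl
  obtain ⟨b1, b2⟩ := buildRows_spec hn₁
  rw [← hs₂] at b1 b2
  have e : setup.denote (inputMemory G d) = findBranch.denote s₆ := by
    have : setReg (inputMemory G d) 3 ((inputMemory G d).reg 1) = s₁ := rfl
    simp only [setup, ForProgram.denote, Expr.eval, this, ← hs₂, b1, hs₆, hs₅, hs₄, hs₃]
  have F₂ := frame_denote buildRows s₁
  have F₄ := frame_denote fullSet s₃
  have F₅ := frame_denote peel s₄
  have F₆ := frame_denote prune s₅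
  have F₇ := frame_denote findBranch s₆
  have hG₂ : HasGraph s₂ G := by
    refine ⟨(F₂.1 0 (by decide)).trans hn₁, fun u v => ?_⟩
    rw [b2 u u.2, F₂.2 0 (by decide)]
    have : s₁.arr 0 (u * n + v) = if ∃ i j : Fin n, (u : ℕ) * n + v = (i : ℕ) * n + j ∧ G.Adj i j
      then 1 else 0 := by
      simp [hs₁, inputMemory]
    rw [this]
    constructor
    · intro h
      split_ifs at h with hex
      · obtain ⟨i, j, hij, hadj⟩ := hex
        obtain ⟨e1, e2⟩ := index_inj v.2 j.2 hij
        rwa [Fin.ext e1, Fin.ext e2]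
      · exact absurd rfl h
    · intro h
      rw [if_pos ⟨u, v, rfl, h⟩]; decide
  have hG₃ : HasGraph s₃ G := hG₂.setReg (by decide) _
  have hG₄ : HasGraph s₄ G := hG₃.denote (by decide) (by decide) (by decide)
  have hG₅ : HasGraph s₅ G := hG₄.denote (by decide) (by decide) (by decide)
  have hK := peel_spec hG₄
  rw [← hs₅, hs₄, fullSet_spec hG₃.reg_zero] at hK
  have h3 : ∀ x < n, s₅.arr 3 x = x * n := by
    rw [F₅.2 3 (by decide), F₄.2 3 (by decide)]; exact b2
  have hG₆ := prune_spec hG₅ h3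
  rw [← hs₆] at hG₆
  obtain ⟨f1, f2⟩ := findBranch_spec hG₆
  refine ⟨_, hK, ?_, ?_, ?_, ?_, ?_⟩
  · rw [e]; exact hG₆.denote (by decide) (by decide) (by decide)
  · rw [e, F₇.1 3 (by decide), F₆.1 3 (by decide), F₅.1 3 (by decide), F₄.1 3 (by decide), hs₃,
      reg_setReg, if_neg (by decide), F₂.1 3 (by decide)]
    rfl
  · rw [e, F₇.1 4 (by decide), F₆.1 4 (by decide), F₅.1 4 (by decide), F₄.1 4 (by decide), hs₃,
      reg_setReg, if_pos rfl]
  · rw [e]; exact f1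
  · rw [e]; exact f2

end

/-! ### Balls around a listed set -/

/-- Set the distance of those listed vertices to `0` for which the test `e` succeeds. -/
def markSources (e : Expr) : ForProgram :=
  .for_ 10 (.ite (.sub (.reg 1) (.reg 10)) (.ite e (.write 6 (.cell 1 (.reg 10)) (.const 0)) .skip)
    .skip)

/-- Compute the distances from the listed vertices for which the test `e` succeeds. -/
def ballDist (e : Expr) : ForProgram := .seq initDist (.seq (markSources e) relax)

/-- Run `P` if the vertex in register `10` has a finite distance of at most `d`. -/
def ifNear (P : ForProgram) : ForProgram :=
  .ite (.sub (.reg 4) (.cell 6 (.reg 10)))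
    (.ite (.sub (.add (.reg 3) (.const 1)) (.cell 6 (.reg 10))) P .skip) .skip

/-- Put the complement of the ball into array `5`. -/
def complBall : ForProgram :=
  .for_ 10 (.seq (.write 5 (.reg 10) (.const 1)) (ifNear (.write 5 (.reg 10) (.const 0))))

/-- Append the vertex in register `10` to the list in array `1`. -/
def appendVertex : ForProgram :=
  .seq (.write 1 (.reg 1) (.reg 10)) (.assign 1 (.add (.reg 1) (.const 1)))

/-- Output the vertices of the ball. -/
def listBall : ForProgram := .seq (.assign 1 (.const 0)) (.for_ 10 (ifNear appendVertex))

/-- Give weight `1` to all vertices. -/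
def unitWeights : ForProgram := .for_ 10 (.write 11 (.reg 10) (.const 1))

/-- Copy array `8` to array `5`. -/
def loadSet : ForProgram := .for_ 10 (.write 5 (.reg 10) (.cell 8 (.reg 10)))

/-- Put the first cycle into array `1`. -/
def firstCycle : ForProgram := .seq loadSet (.seq findMember (findCycle 1))

/-- Put the largest dense set far from the first cycle into array `5`. -/
def shrink : ForProgram :=
  .seq unitWeights (.seq (ballDist (.const 1)) (.seq complBall (.seq peel findMember)))

/-- Output the ball around the branch vertices of the first cycle, and one more vertex of it. -/
def outputBall : ForProgram :=
  .seq (ballDist (.cell 4 (.cell 1 (.reg 10))))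
    (.seq (.write 6 (.cell 1 (.const 0)) (.const 0)) (.seq listBall (.assign 6 (.const 0))))

/-- Output a packing or a set of vertices, if there is a dense set. -/
def output : ForProgram :=
  .seq firstCycle (.seq shrink (.ite (.reg 14) (.seq (findCycle 2) (.assign 6 (.const 1)))
    outputBall))

/-- The whole algorithm, with the kind of the output in register `6`. -/
def mainProgram : ForProgram :=
  .seq setup (.seq findLightest (.ite (.reg 23) output
    (.seq (.assign 1 (.const 0)) (.assign 6 (.const 0)))))

/-- Array `1` lists exactly the elements of `C`, each of them among the first `n` entries. -/
def Lists {n : ℕ} (s : Memory) (C : Finset (Fin n)) : Prop :=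
  (∀ x ∈ C, ∃ i < n, i < s.reg 1 ∧ s.arr 1 i = x) ∧ ∀ i < s.reg 1, ∃ x ∈ C, s.arr 1 i = x

/-- The vertex `x` has a finite distance of at most `d` in array `6`. -/
def IsNear {n : ℕ} (s : Memory) (d : ℕ) (x : Fin n) : Prop :=
  values n s 6 x < n * n ∧ values n s 6 x ≤ d

section

variable {n d : ℕ} {H : SimpleGraph (Fin n)} {s : Memory} {C : Finset (Fin n)}

theorem list_congr {s' : Memory} {a : ℕ} (h : s'.reg a = s.reg a) (h' : s'.arr a = s.arr a) :
    s'.list a = s.list a := by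
  rw [Memory.list, Memory.list, h, h']

theorem list_setReg {x v a : ℕ} (h : a ≠ x) : (setReg s x v).list a = s.list a :=
  list_congr (by simp [h]) rfl

theorem Lists.congr (h : Lists s C) {s' : Memory} (h0 : s'.reg 1 = s.reg 1)
    (h1 : s'.arr 1 = s.arr 1) : Lists s' C := by
  rw [Lists, h0, h1]; exact h

/-- The list may have `n + 1` entries, but the last repeats the first. So a loop with `n` rounds
sees all vertices of the cycle. -/
theorem lists_of_isCycle {u : Fin n} {p : H.Walk u u} (hp : p.IsCycle)
    (h : p.support.map (fun v : Fin n => (v : ℕ)) = s.list 1) : Lists s p.support.toFinset := by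
  have hlen : s.reg 1 = p.length + 1 := by
    have := congrArg List.length h
    simpa [Memory.list] using this.symm
  have hle : p.length ≤ n := by
    have := hp.support_nodup.length_le_card
    simpa using this
  have hget : ∀ i ≤ p.length, s.arr 1 i = p.getVert i := by
    intro i hi
    have := congrArg (fun l : List ℕ => l[i]?) h
    simp only [List.getElem?_map, ← p.getVert_eq_support_getElem? hi, Memory.list, hlen,
      List.getElem?_range (show i < p.length + 1 by omega), Option.map_some] at this
    exact (Option.some.inj this).symm
  have hpos := hp.three_le_length
  refine ⟨fun x hx => ?_, fun i hi => ⟨p.getVert i, ?_, hget i (by omega)⟩⟩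
  · obtain ⟨i, rfl, hi⟩ := SimpleGraph.Walk.mem_support_iff_exists_getVert.1 (List.mem_toFinset.1 hx)
    rcases hi.lt_or_eq with hlt | heq
    · exact ⟨i, by omega, by omega, hget i hi⟩
    · refine ⟨0, by omega, by omega, ?_⟩
      rw [hget 0 (by omega), heq, p.getVert_zero, p.getVert_length]
  · rw [List.mem_toFinset]; exact p.getVert_mem_support i

theorem markSources_spec {e : Expr} (hn : s.reg 0 = n) (hL : Lists s C) (T : Fin n → Prop)
    [DecidablePred T]
    (he : ∀ s' x, Frame (markSources e) s s' → s.arr 1 (s'.reg 10) = (x : Fin n) →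
      (e.eval s' ≠ 0 ↔ T x)) (x : Fin n) :
    ((markSources e).denote s).arr 6 x = if x ∈ C.filter T then 0 else s.arr 6 x := by
  classical
  have h := for_rule (i := 10) (P := .ite (.sub (.reg 1) (.reg 10))
      (.ite e (.write 6 (.cell 1 (.reg 10)) (.const 0)) .skip) .skip) (s := s)
    (fun k s' => s'.arr 6 x = if (∃ i < k, i < s.reg 1 ∧ s.arr 1 i = x) ∧ T x then 0
      else s.arr 6 x) (fun _ _ _ h => h) (by simp) (by
      intro k s' hk hF hi hI
      have h1 : s'.reg 1 = s.reg 1 := hF.1 1 (by simp [regs])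
      have ha1 : s'.arr 1 = s.arr 1 := hF.2 1 (by simp [arrs])
      by_cases hk1 : k < s.reg 1
      · obtain ⟨y, hy, hky⟩ := hL.2 k hk1
        have hT := he s' y hF (by rw [hi, hky])
        have hex : (∃ i < k + 1, i < s.reg 1 ∧ s.arr 1 i = x) ↔
            (∃ i < k, i < s.reg 1 ∧ s.arr 1 i = x) ∨ y = x := by
          constructor
          · rintro ⟨i, hi, hi', hix⟩
            rcases Nat.lt_succ_iff_lt_or_eq.1 hi with hlt | rfl
            · exact Or.inl ⟨i, hlt, hi', hix⟩
            · exact Or.inr (Fin.ext (hky.symm.trans hix))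
          · rintro (⟨i, hi, h⟩ | rfl)
            · exact ⟨i, by omega, h⟩
            · exact ⟨k, by omega, hk1, hky⟩
        have c1 : (Expr.sub (.reg 1) (.reg 10)).eval s' ≠ 0 := by
          simp only [Expr.eval, h1, hi]; omega
        simp only [ForProgram.denote, if_pos c1, hex]
        by_cases hTy : T y
        · rw [if_pos (hT.2 hTy)]
          simp only [arr_setCell, if_true, Expr.eval, hi, ha1, hky, Function.update_apply, hI]
          by_cases hyx : y = x
          · subst hyx; simp [hTy]
          · have : ¬ (x : ℕ) = y := fun h => hyx (Fin.ext h).symm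
            simp [this, hyx]
        · rw [if_neg (fun h => hTy (hT.1 h)), hI]
          by_cases hyx : y = x
          · subst hyx; simp [hTy]
          · simp [hyx]
      · have c1 : ¬ (Expr.sub (.reg 1) (.reg 10)).eval s' ≠ 0 := by
          simp only [Expr.eval, h1, hi]; omega
        have hex : (∃ i < k + 1, i < s.reg 1 ∧ s.arr 1 i = x) ↔
            (∃ i < k, i < s.reg 1 ∧ s.arr 1 i = x) :=
          ⟨fun ⟨i, _, h⟩ => ⟨i, by omega, h⟩, fun ⟨i, _, h⟩ => ⟨i, by omega, h⟩⟩
        simp only [ForProgram.denote, if_neg c1, hex, hI])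
  rw [hn, ← markSources] at h
  rw [h]
  simp only [Finset.mem_filter]
  refine if_congr (and_congr_left fun _ => ⟨fun ⟨i, _, hi, hix⟩ => ?_, fun hx => hL.1 x hx⟩) rfl rfl
  obtain ⟨y, hy, hiy⟩ := hL.2 i hi
  rwa [← Fin.ext (hiy.symm.trans hix)]

theorem ballDist_spec {e : Expr} (hG : HasGraph s H) (h4 : s.reg 4 = n * n)
    (h11 : values n s 11 = fun _ => 1) (hL : Lists s C) (T : Fin n → Prop) [DecidablePred T]
    (he : ∀ s' x, Frame (.seq initDist (markSources e)) s s' → s.arr 1 (s'.reg 10) = (x : Fin n) →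
      (e.eval s' ≠ 0 ↔ T x)) :
    IsPreDist H (fun _ => 1) (C.filter T) (n * n) (values n ((ballDist e).denote s) 6) ∧
      Relaxed H (fun _ => 1) (values n ((ballDist e).denote s) 6) := by
  have F := frame_denote initDist s
  have hG₁ : HasGraph (initDist.denote s) H := hG.denote (by decide) (by decide) (by decide)
  have hm := markSources_spec (e := e) hG₁.reg_zero
    (hL.congr (F.1 1 (by decide)) (F.2 1 (by decide))) T (by
      intro s' x hF hx
      refine he s' x ⟨fun r hr => ?_, fun a ha => ?_⟩ (by rwa [F.2 1 (by decide)] at hx)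
      · simp only [regs, List.mem_append, not_or] at hr
        rw [hF.1 r hr.2, F.1 r hr.1]
      · simp only [arrs, List.mem_append, not_or] at ha
        rw [hF.2 a ha.2, F.2 a ha.1])
  have F' := frame_denote (markSources e) (initDist.denote s)
  have hG₂ : HasGraph ((markSources e).denote (initDist.denote s)) H :=
    hG₁.congr (F'.1 0 (by simp [markSources, regs])) (F'.2 0 (by simp [markSources, arrs]))
      (F'.2 3 (by simp [markSources, arrs]))
  refine relax_spec hG₂ ?_ ?_
  · rw [values_congr (F'.2 11 (by simp [markSources, arrs])), values_congr (F.2 11 (by decide)), h11]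
  · have hv : ∀ x, values n ((markSources e).denote (initDist.denote s)) 6 x =
        if x ∈ C.filter T then 0 else n * n := fun x => by
      rw [values, hm x, initDist_spec hG.reg_zero, h4]
    refine ⟨fun x hx => by rw [hv, if_pos hx], fun x => ?_, fun x hx hlt => ?_⟩
    · rw [hv]; split_ifs <;> simp
    · rw [hv, if_neg hx] at hlt; exact absurd hlt (lt_irrefl _)

theorem ifNear_denote (P : ForProgram) (h3 : s.reg 3 = d) (h4 : s.reg 4 = n * n) {x : Fin n}
    (hx : s.reg 10 = x) [Decidable (IsNear s d x)] :
    (ifNear P).denote s = if IsNear s d x then P.denote s else s := by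
  have h : IsNear s d x ↔ n * n - s.arr 6 x ≠ 0 ∧ d + 1 - s.arr 6 x ≠ 0 := by
    simp only [IsNear, values]; omega
  simp only [ifNear, ForProgram.denote, Expr.eval, h3, h4, hx]
  by_cases h1 : n * n - s.arr 6 x ≠ 0
  · by_cases h2 : d + 1 - s.arr 6 x ≠ 0
    · rw [if_pos h1, if_pos h2, if_pos (h.2 ⟨h1, h2⟩)]
    · rw [if_pos h1, if_neg h2, if_neg fun h' => h2 (h.1 h').2]
  · rw [if_neg h1, if_neg fun h' => h1 (h.1 h').1]

theorem complBall_spec (hn : s.reg 0 = n) (h3 : s.reg 3 = d) (h4 : s.reg 4 = n * n) (x : Fin n) :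
    x ∈ supp n (complBall.denote s) 5 ↔ ¬ IsNear s d x := by
  classical
  have h := for_rule (i := 10) (P := .seq (.write 5 (.reg 10) (.const 1))
      (ifNear (.write 5 (.reg 10) (.const 0)))) (s := s)
    (fun k s' => (x : ℕ) < k → (s'.arr 5 x ≠ 0 ↔ ¬ IsNear s d x)) (fun _ _ _ h => h)
    (fun h => absurd h (by omega)) (by
      intro k s' hk hF hi hI hx
      rw [hn] at hk
      have hnear : IsNear (setCell s' 5 k 1) d (⟨k, hk⟩ : Fin n) ↔ IsNear s d (⟨k, hk⟩ : Fin n) := by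
        simp only [IsNear, values, arr_setCell, hF.2 6 (by decide)]; simp
      have e : (ForProgram.write 5 (.reg 10) (.const 1)).denote s' = setCell s' 5 k 1 := by
        simp [ForProgram.denote, Expr.eval, hi]
      rw [ForProgram.denote, e, ifNear_denote (s := setCell s' 5 k 1) (d := d) (x := ⟨k, hk⟩) _
        ((hF.1 3 (by decide)).trans h3) ((hF.1 4 (by decide)).trans h4) hi]
      simp only [hnear]
      by_cases hxk : (x : ℕ) = k
      · obtain rfl : x = ⟨k, hk⟩ := Fin.ext hxk
        split_ifs with c
        · simp [ForProgram.denote, Expr.eval, hi, c]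
        · simp [c]
      · have := hI (by omega)
        split_ifs with c
        · simpa [ForProgram.denote, Expr.eval, hi, Function.update_apply, hxk] using this
        · simpa [Function.update_apply, hxk] using this)
  rw [hn, ← complBall] at h
  rw [mem_supp]
  exact h x.2

theorem list_append (x : ℕ) : (setReg (setCell s 1 (s.reg 1) x) 1 (s.reg 1 + 1)).list 1 =
    s.list 1 ++ [x] := by
  simp only [Memory.list, reg_setReg, if_true, arr_setReg, arr_setCell, List.range_succ,
    List.map_append, List.map_cons, List.map_nil, Function.update_self]
  congr 1
  refine List.map_congr_left fun i hi => Function.update_of_ne ?_ _ _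
  have := List.mem_range.1 hi
  omega

theorem listBall_spec (hn : s.reg 0 = n) (h3 : s.reg 3 = d) (h4 : s.reg 4 = n * n) :
    ∃ l : List (Fin n), l.Nodup ∧ (∀ x, x ∈ l ↔ IsNear s d x) ∧
      l.map (fun v : Fin n => (v : ℕ)) = (listBall.denote s).list 1 := by
  classical
  have h := for_rule (i := 10) (P := ifNear appendVertex) (s := setReg s 1 0)
    (fun k s' => ∃ l : List (Fin n), l.Nodup ∧ (∀ x, x ∈ l ↔ (x : ℕ) < k ∧ IsNear s d x) ∧
      l.map (fun v : Fin n => (v : ℕ)) = s'.list 1) (fun k s' x h => by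
        rwa [list_congr (s := s') (by simp) (by simp)])
    ⟨[], by simp, by simp, by simp [Memory.list]⟩ (by
      rintro k s' hk hF hi ⟨l, l1, l2, l3⟩
      rw [reg_setReg, if_neg (by decide), hn] at hk
      have hnear : IsNear s' d (⟨k, hk⟩ : Fin n) ↔ IsNear s d (⟨k, hk⟩ : Fin n) := by
        simp only [IsNear, values, hF.2 6 (by decide), arr_setReg]
      rw [ifNear_denote (d := d) (x := ⟨k, hk⟩) _
        ((hF.1 3 (by decide)).trans (by simpa using h3))
        ((hF.1 4 (by decide)).trans (by simpa using h4)) hi]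
      simp only [hnear]
      split_ifs with c
      · refine ⟨l ++ [⟨k, hk⟩], ?_, fun x => ?_, ?_⟩
        · rw [List.nodup_append]
          refine ⟨l1, by simp, fun a ha b hb => ?_⟩
          rw [List.mem_singleton] at hb
          rintro rfl
          have := ((l2 _).1 ha).1
          rw [hb] at this
          exact absurd this (lt_irrefl _)
        · rw [List.mem_append, l2, List.mem_singleton, Fin.ext_iff]
          constructor
          · rintro (h | h)
            · exact ⟨by omega, h.2⟩
            · obtain rfl : x = ⟨k, hk⟩ := Fin.ext h
              exact ⟨Nat.lt_succ_self _, c⟩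
          · rintro ⟨h, h'⟩
            rcases Nat.lt_succ_iff_lt_or_eq.1 h with h | h
            · exact Or.inl ⟨h, h'⟩
            · exact Or.inr h
        · have : appendVertex.denote s' = setReg (setCell s' 1 (s'.reg 1) k) 1 (s'.reg 1 + 1) := by
            simp [appendVertex, ForProgram.denote, Expr.eval, hi]
          rw [this, list_append, List.map_append, l3]
          simp
      · refine ⟨l, l1, fun x => ?_, l3⟩
        rw [l2]
        constructor
        · rintro ⟨h, h'⟩; exact ⟨by omega, h'⟩
        · rintro ⟨h, h'⟩
          rcases Nat.lt_succ_iff_lt_or_eq.1 h with h | h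
          · exact ⟨h, h'⟩
          · obtain rfl : x = ⟨k, hk⟩ := Fin.ext h
            exact absurd h' c)
  rw [reg_setReg, if_neg (by decide), hn] at h
  obtain ⟨l, l1, l2, l3⟩ := h
  exact ⟨l, l1, fun x => by rw [l2]; simp, l3⟩

theorem unitWeights_spec (hn : s.reg 0 = n) :
    values n (unitWeights.denote s) 11 = fun _ => 1 := by
  have h := for_rule (i := 10) (P := .write 11 (.reg 10) (.const 1)) (s := s)
    (fun k s' => ∀ x < k, s'.arr 11 x = 1) (fun _ _ _ h => h)
    (fun _ h => absurd h (by omega)) (by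
      intro k s' hk hF hi h x hx
      simp only [ForProgram.denote, arr_setCell, if_true, Expr.eval, hi, Function.update_apply]
      split_ifs with hxk
      · rfl
      · exact h x (by omega))
  exact funext fun x => h x (by rw [hn]; exact x.2)

theorem loadSet_spec (hn : s.reg 0 = n) : supp n (loadSet.denote s) 5 = supp n s 8 := by
  have h := for_rule (i := 10) (P := .write 5 (.reg 10) (.cell 8 (.reg 10))) (s := s)
    (fun k s' => ∀ x < k, s'.arr 5 x = s.arr 8 x) (fun _ _ _ h => h)
    (fun _ h => absurd h (by omega)) (by
      intro k s' hk hF hi h x hx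
      simp only [ForProgram.denote, arr_setCell, if_true, Expr.eval, hi, Function.update_apply,
        hF.2 8 (by decide)]
      split_ifs with hxk
      · rw [hxk]
      · exact h x (by omega))
  ext x
  rw [mem_supp, mem_supp, loadSet, h x (by rw [hn]; exact x.2)]

/-! ### Correctness of the algorithm -/

/-- A cycle found inside a minimum dense set is itself dense and therefore uses all its vertices. -/
theorem firstCycle_spec {w : Fin n → ℕ} (hG : HasGraph s H) (hw : ∀ x, 0 < w x)
    (hC : MinDense H w (supp n s 8)) :
    ∃ (u : Fin n) (p : H.Walk u u), p.IsCycle ∧ p.support.toFinset = supp n s 8 ∧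
      p.support.map (fun v : Fin n => (v : ℕ)) = (firstCycle.denote s).list 1 := by
  have h5 := loadSet_spec hG.reg_zero
  have hG₁ : HasGraph (loadSet.denote s) H := hG.denote (by decide) (by decide) (by decide)
  have hG₂ : HasGraph (findMember.denote (loadSet.denote s)) H :=
    hG₁.denote (by decide) (by decide) (by decide)
  have h5' : supp n (findMember.denote (loadSet.denote s)) 5 = supp n s 8 :=
    (supp_congr (arr_denote findMember (by decide) _)).trans h5
  have hm := findMember_spec hG₁.reg_zero
  rw [h5] at hm
  rcases hm with ⟨-, h⟩ | ⟨-, x, hx, h15⟩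
  · exact absurd h hC.nonempty.ne_empty
  · obtain ⟨u, p, hp, hpC, hpl⟩ := findCycle_spec (Or.inl rfl) hG₂ (by rw [h5']; exact hC.dense)
      (by rw [h5']; exact hx) h15
    rw [h5'] at hpC
    exact ⟨u, p, hp, hC.eq_of_subset hw (fun y hy => hpC y (List.mem_toFinset.1 hy))
      ⟨u, by simp⟩ (dense_of_isCycle hp), hpl⟩

/-- The core of the complement of the ball contains every dense set that avoids the ball. If it is
empty, every nonempty dense set meets the ball; otherwise it is a dense set at distance more than
`d` from `C`. -/
theorem shrink_spec (hG : HasGraph s H) (h3 : s.reg 3 = d) (h4 : s.reg 4 = n * n)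
    (hL : Lists s C) :
    values n (shrink.denote s) 11 = (fun _ => 1) ∧
      (((shrink.denote s).reg 14 = 0 ∧ ∀ U : Finset (Fin n), U.Nonempty → Dense H U →
          ∃ u ∈ U, ∃ c ∈ C, ∃ p : H.Walk c u, p.length ≤ d) ∨
        ((shrink.denote s).reg 14 ≠ 0 ∧ Dense H (supp n (shrink.denote s) 5) ∧
          (∃ x ∈ supp n (shrink.denote s) 5, (shrink.denote s).reg 15 = x) ∧
          ∀ y ∈ supp n (shrink.denote s) 5, ∀ c ∈ C, ∀ p : H.Walk c y, ¬ p.length ≤ d)) := by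
  set s₁ := unitWeights.denote s with hs₁
  set s₂ := (ballDist (.const 1)).denote s₁ with hs₂
  set s₃ := complBall.denote s₂ with hs₃
  set s₄ := peel.denote s₃ with hs₄
  have e : shrink.denote s = findMember.denote s₄ := rfl
  have F₁ := frame_denote unitWeights s
  have F₂ := frame_denote (ballDist (.const 1)) s₁
  have F₃ := frame_denote complBall s₂
  have F₄ := frame_denote peel s₃
  have F₅ := frame_denote findMember s₄
  have hG₁ : HasGraph s₁ H := hG.denote (by decide) (by decide) (by decide)
  have hG₂ : HasGraph s₂ H := hG₁.denote (by decide) (by decide) (by decide)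
  have hG₃ : HasGraph s₃ H := hG₂.denote (by decide) (by decide) (by decide)
  have hG₄ : HasGraph s₄ H := hG₃.denote (by decide) (by decide) (by decide)
  have hu : values n s₁ 11 = fun _ => 1 := unitWeights_spec hG.reg_zero
  obtain ⟨hD, hR⟩ := ballDist_spec (e := .const 1) hG₁ ((F₁.1 4 (by decide)).trans h4) hu
    (hL.congr (F₁.1 1 (by decide)) (F₁.2 1 (by decide))) (fun _ => True)
    (by intro _ _ _ _; simp [Expr.eval])
  rw [Finset.filter_true, ← hs₂] at hD
  rw [← hs₂] at hR
  have hc := complBall_spec (d := d) hG₂.reg_zero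
    ((F₂.1 3 (by decide)).trans ((F₁.1 3 (by decide)).trans h3))
    ((F₂.1 4 (by decide)).trans ((F₁.1 4 (by decide)).trans h4))
  have hK := peel_spec hG₃
  rw [← hs₄] at hK
  rw [← hs₃] at hc
  have h5 : supp n (findMember.denote s₄) 5 = supp n s₄ 5 := supp_congr (F₅.2 5 (by decide))
  rw [e, h5]
  refine ⟨?_, ?_⟩
  · rw [values_congr (F₅.2 11 (by decide)), values_congr (F₄.2 11 (by decide)),
      values_congr (F₃.2 11 (by decide)), values_congr (F₂.2 11 (by decide)), hu]
  · refine (findMember_spec hG₄.reg_zero).imp (fun ⟨h, h'⟩ => ⟨h, fun U hne hU => ?_⟩)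
      (fun ⟨h, h'⟩ => ⟨h, hK.dense, h', fun y hy c hc' p hp => ?_⟩)
    · by_contra! hcon
      have hsub : U ⊆ supp n s₃ 5 := by
        intro x hx
        rw [hc]
        rintro ⟨h1, h2⟩
        obtain ⟨a, ha, p, hp⟩ := hD.exists_walk h1
        exact absurd (hp.trans h2) (not_le.2 (hcon x hx a ha p))
      have := hK.max U hsub hU
      rw [h'] at this
      obtain ⟨x, hx⟩ := hne
      exact absurd (this hx) (Finset.notMem_empty x)
    · exact (hc y).1 (hK.subset hy) (hD.lt_and_le_of_walk hR hc' p hp)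

open scoped Classical in
-- The distance of the extra vertex `c` is set to `0` only after the relaxation, so `c` enters the
-- list but no ball around it does.
theorem outputBall_spec (hG : HasGraph s H) (h3 : s.reg 3 = d) (h4 : s.reg 4 = n * n)
    (h11 : values n s 11 = fun _ => 1) (hbr : ∀ x : Fin n, s.arr 4 x ≠ 0 ↔ Branch H x)
    (hL : Lists s C) (hne : C.Nonempty) :
    (outputBall.denote s).reg 6 = 0 ∧ ∃ l : List (Fin n), l.Nodup ∧
      l.map (fun v : Fin n => (v : ℕ)) = (outputBall.denote s).list 1 ∧
      ∃ c ∈ C, c ∈ l ∧ ContainsBall H d (C.filter (Branch H)) l.toFinset ∧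
        ∀ x ∈ l, x = c ∨ ∃ a ∈ C.filter (Branch H), ∃ p : H.Walk a x, p.length ≤ d := by
  obtain ⟨hD, hR⟩ := ballDist_spec (e := .cell 4 (.cell 1 (.reg 10))) hG h4 h11 hL (Branch H) (by
    intro s' x hF hx
    simp only [Expr.eval, hF.2 4 (by decide), hF.2 1 (by decide), hx]
    exact hbr x)
  have F := frame_denote (ballDist (.cell 4 (.cell 1 (.reg 10)))) s
  set s₁ := (ballDist (.cell 4 (.cell 1 (.reg 10)))).denote s with hs₁
  obtain ⟨y, hy⟩ := hne
  obtain ⟨i, hin, hi, -⟩ := hL.1 y hy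
  obtain ⟨c, hc, h1c⟩ := hL.2 0 (by omega)
  set s₂ := setCell s₁ 6 c 0 with hs₂
  have e : (outputBall.denote s) = setReg (listBall.denote s₂) 6 0 := by
    simp [outputBall, ForProgram.denote, Expr.eval, ← hs₁, F.2 1 (by decide), h1c, ← hs₂]
  have hG₂ : HasGraph s₂ H := (hG.denote (P := ballDist (.cell 4 (.cell 1 (.reg 10)))) (by decide)
    (by decide) (by decide)).congr rfl (by simp [hs₂, hs₁]) (by simp [hs₂, hs₁])
  obtain ⟨l, l1, l2, l3⟩ := listBall_spec (d := d) hG₂.reg_zero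
    ((F.1 3 (by decide)).trans h3) ((F.1 4 (by decide)).trans h4)
  have hnear : ∀ x, IsNear s₂ d x ↔ x = c ∨ IsNear s₁ d x := by
    intro x
    simp only [IsNear, values, hs₂, arr_setCell, if_true, Function.update_apply, ← Fin.ext_iff]
    split_ifs with hx
    · simp only [hx, true_or, iff_true]
      have : 0 < n := by omega
      exact ⟨by positivity, Nat.zero_le _⟩
    · simp [hx]
  rw [e]
  refine ⟨by simp, l, l1, ?_, c, hc, ?_, fun a ha x p hp => ?_, fun x hx => ?_⟩
  · rw [l3, list_setReg (by decide)]
  · rw [l2, hnear]; exact Or.inl rfl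
  · rw [List.mem_toFinset, l2, hnear]
    exact Or.inr (hD.lt_and_le_of_walk hR ha p hp)
  · rw [l2, hnear] at hx
    refine hx.imp id fun ⟨h1, h2⟩ => ?_
    obtain ⟨a, ha, p, hp⟩ := hD.exists_walk h1
    exact ⟨a, ha, p, hp.trans h2⟩

open scoped Classical in
theorem output_spec {w : Fin n → ℕ} (hG : HasGraph s H) (h3 : s.reg 3 = d) (h4 : s.reg 4 = n * n)
    (hbr : ∀ x : Fin n, s.arr 4 x ≠ 0 ↔ Branch H x) (hw : ∀ x, 0 < w x)
    (hC : MinDense H w (supp n s 8)) :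
    ((output.denote s).reg 6 = 1 ∧ ∃ (u : Fin n) (p : H.Walk u u) (v : Fin n) (q : H.Walk v v),
      p.IsCycle ∧ q.IsCycle ∧
      p.support.map (fun v : Fin n => (v : ℕ)) = (output.denote s).list 1 ∧
      q.support.map (fun v : Fin n => (v : ℕ)) = (output.denote s).list 2 ∧
      ∀ x ∈ p.support, ∀ y ∈ q.support, ∀ r : H.Walk x y, ¬ r.length ≤ d) ∨
    ((output.denote s).reg 6 = 0 ∧ (∀ U : Finset (Fin n), U.Nonempty → Dense H U →
        ∃ u ∈ U, ∃ c ∈ supp n s 8, ∃ p : H.Walk c u, p.length ≤ d) ∧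
      ∃ l : List (Fin n), l.Nodup ∧
        l.map (fun v : Fin n => (v : ℕ)) = (output.denote s).list 1 ∧
        ∃ c ∈ supp n s 8, c ∈ l ∧
          ContainsBall H d ((supp n s 8).filter (Branch H)) l.toFinset ∧
          ∀ x ∈ l, x = c ∨
            ∃ a ∈ (supp n s 8).filter (Branch H), ∃ p : H.Walk a x, p.length ≤ d) := by
  obtain ⟨u, p, hp, hpC, hpl⟩ := firstCycle_spec hG hw hC
  set s₁ := firstCycle.denote s with hs₁
  set s₂ := shrink.denote s₁ with hs₂
  have F₁ := frame_denote firstCycle s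
  have F₂ := frame_denote shrink s₁
  have hG₁ : HasGraph s₁ H := hG.denote (by decide) (by decide) (by decide)
  have hG₂ : HasGraph s₂ H := hG₁.denote (by decide) (by decide) (by decide)
  have hL := lists_of_isCycle hp hpl
  rw [hpC] at hL
  have h3₁ : s₁.reg 3 = d := (F₁.1 3 (by decide)).trans h3
  have h4₁ : s₁.reg 4 = n * n := (F₁.1 4 (by decide)).trans h4
  obtain ⟨h11, h⟩ := shrink_spec hG₁ h3₁ h4₁ hL
  have e : output.denote s = if s₂.reg 14 ≠ 0 then setReg ((findCycle 2).denote s₂) 6 1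
      else outputBall.denote s₂ := rfl
  rcases h with ⟨h14, hB⟩ | ⟨h14, hd, ⟨x, hx, h15⟩, hfar⟩
  · right
    rw [e, if_neg (not_not.2 h14)]
    obtain ⟨r1, r2⟩ := outputBall_spec (d := d) hG₂ ((F₂.1 3 (by decide)).trans h3₁)
      ((F₂.1 4 (by decide)).trans h4₁) h11
      (by rw [F₂.2 4 (by decide), F₁.2 4 (by decide)]; exact hbr)
      (hL.congr (F₂.1 1 (by decide)) (F₂.2 1 (by decide))) hC.nonempty
    exact ⟨r1, hB, r2⟩
  · left
    rw [e, if_pos h14]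
    obtain ⟨v, q, hq, hq', hql⟩ := findCycle_spec (Or.inr rfl) hG₂ hd hx h15
    have F₃ := frame_denote (findCycle 2) s₂
    refine ⟨by simp, u, p, v, q, hp, hq, ?_, ?_, fun x hx y hy r => hfar y (hq' y hy) x ?_ r⟩
    · rw [hpl, list_setReg (by decide),
        list_congr (F₃.1 1 (by decide)) (F₃.2 1 (by decide)),
        list_congr (F₂.1 1 (by decide)) (F₂.2 1 (by decide))]
    · rw [hql, list_setReg (by decide)]
    · rw [← hpC, List.mem_toFinset]; exact hx

end

/-! ### The size bound and the whole algorithm -/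

section

variable {n d : ℕ} {G : SimpleGraph (Fin n)}

theorem sum_pow_le {t : ℕ} (ht : 2 ≤ t) (d : ℕ) : ∑ i ∈ Finset.range (d + 1), t ^ i ≤ 2 * t ^ d := by
  induction d with
  | zero => simp
  | succ d ih =>
    rw [Finset.sum_range_succ, pow_succ]
    nlinarith [Nat.mul_le_mul_left (t ^ d) ht]

/-- Since `d` is positive, `4 * d + 12` is at most `16 * d`. The geometric sum is at most `2 * t ^
d`, which gives the factor `32`, and the extra vertex raises it to `33`. The argument only needs `t
^ d`. -/
theorem ball_bound {t m : ℕ} (ht : 2 ≤ t) (hd : 0 < d) (hm : m ≤ 4 * d + 12) :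
    m * ∑ i ∈ Finset.range (d + 1), t ^ i + 1 ≤ 33 * (d * t ^ (2 * d)) := by
  have h1 : 1 ≤ t ^ d := Nat.one_le_pow _ _ (by omega)
  have h2 : t ^ d ≤ t ^ (2 * d) := Nat.pow_le_pow_right (by omega) (by omega)
  calc m * ∑ i ∈ Finset.range (d + 1), t ^ i + 1 ≤ (16 * d) * (2 * t ^ d) + 1 * 1 :=
        Nat.add_le_add_right (Nat.mul_le_mul (by omega) (sum_pow_le ht d)) _
    _ ≤ (16 * d) * (2 * t ^ d) + d * t ^ d := Nat.add_le_add_left (Nat.mul_le_mul hd h1) _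
    _ = 33 * (d * t ^ d) := by ring
    _ ≤ 33 * (d * t ^ (2 * d)) := by gcongr

theorem mem_of_mem_support_of_isCycle {K : Finset (Fin n)} {u x : Fin n}
    {p : (restrict G K).Walk u u} (hp : p.IsCycle) (hx : x ∈ p.support) : x ∈ K := by
  obtain ⟨y, -, z, -, -, h, -⟩ := dense_of_isCycle hp x (List.mem_toFinset.2 hx)
  exact h.2.1

/-- The form in which the output formats coerce a list of vertices. -/
theorem map_coe_list (l : List (Fin n)) :
    ((do let a ← l; pure (a : ℕ)) : List ℕ).map (fun v => v) = l.map fun v : Fin n => (v : ℕ) := by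
  induction l with
  | nil => rfl
  | cons a l ih => simpa using ih

/-- The algorithm measures distances in the core. A short path of `G` between the two cycles would
stay in the core, so the cycles are also far apart in `G`. -/
theorem outputsPacking_of_walks {s : Memory} (h0 : s.reg 0 = 1) {K : Finset (Fin n)}
    (hK : IsCore G Finset.univ K) {u v : Fin n} {p : (restrict G K).Walk u u}
    {q : (restrict G K).Walk v v} (hp : p.IsCycle) (hq : q.IsCycle)
    (hp1 : p.support.map (fun v : Fin n => (v : ℕ)) = s.list 1)
    (hq2 : q.support.map (fun v : Fin n => (v : ℕ)) = s.list 2)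
    (hfar : ∀ x ∈ p.support, ∀ y ∈ q.support, ∀ r : (restrict G K).Walk x y, ¬ r.length ≤ d) :
    OutputsPacking G d s := by
  have hfar' : ∀ x ∈ p.support, ∀ y ∈ q.support, ∀ r : G.Walk x y, r.IsPath → ¬ r.length ≤ d := by
    intro x hx y hy r hr hle
    obtain ⟨r', hr'⟩ := hK.exists_walk (mem_of_mem_support_of_isCycle hp hx)
      (mem_of_mem_support_of_isCycle hq hy) hr
    exact hfar x hx y hy r' (hr'.trans_le hle)
  have hle : restrict G K ≤ G := restrict_le
  have hp' : (p.mapLe hle).IsCycle := hp.mapLe hle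
  have hq' : (q.mapLe hle).IsCycle := hq.mapLe hle
  have hps : (p.mapLe hle).support = p.support := by simp
  have hqs : (q.mapLe hle).support = q.support := by simp
  have hne : (p.mapLe hle).toSubgraph ≠ (q.mapLe hle).toSubgraph := by
    intro he
    have hu : u ∈ (q.mapLe hle).toSubgraph.verts := by rw [← he]; simp
    rw [SimpleGraph.Walk.mem_verts_toSubgraph, hqs] at hu
    exact hfar u p.start_mem_support u hu .nil (Nat.zero_le _)
  refine ⟨h0, _, _, hne, ⟨?_, ?_⟩, ⟨u, _, hp', rfl, ?_⟩, ⟨v, _, hq', rfl, ?_⟩⟩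
  · rintro C (rfl | rfl)
    · exact ⟨u, _, hp', rfl⟩
    · exact ⟨v, _, hq', rfl⟩
  · rintro C (rfl | rfl) D (rfl | rfl) hCD x hx y hy r hr
    · exact absurd rfl hCD
    · rw [SimpleGraph.Walk.mem_verts_toSubgraph, hps] at hx
      rw [SimpleGraph.Walk.mem_verts_toSubgraph, hqs] at hy
      exact hfar' x hx y hy r hr
    · rw [SimpleGraph.Walk.mem_verts_toSubgraph, hqs] at hx
      rw [SimpleGraph.Walk.mem_verts_toSubgraph, hps] at hy
      rw [← SimpleGraph.Walk.length_reverse]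
      exact hfar' y hy x hx r.reverse hr.reverse
    · exact absurd rfl hCD
  · rw [hps]; exact (map_coe_list _).trans hp1
  · rw [hqs]; exact (map_coe_list _).trans hq2

theorem mainProgram_spec (hd : 0 < d) {t : ℕ} [DecidableRel G.Adj] (ht : G.maxDegree ≤ t) :
    OutputsPacking G d
        (setReg (mainProgram.denote (inputMemory G d)) 0
          ((mainProgram.denote (inputMemory G d)).reg 6)) ∨
      OutputsFeedbackVertexSet G (33 * (d * t ^ (2 * d)))
        (setReg (mainProgram.denote (inputMemory G d)) 0
          ((mainProgram.denote (inputMemory G d)).reg 6)) := by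
  classical
  obtain ⟨K, hK, hG, h3, h4, hbr, h11⟩ := setup_spec G d
  set H := restrict G K with hH
  have F₁ := frame_denote setup (inputMemory G d)
  set s₁ := setup.denote (inputMemory G d) with hs₁
  set w : Fin n → ℕ := fun x => if Branch H x then n else 1 with hwdef
  have hw : ∀ x, 0 < w x := fun x => by
    have := x.2
    simp only [hwdef]; split_ifs <;> omega
  have hwn : ∀ x, w x ≤ n := fun x => by
    have := x.2
    simp only [hwdef]; split_ifs <;> omega
  have hl := findLightest_spec hG hw hwn h11 h4
    (fun i => by rw [F₁.2 7 (by decide)]; simp [inputMemory])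
    (by rw [F₁.1 23 (by decide)]; simp [inputMemory])
  have F₂ := frame_denote findLightest s₁
  set s₂ := findLightest.denote s₁ with hs₂
  have hG₂ : HasGraph s₂ H := hG.denote (by decide) (by decide) (by decide)
  have e : mainProgram.denote (inputMemory G d) =
      if s₂.reg 23 ≠ 0 then output.denote s₂ else setReg (setReg s₂ 1 0) 6 0 := rfl
  rw [e]
  rcases hl with ⟨h23, hno⟩ | ⟨h23, hC⟩
  · right
    rw [if_neg (not_not.2 h23)]
    refine ⟨by simp, ∅, by simp, isFeedbackVertexSet_of_dense fun U hne hU => ?_, [], by simp, rfl, ?_⟩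
    · exact absurd (hno U (hK.dense_restrict hU)) hne.ne_empty
    · simp [Memory.list]
  · rw [if_pos h23]
    rcases output_spec hG₂ ((F₂.1 3 (by decide)).trans h3) ((F₂.1 4 (by decide)).trans h4)
      (by rw [F₂.2 4 (by decide)]; exact hbr) hw hC with
      ⟨h6, u, p, v, q, hp, hq, hp1, hq2, hfar⟩ | ⟨h6, hB, l, l1, l2, c, hc, hcl, hX, hlX⟩
    · left
      exact outputsPacking_of_walks (by simp [h6]) hK hp hq
        (by rw [hp1, list_setReg (by decide)]) (by rw [hq2, list_setReg (by decide)]) hfar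
    · right
      have hdeg : ∀ x, (Finset.univ.filter (H.Adj x)).card ≤ t := fun x => by
        refine le_trans (Finset.card_le_card fun y hy => ?_)
          ((G.degree_le_maxDegree x).trans ht)
        rw [SimpleGraph.mem_neighborFinset]
        exact (Finset.mem_filter.1 hy).2.1
      -- A vertex of `C` has two neighbours; the bound on the geometric sum needs this.
      have ht2 : 2 ≤ t := by
        obtain ⟨x, hx⟩ := hC.nonempty
        obtain ⟨y, -, z, -, hyz, hy, hz⟩ := hC.dense x hx
        refine le_trans ?_ (hdeg x)
        exact Finset.one_lt_card.2 ⟨y, by simpa using hy, z, by simpa using hz, hyz⟩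
      have hcard := hC.card_branch_le (d := d) (fun x => by rw [Fintype.card_fin])
        (fun x y h => hK.exists_adj h) hB
      have hball := card_le_of_ball hdeg (X := l.toFinset.erase c)
        (S := (supp n s₂ 8).filter (Branch H)) (d := d) fun x hx => by
          obtain ⟨hxc, hx⟩ := Finset.mem_erase.1 hx
          exact (hlX x (List.mem_toFinset.1 hx)).resolve_left hxc
      refine ⟨by simp [h6], l.toFinset, ?_, isFeedbackVertexSet_of_dense fun U hne hU => ?_, l, l1,
        by ext; simp, ?_⟩
      · have h1 := ball_bound ht2 hd hcard
        have h2 := Finset.card_erase_add_one (List.mem_toFinset.2 hcl)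
        omega
      · exact hC.exists_mem_of_ball hw hB hc (List.mem_toFinset.2 hcl) hX hne (hK.dense_restrict hU)
      · rw [list_setReg (by decide), ← l2]; exact map_coe_list l

end

end CoarseErdosPosa
open CoarseErdosPosa in
theorem corollary1p7 :
    ∃ (P : Program) (p : Polynomial ℕ) (c : ℕ),
      ∀ (d t : ℕ), 0 < d → 0 < t →
        ∀ (n : ℕ) (G : SimpleGraph (Fin n)) [DecidableRel G.Adj], G.maxDegree ≤ t →
          ∃ (T : ℕ) (s : Memory), Runs P (inputMemory G d) T s ∧ T ≤ p.eval n ∧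
            (OutputsPacking G d s ∨ OutputsFeedbackVertexSet G (c * (d * t ^ (2 * d))) s) := by
  -- Register `0` bounds all loops and must not change before they end, so the kind of the output
  -- waits in register `6` and is moved by one last assignment of cost `2`.
  refine ⟨.seq mainProgram.compile (.assign 0 (.reg 6)), mainProgram.cost + Polynomial.C 2, 33,
    fun d t hd _ n G _ ht => ?_⟩
  obtain ⟨T, hT, hTle⟩ := ForProgram.runs_compile mainProgram (by decide) (by decide)
    (inputMemory G d)
  refine ⟨_, _, .seq hT (.assign _ _ _), ?_, mainProgram_spec hd ht⟩
  rw [Polynomial.eval_add, Polynomial.eval_C]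
  exact Nat.add_le_add hTle le_rfl
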